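/- Let $V,H$ be real separable Hilbert spaces with $V$ compactly and densely embedded into $H$, and let $C_{V,H}>0$ satisfy $\|v\|_H\le C_{V,H}\|v\|_V$ for all $v\in V$. Identify $H$ with its dual, so that $V\hookrightarrow H\cong H^*\hookrightarrow V^*$. Write $\mathrm{HS}(X,Y)$ for the Hilbert space of Hilbert–Schmidt operators $X\to Y$, and put $$\mathcal V=\mathrm{HS}(V^*,H)\cap \mathrm{HS}(H,V),\qquad \mathcal H=\mathrm{HS}(H,H),\qquad \mathcal V^*=\mathrm{HS}(V,H)+\mathrm{HS}(H,V^*),$$ where $(R,S)_{\mathcal V}=(R,S)_{\mathrm{HS}(V^*,H)}+(R,S)_{\mathrm{HS}(H,V)}$, and $\mathcal V^*$ is identified with the dual of $\mathcal V$ (and carries the dual norm) through the pairing $\langle\cdot,\cdot\rangle$ on $\mathcal V^*\times\mathcal V$ that extends the inner product of $\mathcal H$. For self-adjoint $P\in\mathcal H$ and $c\in\mathbb R$ write $P\ge c$ if $(Pu,u)_H\ge c\|u\|_H^2$ for all $u\in H$. Let $T>0$ and, for each $t\in[0,T]$, let $a(t;\cdot,\cdot):V\times V\to\mathbb R$ be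 bilinear. Assume that there are constants $\mu,\eta>0$ with $a(t;u,u)\ge\mu\|u\|_V^2$ and $|a(t;u,v)|\le\eta\|u\|_V\|v\|_V$ for all $t\in[0,T]$ and $u,v\in V$, and that $t\mapsto a(t;u,v)$ is Lebesgue measurable for all $u,v\in V$. Define $\mathcal A(t),\mathcal A^*(t):V\to V^*$ by $\langle \mathcal A(t)u,v\rangle=a(t;u,v)$ and $\langle \mathcal A^*(t)u,v\rangle=a(t;v,u)$. Let $$\mathcal W=\{P\in L^2(0,T;\mathcal V): P'\in L^1(0,T;\mathcal H)+L^2(0,T;\mathcal V^*)\},$$ where $P'$ is the weak derivative; elements of $\mathcal W$ are evaluated at points $t\in[0,T]$ through their representative in $C([0,T];\mathcal H)$. Let $0\le\gamma<\mu/C_{V,H}^2$. Let $Q\in L^1(0,T;\mathcal H)+L^2(0,T;\mathcal V^*)$ be such that for almost every $t\in[0,T]$ the value $Q(t)$ lies in $\mathcal H$, is self-adjoint, and satisfies $Q(t)\ge-\gamma^2$. Let $P_0\in\mathcal H$ be self-adjoint with $P_0\ge-\gamma$. Then there is a $P\in\mathcal W$ such that $P(t)$ is self-adjoint with $P(t)\ge-\gamma$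 for every $t\in[0,T]$, and such that $P$ is a weak solution of $$P'+\mathcal A^*P+P\mathcal A+P^2=Q\ \text{ on }(0,T),\qquad P(0)=P_0,$$ that is, $P(0)=P_0$ and, for every $R\in\mathcal V$ and every $\varphi\in C_c^\infty(0,T)$, $$-\int_0^T\langle P(t),R\rangle\varphi'(t)\,dt+\int_0^T\langle \mathcal A^*(t)P(t)+P(t)\mathcal A(t)+P(t)^2,R\rangle\varphi(t)\,dt=\int_0^T\langle Q(t),R\rangle\varphi(t)\,dt .$$ This solution is unique among the weak solutions $P\in\mathcal W$ for which $P(t)$ is self-adjoint with $P(t)\ge-\gamma$ for every $t\in[0,T]$. -/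

import Mathlib

open MeasureTheory Set
open scoped ContDiff

noncomputable section

namespace RiccatiHS

/-! ### Hilbert–Schmidt operators -/

section HilbertSchmidt

variable {X Y Z : Type*}
  [NormedAddCommGroup X] [InnerProductSpace ℝ X] [CompleteSpace X]
  [NormedAddCommGroup Y] [InnerProductSpace ℝ Y]
  [NormedAddCommGroup Z] [InnerProductSpace ℝ Z]

variable (X) in
/-- The index set of a fixed orthonormal basis of `X`. -/
def onbIndex : Set X := (exists_hilbertBasis ℝ X).choose

variable (X) in
/-- A fixed orthonormal basis of the Hilbert space `X`. -/
def onb : HilbertBasis (onbIndex X) ℝ X := (exists_hilbertBasis ℝ X).choose_spec.choose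

/-- `T` is Hilbert–Schmidt: `∑ ‖T eₙ‖² < ∞` for an orthonormal basis `(eₙ)`. The value of the sum
does not depend on the basis, see `tsum_sq_eq` below. -/
def IsHS (T : X →L[ℝ] Y) : Prop := Summable fun i => ‖T (onb X i)‖ ^ 2

theorem IsHS.summable_inner {S T : X →L[ℝ] Y} (hS : IsHS S) (hT : IsHS T) :
    Summable fun i => inner ℝ (S (onb X i)) (T (onb X i)) := by
  refine Summable.of_norm_bounded (hS.add hT) fun i => ?_
  refine (norm_inner_le_norm _ _).trans ?_
  nlinarith [sq_nonneg (‖S (onb X i)‖ - ‖T (onb X i)‖), sq_nonneg ‖S (onb X i)‖,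
    sq_nonneg ‖T (onb X i)‖]

variable (X Y) in
/-- The Hilbert–Schmidt operators as a linear subspace of the bounded operators. -/
def hsSubmodule : Submodule ℝ (X →L[ℝ] Y) where
  carrier := {T | IsHS T}
  zero_mem' := by simp [IsHS, summable_zero]
  add_mem' := by
    intro S T hS hT
    refine Summable.of_nonneg_of_le (fun i => sq_nonneg _) (fun i => ?_)
      ((hS.mul_left 2).add (hT.mul_left 2))
    have h := norm_add_le (S (onb X i)) (T (onb X i))
    have h0 := norm_nonneg (S (onb X i) + T (onb X i))
    simp only [add_apply]
    nlinarith [sq_nonneg (‖S (onb X i)‖ - ‖T (onb X i)‖)]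
  smul_mem' := by
    intro c T hT
    have h := Summable.mul_left (‖c‖ ^ 2) hT
    simpa [IsHS, norm_smul, mul_pow] using h

variable (X Y) in
/-- The space `HS(X, Y)` of Hilbert–Schmidt operators (with the Hilbert–Schmidt norm, not the
operator norm). -/
def HS : Type _ := hsSubmodule X Y

instance : AddCommGroup (HS X Y) := inferInstanceAs (AddCommGroup (hsSubmodule X Y))

instance : Module ℝ (HS X Y) := inferInstanceAs (Module ℝ (hsSubmodule X Y))

namespace HS

/-- The bounded operator underlying a Hilbert–Schmidt operator. -/
def op : HS X Y →ₗ[ℝ] (X →L[ℝ] Y) := (hsSubmodule X Y).subtype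

/-- A Hilbert–Schmidt operator, from a bounded operator and the summability of the squares. -/
def mk (T : X →L[ℝ] Y) (hT : IsHS T) : HS X Y := ⟨T, hT⟩

@[simp] theorem op_mk (T : X →L[ℝ] Y) (hT : IsHS T) : (mk T hT).op = T := rfl

theorem isHS (T : HS X Y) : IsHS T.op := T.2

theorem op_injective : Function.Injective (op : HS X Y →ₗ[ℝ] (X →L[ℝ] Y)) :=
  Subtype.val_injective

/-- The inner product `(S, T) = ∑ (S eₙ, T eₙ)`. -/
@[reducible] def core : InnerProductSpace.Core ℝ (HS X Y) where
  inner S T := ∑' i, inner ℝ (S.op (onb X i)) (T.op (onb X i))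
  conj_inner_symm S T := by
    simp only [conj_trivial]
    exact tsum_congr fun i => real_inner_comm _ _
  re_inner_nonneg S := by
    simp only [RCLike.re_to_real]
    exact tsum_nonneg fun i => real_inner_self_nonneg
  add_left R S T := by
    rw [← (R.isHS.summable_inner T.isHS).tsum_add (S.isHS.summable_inner T.isHS)]
    exact tsum_congr fun i => by simp [inner_add_left]
  smul_left S T c := by
    rw [← tsum_mul_left]
    exact tsum_congr fun i => by simp [real_inner_smul_left]
  definite S hS := by
    have h := (S.isHS.summable_inner S.isHS).hasSum
    rw [hS, hasSum_zero_iff_of_nonneg fun i => real_inner_self_nonneg] at h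
    apply op_injective
    refine ContinuousLinearMap.ext_on (Submodule.dense_iff_topologicalClosure_eq_top.mpr
      (onb X).dense_span) ?_
    rintro _ ⟨i, rfl⟩
    have h1 := congrFun h i
    simpa using h1

instance : NormedAddCommGroup (HS X Y) := core.toNormedAddCommGroup

instance : InnerProductSpace ℝ (HS X Y) := InnerProductSpace.ofCore core.toCore

theorem inner_eq (S T : HS X Y) :
    inner ℝ S T = ∑' i, inner ℝ (S.op (onb X i)) (T.op (onb X i)) := rfl

theorem norm_sq_eq (S : HS X Y) : ‖S‖ ^ 2 = ∑' i, ‖S.op (onb X i)‖ ^ 2 := by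
  rw [← real_inner_self_eq_norm_sq, inner_eq]
  exact tsum_congr fun i => real_inner_self_eq_norm_sq _

end HS

theorem IsHS.compLeft {T : X →L[ℝ] Y} (hT : IsHS T) (B : Y →L[ℝ] Z) : IsHS (B.comp T) := by
  refine Summable.of_nonneg_of_le (fun i => sq_nonneg _) (fun i => ?_) (hT.mul_left (‖B‖ ^ 2))
  rw [← mul_pow]
  exact pow_le_pow_left₀ (norm_nonneg _) (B.le_opNorm _) 2

theorem tsum_inner_sq {κ : Type*} (b : HilbertBasis κ ℝ X) (x : X) :
    ∑' i, ENNReal.ofReal (inner ℝ x (b i) ^ 2) = ENNReal.ofReal (‖x‖ ^ 2) := by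
  have h := b.hasSum_inner_mul_inner x x
  have h' : HasSum (fun i => inner ℝ x (b i) ^ 2) (‖x‖ ^ 2) := by
    rw [real_inner_self_eq_norm_sq] at h
    refine h.congr_fun fun i => ?_
    rw [sq, real_inner_comm x (b i)]
  rw [← h'.tsum_eq, ENNReal.ofReal_tsum_of_nonneg (fun i => sq_nonneg _) h'.summable]

theorem tsum_sq_adjoint [CompleteSpace Y] {κ κ' : Type*} (b : HilbertBasis κ ℝ X)
    (c : HilbertBasis κ' ℝ Y) (T : X →L[ℝ] Y) :
    ∑' i, ENNReal.ofReal (‖T (b i)‖ ^ 2) =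
      ∑' j, ENNReal.ofReal (‖ContinuousLinearMap.adjoint T (c j)‖ ^ 2) := by
  calc ∑' i, ENNReal.ofReal (‖T (b i)‖ ^ 2)
      = ∑' i, ∑' j, ENNReal.ofReal (inner ℝ (T (b i)) (c j) ^ 2) :=
        tsum_congr fun i => (tsum_inner_sq c _).symm
    _ = ∑' j, ∑' i, ENNReal.ofReal (inner ℝ (T (b i)) (c j) ^ 2) := ENNReal.tsum_comm
    _ = ∑' j, ∑' i, ENNReal.ofReal (inner ℝ (ContinuousLinearMap.adjoint T (c j)) (b i) ^ 2) := by
        refine tsum_congr fun j => tsum_congr fun i => ?_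
        rw [ContinuousLinearMap.adjoint_inner_left, real_inner_comm]
    _ = _ := tsum_congr fun j => tsum_inner_sq b _

/-- The Hilbert–Schmidt sum is independent of the orthonormal basis. -/
theorem tsum_sq_eq [CompleteSpace Y] {κ κ' : Type*} (b : HilbertBasis κ ℝ X)
    (b' : HilbertBasis κ' ℝ X) (T : X →L[ℝ] Y) :
    ∑' i, ENNReal.ofReal (‖T (b i)‖ ^ 2) = ∑' i, ENNReal.ofReal (‖T (b' i)‖ ^ 2) := by
  rw [tsum_sq_adjoint b (onb Y), tsum_sq_adjoint b' (onb Y)]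

theorem isHS_iff_tsum (T : X →L[ℝ] Y) :
    IsHS T ↔ ∑' i, ENNReal.ofReal (‖T (onb X i)‖ ^ 2) ≠ ⊤ := by
  constructor
  · intro h
    rw [← ENNReal.ofReal_tsum_of_nonneg (fun i => sq_nonneg _) h]
    exact ENNReal.ofReal_ne_top
  · intro h
    have h' := ENNReal.summable_toReal h
    simpa [IsHS, ENNReal.toReal_ofReal, sq_nonneg] using h'

theorem IsHS.compRight [CompleteSpace Y] [CompleteSpace Z] {T : Y →L[ℝ] Z} (hT : IsHS T)
    (B : X →L[ℝ] Y) : IsHS (T.comp B) := by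
  have hT' : IsHS (ContinuousLinearMap.adjoint T) := by
    rw [isHS_iff_tsum, ← tsum_sq_adjoint (onb Y) (onb Z)]
    exact (isHS_iff_tsum T).1 hT
  rw [isHS_iff_tsum, tsum_sq_adjoint (onb X) (onb Z), ContinuousLinearMap.adjoint_comp]
  exact (isHS_iff_tsum _).1 (hT'.compLeft _)

namespace HS

/-- Composition `B ∘ T` of a Hilbert–Schmidt operator `T` with a bounded operator `B`. -/
def compLeft (B : Y →L[ℝ] Z) (T : HS X Y) : HS X Z := mk (B.comp T.op) (T.isHS.compLeft B)

/-- Composition `T ∘ B` of a Hilbert–Schmidt operator `T` with a bounded operator `B`. -/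
def compRight [CompleteSpace Y] [CompleteSpace Z] (T : HS Y Z) (B : X →L[ℝ] Y) : HS X Z :=
  mk (T.op.comp B) (T.isHS.compRight B)

theorem norm_compLeft_le (B : Y →L[ℝ] Z) (T : HS X Y) : ‖compLeft B T‖ ≤ ‖B‖ * ‖T‖ := by
  refine (sq_le_sq₀ (norm_nonneg _) (by positivity)).1 ?_
  rw [mul_pow, norm_sq_eq, norm_sq_eq, ← tsum_mul_left]
  refine Summable.tsum_le_tsum (fun i => ?_) (compLeft B T).isHS (T.isHS.mul_left _)
  rw [← mul_pow]
  exact pow_le_pow_left₀ (norm_nonneg _) (B.le_opNorm _) 2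

/-- `T ↦ B ∘ T` as a bounded operator `HS(X, Y) → HS(X, Z)`. -/
def compLeftL (B : Y →L[ℝ] Z) : HS X Y →L[ℝ] HS X Z :=
  LinearMap.mkContinuous
    { toFun := compLeft B
      map_add' := fun S T => op_injective (by ext x; simp [compLeft])
      map_smul' := fun c T => op_injective (by ext x; simp [compLeft]) }
    ‖B‖ (norm_compLeft_le B)

/-- The square `P² = P ∘ P`. -/
def square (P : HS X X) : HS X X := compLeft P.op P

end HS

end HilbertSchmidt

/-! ### The Gelfand triple `V ⊆ H ⊆ V*` and the operator spaces `𝒱 ⊆ ℋ ⊆ 𝒱*` -/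

section Spaces

variable {V H : Type*}
  [NormedAddCommGroup V] [InnerProductSpace ℝ V] [CompleteSpace V]
  [NormedAddCommGroup H] [InnerProductSpace ℝ H] [CompleteSpace H]

variable (V) in
/-- The inverse Riesz isomorphism `V* → V`. -/
def riesz : StrongDual ℝ V →L[ℝ] V where
  toFun f := (InnerProductSpace.toDual ℝ V).symm f
  map_add' f g := by simp
  map_smul' c f := by simp
  cont := (InnerProductSpace.toDual ℝ V).symm.continuous

theorem norm_riesz (f : StrongDual ℝ V) : ‖riesz V f‖ = ‖f‖ :=
  (InnerProductSpace.toDual ℝ V).symm.norm_map f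

/-- The inner product on the dual `V*` of a Hilbert space; it induces the usual dual norm. -/
instance dualInner : InnerProductSpace ℝ (StrongDual ℝ V) where
  inner f g := inner ℝ (riesz V f) (riesz V g)
  norm_sq_eq_re_inner f := by simp [norm_riesz]
  conj_inner_symm f g := by simp [real_inner_comm]
  add_left f g h := by simp [inner_add_left]
  smul_left f g c := by simp [real_inner_smul_left]

/-- The embedding `H ≅ H* → V*`, `h ↦ (h, ι ·)_H`, induced by the embedding `ι : V → H`. -/
def toDualV (ι : V →L[ℝ] H) : H →L[ℝ] StrongDual ℝ V where
  toFun h := (innerSL ℝ h).comp ι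
  map_add' h k := by ext; simp
  map_smul' c h := by ext; simp
  cont := by fun_prop

/-- `𝒱 = HS(V*, H) ∩ HS(H, V)`. An element is a pair of operators `P₁ ∈ HS(V*, H)` and
`P₂ ∈ HS(H, V)` that coincide as elements of `L(V, V*)`. The inner product is
`(R, S) = (R₁, S₁)_{HS(V*, H)} + (R₂, S₂)_{HS(H, V)}`. -/
def opVSubmodule (ι : V →L[ℝ] H) :
    Submodule ℝ (WithLp 2 (HS (StrongDual ℝ V) H × HS H V)) where
  carrier := {P | ((toDualV ι).comp P.fst.op).comp ((toDualV ι).comp ι) =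
    ((toDualV ι).comp (ι.comp P.snd.op)).comp ι}
  zero_mem' := by simp
  add_mem' := by
    intro P R hP hR
    simp only [mem_ofPred_eq] at hP hR ⊢
    simp [ContinuousLinearMap.comp_add, ContinuousLinearMap.add_comp, hP, hR]
  smul_mem' := by
    intro c P hP
    simp only [mem_ofPred_eq] at hP ⊢
    simp [hP]

/-- The space `𝒱`. -/
abbrev OpV (ι : V →L[ℝ] H) : Type _ := opVSubmodule ι

/-- The dual space `𝒱*` of `𝒱`, with the dual norm. The duality pairing is the evaluation. -/
abbrev OpVDual (ι : V →L[ℝ] H) : Type _ := StrongDual ℝ (OpV ι)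

/-- `P ∈ 𝒱` as an operator `V* → H`. -/
def OpV.fromDual (ι : V →L[ℝ] H) : OpV ι →L[ℝ] HS (StrongDual ℝ V) H :=
  (WithLp.fstL 2 ℝ (HS (StrongDual ℝ V) H) (HS H V)).comp (opVSubmodule ι).subtypeL

/-- `P ∈ 𝒱` as an operator `H → V`. -/
def OpV.intoV (ι : V →L[ℝ] H) : OpV ι →L[ℝ] HS H V :=
  (WithLp.sndL 2 ℝ (HS (StrongDual ℝ V) H) (HS H V)).comp (opVSubmodule ι).subtypeL

/-- The embedding `𝒱 → ℋ = HS(H, H)`. -/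
def OpV.toHi (ι : V →L[ℝ] H) : OpV ι →L[ℝ] HS H H := (HS.compLeftL ι).comp (OpV.intoV ι)

/-- The embedding `ℋ → 𝒱*`, `K ↦ (K, ·)_ℋ`. -/
def hiToDual (ι : V →L[ℝ] H) (K : HS H H) : OpVDual ι := (innerSL ℝ K).comp (OpV.toHi ι)

/-- An operator `S ∈ HS(H, V*)` as an element of `𝒱*`: the pairing extends the inner product of
`ℋ`, `⟨S, R⟩ = ∑ ⟨S eₙ, R eₙ⟩_{V* × V}` with an orthonormal basis `(eₙ)` of `H`. -/
def ofIntoDual (ι : V →L[ℝ] H) (S : HS H (StrongDual ℝ V)) : OpVDual ι :=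
  (innerSL ℝ (HS.compLeft (riesz V) S)).comp (OpV.intoV ι)

theorem ofIntoDual_apply (ι : V →L[ℝ] H) (S : HS H (StrongDual ℝ V)) (R : OpV ι) :
    ofIntoDual ι S R = ∑' i, S.op (onb H i) ((OpV.intoV ι R).op (onb H i)) := by
  refine tsum_congr fun i => ?_
  exact InnerProductSpace.toDual_symm_apply

/-- An operator `S ∈ HS(V, H)` as an element of `𝒱*`: the pairing extends the inner product of
`ℋ`, `⟨S, R⟩ = ∑ (S J⁻¹ gₙ, R gₙ)_H` with an orthonormal basis `(gₙ)` of `V*` and the Riesz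
isomorphism `J : V → V*`. Every element of `𝒱*` is a sum of one of these and one of the former
operators: `𝒱* = HS(V, H) + HS(H, V*)`. -/
def ofFromV (ι : V →L[ℝ] H) (S : HS V H) : OpVDual ι :=
  (innerSL ℝ (HS.compRight S (riesz V))).comp (OpV.fromDual ι)

/-- `A* P + P A ∈ 𝒱*` for `A : V → V*` and `P ∈ 𝒱`; the dual operator `A*` is
`⟨A* u, v⟩ = ⟨A v, u⟩`. -/
def lyapunov (ι : V →L[ℝ] H) (A : V →L[ℝ] StrongDual ℝ V) (P : OpV ι) : OpVDual ι :=
  ofIntoDual ι (HS.compLeft A.flip (OpV.intoV ι P)) + ofFromV ι (HS.compRight (OpV.fromDual ι P) A)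

/-- The set `C_c` of self-adjoint `P ∈ ℋ` with `P ≥ c`. -/
def lowerClass (H : Type*) [NormedAddCommGroup H] [InnerProductSpace ℝ H] [CompleteSpace H]
    (c : ℝ) : Set (HS H H) :=
  {P | IsSelfAdjoint P.op ∧ ∀ u : H, c * ‖u‖ ^ 2 ≤ inner ℝ (P.op u) u}

/-! ### Function spaces in time and weak solutions -/

/-- `f ∈ L¹(0, T; ℋ) + L²(0, T; 𝒱*)`. -/
def MemSum (ι : V →L[ℝ] H) (T : ℝ) (f : ℝ → OpVDual ι) : Prop :=
  ∃ (f₁ : ℝ → HS H H) (f₂ : ℝ → OpVDual ι),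
    MemLp f₁ 1 (volume.restrict (Icc 0 T)) ∧ MemLp f₂ 2 (volume.restrict (Icc 0 T)) ∧
      ∀ᵐ t ∂volume.restrict (Icc 0 T), f t = hiToDual ι (f₁ t) + f₂ t

/-- `φ ∈ C_c^∞(0, T)`. -/
def IsTestFunction (T : ℝ) (φ : ℝ → ℝ) : Prop :=
  ContDiff ℝ ∞ φ ∧ HasCompactSupport φ ∧ tsupport φ ⊆ Ioo 0 T

/-- `g` is the weak derivative of `P` on `(0, T)`, as functions with values in `𝒱*`. -/
def HasWeakDeriv (ι : V →L[ℝ] H) (T : ℝ) (P : ℝ → OpV ι) (g : ℝ → OpVDual ι) : Prop :=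
  ∀ (R : OpV ι) (φ : ℝ → ℝ), IsTestFunction T φ →
    -(∫ t in (0 : ℝ)..T, hiToDual ι (OpV.toHi ι (P t)) R * deriv φ t) =
      ∫ t in (0 : ℝ)..T, g t R * φ t

/-- `P ∈ 𝒲`: `P ∈ L²(0, T; 𝒱)` with `P' ∈ L¹(0, T; ℋ) + L²(0, T; 𝒱*)`. -/
def MemW (ι : V →L[ℝ] H) (T : ℝ) (P : ℝ → OpV ι) : Prop :=
  MemLp P 2 (volume.restrict (Icc 0 T)) ∧
    ∃ g : ℝ → OpVDual ι, MemSum ι T g ∧ HasWeakDeriv ι T P g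

/-- `p ∈ C([0, T]; ℋ)` is the continuous representative of `P`. -/
def IsContRep (ι : V →L[ℝ] H) (T : ℝ) (P : ℝ → OpV ι) (p : ℝ → HS H H) : Prop :=
  ContinuousOn p (Icc 0 T) ∧ ∀ᵐ t ∂volume.restrict (Icc 0 T), OpV.toHi ι (P t) = p t

/-- `P ∈ 𝒲`, with continuous representative `p`, is a weak solution of
`P' + A* P + P A + P² = Q` on `(0, T)`, `P(0) = P₀`. -/
structure IsWeakSolution (ι : V →L[ℝ] H) (T : ℝ) (A : ℝ → V →L[ℝ] StrongDual ℝ V)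
    (Q : ℝ → OpVDual ι) (P₀ : HS H H) (P : ℝ → OpV ι) (p : ℝ → HS H H) : Prop where
  memW : MemW ι T P
  contRep : IsContRep ι T P p
  initial : p 0 = P₀
  equation : ∀ (R : OpV ι) (φ : ℝ → ℝ), IsTestFunction T φ →
    -(∫ t in (0 : ℝ)..T, hiToDual ι (OpV.toHi ι (P t)) R * deriv φ t) +
      ∫ t in (0 : ℝ)..T,
        (lyapunov ι (A t) (P t) + hiToDual ι (HS.square (OpV.toHi ι (P t)))) R * φ t =
      ∫ t in (0 : ℝ)..T, Q t R * φ t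

end Spaces

end RiccatiHS

end

open MeasureTheory Set
open scoped ContDiff

noncomputable section

set_option linter.unusedSectionVars false

namespace RiccatiHS

/-! ### Measurability in separable Hilbert spaces -/

section Measurability

variable {X : Type*} [NormedAddCommGroup X] [InnerProductSpace ℝ X]

/-! Symmetrisation tames the nonlinearity. Since `P² = ½ (P P + P P)`, the Riccati equation is the
fixed point case `B = P` of the linear equation `P' + A* P + P A + ½ (B P + P B) = Q`. For
self-adjoint `B` the last two terms on the left are absorbed by replacing `a(u, v)` by `a(u, v) + ½
(B u, v)_H` (`lyapunov_pert`). If `B ≥ -γ`, the condition `γ C² < μ` keeps this form coercive with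
the constant `μ - γ C²`, whatever `B` is. Coercivity passes from the form to `P ↦ A* P + P A` on
`𝒱`: after transposing one component of `P`, the pairing is a sum of two copies of the form on
`HS(H, V)` (`lyapunov_apply`).

The linear equation is solved with the delayed difference quotient `h⁻¹ (P(t) - P(t - h))`, which
keeps the merely measurable coefficients as they are; a weak limit `h → 0` gives
`exists_isSol_linear`. Each time step preserves the bound `P ≥ -γ` (`toHi_mem_lowerClass_of_step`):
if the bottom `l` of the spectrum were below `-γ`, with eigenvector `u`, testing with the rank one
operator of `P u` would give `-γ² ≤ h⁻¹ (l + γ) + l γ`, that is `(l + γ)(h⁻¹ + γ) ≥ 0`, which is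
absurd. The class of these `P` is closed and convex, so it survives the weak limit.

Energy estimates bound the solutions of all linearised equations at once, so the map `B ↦ P`
contracts in an exponentially weighted norm, and Picard iteration solves the Riccati equation with
square integrable right hand side (`exists_riccati`). The energy identity behind the estimates is
`integral_normSq_mul_deriv`, and the continuous representative comes from `exists_isSol`.

For two solutions, `P₁² - P₂² = ½ ((P₁ + P₂)(P₁ - P₂) + (P₁ - P₂)(P₁ + P₂))`. Their difference
therefore solves a linear equation whose coefficient, the mean `½ (P₁ + P₂)`, is `≥ -γ` by
convexity. This gives uniqueness (`eqOn`) and continuous dependence in `L¹(ℋ) + L²(𝒱*)`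
(`stability`). The latter reaches general `Q` by cutting `Q` off where its `L¹` part is large
(`exists_riccati_sum`). -/

theorem _root_.HilbertBasis.countable_index [TopologicalSpace.SeparableSpace X] {κ : Type*}
    (b : HilbertBasis κ ℝ X) : Countable κ := by
  -- Distinct basis vectors are at distance `√2 > 1`, so these open balls are disjoint; a separable
  -- space holds only countably many.
  have hd : Pairwise fun i k => Disjoint (Metric.ball (b i) (1 / 2)) (Metric.ball (b k) (1 / 2)) := by
    intro i k hik
    refine Metric.ball_disjoint_ball ?_
    have h : ‖b i - b k‖ ^ 2 = 2 := by
      rw [norm_sub_sq_real, b.orthonormal.1 i, b.orthonormal.1 k, b.orthonormal.2 hik]; norm_num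
    rw [dist_eq_norm]
    nlinarith [norm_nonneg (b i - b k)]
  exact Pairwise.countable_of_isOpen_disjoint hd (fun i => Metric.isOpen_ball)
    fun i => ⟨b i, Metric.mem_ball_self (by norm_num)⟩

variable [CompleteSpace X] {α : Type*} [MeasurableSpace α] {m : Measure α}

theorem aestronglyMeasurable_of_hasSum {E κ : Type*} [NormedAddCommGroup E] [Countable κ]
    {f : κ → α → E} {g : α → E} (hf : ∀ i, AEStronglyMeasurable (f i) m)
    (h : ∀ᵐ t ∂m, HasSum (fun i => f i t) (g t)) : AEStronglyMeasurable g m := by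
  refine aestronglyMeasurable_of_tendsto_ae (Filter.atTop : Filter (Finset κ))
    (f := fun s t => ∑ i ∈ s, f i t) (fun s => ?_) ?_
  · exact Finset.aestronglyMeasurable_fun_sum s fun i _ => hf i
  · filter_upwards [h] with t ht using ht

theorem aestronglyMeasurable_of_inner [TopologicalSpace.SeparableSpace X] {f : α → X}
    (h : ∀ x, AEMeasurable (fun t => inner ℝ x (f t)) m) : AEStronglyMeasurable f m := by
  obtain ⟨w, b, hb⟩ := exists_hilbertBasis ℝ X
  have := b.countable_index
  refine aestronglyMeasurable_of_hasSum (κ := w) (f := fun i t => inner ℝ (b i) (f t) • b i)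
    (fun i => ?_) (Filter.Eventually.of_forall fun t => ?_)
  · exact (h (b i)).aestronglyMeasurable.smul_const _
  · simpa [b.repr_apply_apply] using b.hasSum_repr (f t)

theorem aestronglyMeasurable_of_apply [TopologicalSpace.SeparableSpace X] {f : α → StrongDual ℝ X}
    (h : ∀ x, AEMeasurable (fun t => f t x) m) : AEStronglyMeasurable f m := by
  have h1 : AEStronglyMeasurable (fun t => (InnerProductSpace.toDual ℝ X).symm (f t)) m := by
    refine aestronglyMeasurable_of_inner fun x => ?_
    have e : ∀ t, inner ℝ x ((InnerProductSpace.toDual ℝ X).symm (f t)) = f t x := fun t => by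
      rw [real_inner_comm, InnerProductSpace.toDual_symm_apply]
    simpa only [e] using h x
  simpa using (InnerProductSpace.toDual ℝ X).continuous.comp_aestronglyMeasurable h1

/-- The form is measurable only for fixed arguments. Expanding `u t` in a countable orthonormal
basis reduces the composition to sums of products of measurable scalar functions. -/
theorem aestronglyMeasurable_bilin [TopologicalSpace.SeparableSpace X]
    {a : α → X →L[ℝ] StrongDual ℝ X} (ha : ∀ u v, AEMeasurable (fun t => a t u v) m) {u : α → X}
    (hu : AEStronglyMeasurable u m) : AEStronglyMeasurable (fun t => a t (u t)) m := by
  obtain ⟨w, b, hb⟩ := exists_hilbertBasis ℝ X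
  have := b.countable_index
  refine aestronglyMeasurable_of_apply fun x => AEStronglyMeasurable.aemeasurable ?_
  refine aestronglyMeasurable_of_hasSum (κ := w)
    (f := fun i t => inner ℝ (b i) (u t) • a t (b i) x)
    (fun i => ?_) (Filter.Eventually.of_forall fun t => ?_)
  · exact ((aestronglyMeasurable_const (b := b i)).inner (𝕜 := ℝ) hu).smul (ha (b i) x).aestronglyMeasurable
  · have h := (b.hasSum_repr (u t)).mapL ((a t).flip x)
    simpa [b.repr_apply_apply] using h

end Measurability

/-! ### Weak derivatives of scalar functions on an interval -/

section Scalar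

/-- Lebesgue measure on `[0, T]`. -/
abbrev timeMeasure (T : ℝ) : Measure ℝ := volume.restrict (Icc 0 T)

variable {T : ℝ} {E : Type*} [NormedAddCommGroup E] [NormedSpace ℝ E]

theorem intervalIntegral_eq_timeMeasure (hT : 0 ≤ T) (f : ℝ → E) :
    ∫ t in (0 : ℝ)..T, f t = ∫ t, f t ∂timeMeasure T := by
  rw [intervalIntegral.integral_of_le hT, integral_Icc_eq_integral_Ioc]

theorem intervalIntegrable_of_timeMeasure {F : Type*} [NormedAddCommGroup F] {f : ℝ → F} (hf : Integrable f (timeMeasure T))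
    {s t : ℝ} (hs : s ∈ Icc 0 T) (ht : t ∈ Icc 0 T) : IntervalIntegrable f volume s t := by
  have h : IntegrableOn f (uIcc s t) volume := by
    refine IntegrableOn.mono_set hf (uIcc_subset_Icc hs ht)
  exact h.intervalIntegrable

/-- Integration by parts with a factor that is only absolutely continuous; its derivative is `g`
almost everywhere, and the boundary term at `0` vanishes. -/
theorem integral_primitive_mul_deriv (hT : 0 ≤ T) {ψ : ℝ → ℝ} (hψ : ContDiff ℝ 1 ψ) {g : ℝ → ℝ}
    (hg : Integrable g (timeMeasure T)) :
    ∫ t in (0 : ℝ)..T, (∫ s in (0 : ℝ)..t, g s) * deriv ψ t =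
      (∫ s in (0 : ℝ)..T, g s) * ψ T - ∫ t in (0 : ℝ)..T, g t * ψ t := by
  have hi := intervalIntegrable_of_timeMeasure hg (left_mem_Icc.2 hT) (right_mem_Icc.2 hT)
  have h1 := hi.absolutelyContinuousOnInterval_intervalIntegral (c := 0) left_mem_uIcc
  have h2 : AbsolutelyContinuousOnInterval ψ 0 T :=
    hψ.contDiffOn.absolutelyContinuousOnInterval
  rw [h1.integral_mul_deriv_eq_deriv_mul h2]
  simp only [intervalIntegral.integral_same, zero_mul, sub_zero]
  congr 1
  refine intervalIntegral.integral_congr_ae ?_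
  filter_upwards [hi.ae_hasDerivAt_integral] with t ht h
  rw [(ht (uIoc_subset_uIcc h) 0 left_mem_uIcc).deriv]

theorem continuousOn_primitive_timeMeasure {g : ℝ → E} (hg : Integrable g (timeMeasure T)) :
    ContinuousOn (fun t => ∫ s in (0 : ℝ)..t, g s) (Icc 0 T) := by
  rcases le_or_gt 0 T with hT | hT
  · have := intervalIntegral.continuousOn_primitive_interval' (a := 0) (b₁ := 0) (b₂ := T)
      (intervalIntegrable_of_timeMeasure hg (left_mem_Icc.2 hT) (right_mem_Icc.2 hT)) left_mem_uIcc
    rwa [uIcc_of_le hT] at this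
  · simp [Icc_eq_empty_of_lt hT]

theorem IsTestFunction.exists_Icc {φ : ℝ → ℝ} (hT : 0 < T) (hφ : IsTestFunction T φ) :
    ∃ a b, 0 < a ∧ b < T ∧ a ≤ b ∧ ∀ t, t ∉ Icc a b → φ t = 0 := by
  obtain ⟨-, hc, hs⟩ := hφ
  rcases (tsupport φ).eq_empty_or_nonempty with h | h
  · exact ⟨T / 2, T / 2, by linarith, by linarith, le_rfl, fun t _ =>
      image_eq_zero_of_notMem_tsupport (by simp [h])⟩
  · obtain ⟨a, ha⟩ := hc.exists_isLeast h
    obtain ⟨b, hb⟩ := hc.exists_isGreatest h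
    refine ⟨a, b, (hs ha.1).1, (hs hb.1).2, ha.2 hb.1, fun t ht => ?_⟩
    refine image_eq_zero_of_notMem_tsupport fun h' => ht ⟨ha.2 h', hb.2 h'⟩

theorem isTestFunction_of_Icc {φ : ℝ → ℝ} (hφ : ContDiff ℝ ∞ φ) {a b : ℝ} (ha : 0 < a) (hb : b < T)
    (h : ∀ t, t ∉ Icc a b → φ t = 0) : IsTestFunction T φ := by
  have hs : tsupport φ ⊆ Icc a b :=
    closure_minimal (fun t ht => by_contra fun h' => ht (h t h')) isClosed_Icc
  exact ⟨hφ, isCompact_Icc.of_isClosed_subset (isClosed_tsupport φ) hs,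
    hs.trans fun t ht => ⟨ha.trans_le ht.1, ht.2.trans_lt hb⟩⟩

theorem contDiff_primitive {φ : ℝ → ℝ} (hφ : ContDiff ℝ ∞ φ) (c : ℝ) :
    ContDiff ℝ ∞ fun t => ∫ s in c..t, φ s := by
  have hd : ∀ t, HasDerivAt (fun t => ∫ s in c..t, φ s) (φ t) t := fun t =>
    intervalIntegral.integral_hasDerivAt_right (hφ.continuous.intervalIntegrable _ _)
      (hφ.continuous.stronglyMeasurableAtFilter _ _) hφ.continuous.continuousAt
  rw [contDiff_infty_iff_deriv]
  refine ⟨fun t => (hd t).differentiableAt, ?_⟩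
  rwa [funext fun t => (hd t).deriv]

theorem deriv_primitive {φ : ℝ → ℝ} (hφ : Continuous φ) (c t : ℝ) :
    deriv (fun t => ∫ s in c..t, φ s) t = φ t :=
  (intervalIntegral.integral_hasDerivAt_right (hφ.intervalIntegrable _ _)
      (hφ.stronglyMeasurableAtFilter _ _) hφ.continuousAt).deriv

theorem ae_eq_zero_of_integral_test (hT : 0 < T) {f : ℝ → ℝ} (hf : Integrable f (timeMeasure T))
    (h : ∀ φ, IsTestFunction T φ → ∫ t in (0 : ℝ)..T, f t * φ t = 0) :
    ∀ᵐ t ∂timeMeasure T, f t = 0 := by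
  have h1 : ∀ᵐ t, t ∈ Ioo 0 T → f t = 0 := by
    refine isOpen_Ioo.ae_eq_zero_of_integral_contDiff_smul_eq_zero
      (IntegrableOn.locallyIntegrableOn (IntegrableOn.mono_set hf Ioo_subset_Icc_self)) ?_
    intro φ hφ hc hs
    have := h φ ⟨hφ, hc, hs⟩
    rw [intervalIntegral_eq_timeMeasure hT.le, setIntegral_eq_integral_of_forall_compl_eq_zero] at this
    · simpa [mul_comm] using this
    · intro t ht
      rw [image_eq_zero_of_notMem_tsupport fun h' => ht (Ioo_subset_Icc_self (hs h')), mul_zero]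
  rw [timeMeasure, ← restrict_Ioo_eq_restrict_Icc]
  exact (ae_restrict_iff' measurableSet_Ioo).2 h1

theorem exists_isTestFunction_integral_eq_one (hT : 0 < T) :
    ∃ φ, IsTestFunction T φ ∧ ∫ t in (0 : ℝ)..T, φ t = 1 := by
  let b : ContDiffBump (T / 2) := ⟨T / 8, T / 4, by linarith, by linarith⟩
  have hb : ∀ t, t ∉ Icc (T / 4) (3 * T / 4) → b t = 0 := by
    intro t ht
    refine b.zero_of_le_dist ?_
    show T / 4 ≤ _
    rw [Real.dist_eq]
    by_contra! h'
    rw [abs_lt] at h'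
    exact ht ⟨by linarith, by linarith⟩
  have hI : ∫ t in (0 : ℝ)..T, b t = ∫ t, b t := by
    rw [intervalIntegral_eq_timeMeasure hT.le, setIntegral_eq_integral_of_forall_compl_eq_zero]
    exact fun t ht => hb t fun h => ht ⟨by linarith [h.1], by linarith [h.2]⟩
  have hp : 0 < ∫ t, b t := b.integral_pos
  refine ⟨fun t => (∫ t, b t)⁻¹ * b t, isTestFunction_of_Icc (a := T / 4) (b := 3 * T / 4)
    (contDiff_const.mul b.contDiff) (by linarith) (by linarith) fun t ht => by simp [hb t ht], ?_⟩
  rw [intervalIntegral.integral_const_mul, hI, inv_mul_cancel₀ hp.ne']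

/-- The du Bois-Reymond argument: subtracting `(∫ φ) φ₀` from a test function `φ` leaves mean zero,
so the primitive is again a test function and may be inserted in the hypothesis. -/
theorem ae_eq_const_of_integral_mul_deriv (hT : 0 < T) {f : ℝ → ℝ}
    (hf : Integrable f (timeMeasure T))
    (h : ∀ φ, IsTestFunction T φ → ∫ t in (0 : ℝ)..T, f t * deriv φ t = 0) :
    ∃ c, ∀ᵐ t ∂timeMeasure T, f t = c := by
  obtain ⟨φ₀, h₀, h₁⟩ := exists_isTestFunction_integral_eq_one hT
  have hint : ∀ φ : ℝ → ℝ, IsTestFunction T φ →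
      IntervalIntegrable (fun t => f t * φ t) volume 0 T := fun φ hφ =>
    (intervalIntegrable_of_timeMeasure hf (left_mem_Icc.2 hT.le)
      (right_mem_Icc.2 hT.le)).mul_continuousOn hφ.1.continuous.continuousOn
  set c := ∫ t in (0 : ℝ)..T, f t * φ₀ t
  refine ⟨c, ?_⟩
  have := ae_eq_zero_of_integral_test hT (hf.sub (integrable_const c)) fun φ hφ => ?_
  · filter_upwards [this] with t ht using sub_eq_zero.1 ht
  set m := ∫ t in (0 : ℝ)..T, φ t
  have hχ : ContDiff ℝ ∞ fun t => φ t - m * φ₀ t := hφ.1.sub (contDiff_const.mul h₀.1)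
  have hψ : IsTestFunction T fun t => ∫ s in (0 : ℝ)..t, (φ s - m * φ₀ s) := by
    obtain ⟨a, b, ha, hb, hab, hz⟩ := hφ.exists_Icc hT
    obtain ⟨a', b', ha', hb', hab', hz'⟩ := h₀.exists_Icc hT
    have hz2 : ∀ t, t ∉ Icc (min a a') (max b b') → φ t - m * φ₀ t = 0 := by
      intro t ht
      rw [hz t fun h => ht ⟨(min_le_left _ _).trans h.1, h.2.trans (le_max_left _ _)⟩,
        hz' t fun h => ht ⟨(min_le_right _ _).trans h.1, h.2.trans (le_max_right _ _)⟩]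
      simp
    refine isTestFunction_of_Icc (contDiff_primitive hχ 0) (lt_min ha ha') (max_lt hb hb') ?_
    intro t ht
    rcases lt_or_ge t (min a a') with h1 | h1
    · refine (intervalIntegral.integral_congr fun s hs => hz2 s fun h => ?_).trans (by simp)
      have := hs.2.trans (max_le (lt_min ha ha').le h1.le)
      rcases le_total 0 t with h0 | h0
      · rw [uIcc_of_le h0] at hs
        linarith [hs.2, h.1]
      · rw [uIcc_of_ge h0] at hs
        linarith [hs.2, h.1, lt_min ha ha']
    · have h2 : max b b' < t := by
        by_contra! h'
        exact ht ⟨h1, h'⟩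
      -- To the right of both supports the primitive equals the total integral. It vanishes because
      -- `φ₀` has integral one.
      have e1 : ∫ s in (0 : ℝ)..T, (φ s - m * φ₀ s) = 0 := by
        have := intervalIntegral.integral_sub (hφ.1.continuous.intervalIntegrable (μ := volume) 0 T)
          ((h₀.1.continuous.intervalIntegrable (μ := volume) 0 T).const_mul m)
        rw [this, intervalIntegral.integral_const_mul, h₁]
        simp [m]
      rw [← intervalIntegral.integral_add_adjacent_intervals (b := t)
        (hχ.continuous.intervalIntegrable _ _) (hχ.continuous.intervalIntegrable _ _)] at e1
      suffices e2 : ∫ s in t..T, (φ s - m * φ₀ s) = 0 by rwa [e2, add_zero] at e1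
      refine (intervalIntegral.integral_congr fun s hs => hz2 s fun h => ?_).trans (by simp)
      have := (le_inf h2.le (max_lt hb hb').le).trans hs.1
      have h3 := h.2
      rcases le_total t T with h0 | h0
      · rw [uIcc_of_le h0] at hs
        linarith [hs.1]
      · rw [uIcc_of_ge h0] at hs
        linarith [hs.1, max_lt hb hb']
  have h2 := h _ hψ
  simp_rw [deriv_primitive hχ.continuous] at h2
  have h3 : ∫ t in (0 : ℝ)..T, f t * (φ t - m * φ₀ t) =
      (∫ t in (0 : ℝ)..T, f t * φ t) - m * c := by
    rw [← intervalIntegral.integral_const_mul, ← intervalIntegral.integral_sub (hint φ hφ)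
      ((hint φ₀ h₀).const_mul m)]
    exact intervalIntegral.integral_congr fun t _ => by ring
  have h4 : ∫ t in (0 : ℝ)..T, (f t - c) * φ t =
      (∫ t in (0 : ℝ)..T, f t * φ t) - c * m := by
    rw [← intervalIntegral.integral_const_mul, ← intervalIntegral.integral_sub (hint φ hφ)
      ((hφ.1.continuous.intervalIntegrable _ _).const_mul c)]
    exact intervalIntegral.integral_congr fun t _ => by ring
  simp only [Pi.sub_apply]
  rw [h4]
  linarith

theorem ae_eq_primitive_of_weakDeriv (hT : 0 < T) {f g : ℝ → ℝ}
    (hf : Integrable f (timeMeasure T)) (hg : Integrable g (timeMeasure T))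
    (h : ∀ φ, IsTestFunction T φ →
      -(∫ t in (0 : ℝ)..T, f t * deriv φ t) = ∫ t in (0 : ℝ)..T, g t * φ t) :
    ∃ c, ∀ᵐ t ∂timeMeasure T, f t = c + ∫ s in (0 : ℝ)..t, g s := by
  have hG : Integrable (fun t => ∫ s in (0 : ℝ)..t, g s) (timeMeasure T) :=
    (continuousOn_primitive_timeMeasure hg).integrableOn_compact isCompact_Icc
  refine (ae_eq_const_of_integral_mul_deriv hT (hf.sub hG) fun φ hφ => ?_).imp fun c hc => ?_
  swap
  · filter_upwards [hc] with t ht using sub_eq_iff_eq_add.1 ht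
  have h1 := integral_primitive_mul_deriv hT.le (hφ.1.of_le (by simp)) hg
  have h2 : φ T = 0 := image_eq_zero_of_notMem_tsupport fun h' => lt_irrefl _ (hφ.2.2 h').2
  have hi : ∀ k : ℝ → ℝ, Integrable k (timeMeasure T) →
      IntervalIntegrable (fun t => k t * deriv φ t) volume 0 T := fun k hk =>
    (intervalIntegrable_of_timeMeasure hk (left_mem_Icc.2 hT.le)
      (right_mem_Icc.2 hT.le)).mul_continuousOn (hφ.1.continuous_deriv (by simp)).continuousOn
  simp only [Pi.sub_apply, sub_mul]
  rw [intervalIntegral.integral_sub (hi _ hf) (hi _ hG), h1, h2, mul_zero, zero_sub, ← h φ hφ]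
  ring

end Scalar

/-! ### The energy identity in a Gelfand triple -/

section Energy

open Filter Topology

variable {X K : Type*} [NormedAddCommGroup X]

theorem coeFn_vadd_toLp {f : ℝ → X} (hf : MemLp f 2 volume) (h : ℝ) :
    (DomAddAct.mk h +ᵥ hf.toLp : Lp X 2 (volume : Measure ℝ)) =ᵐ[volume] fun t => f (t + h) := by
  have h1 := DomAddAct.vadd_Lp_ae_eq (DomAddAct.mk h) hf.toLp
  have h2 := (measurePreserving_vadd h (volume : Measure ℝ)).quasiMeasurePreserving.ae_eq_comp
    hf.coeFn_toLp
  filter_upwards [h1, h2] with t h1 h2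
  rw [h1, add_comm]
  exact h2

variable [InnerProductSpace ℝ X]

/-- The pairing `∫ ⟨G(t + s), U(t + h) + U(t)⟩ φ(t) dt` depends continuously on the shifts. -/
theorem exists_continuous_shift_pairing {U G : ℝ → X} (hU : MemLp U 2 volume)
    (hG : MemLp G 2 volume) {φ : ℝ → ℝ} (hφ : Continuous φ) (hc : HasCompactSupport φ) :
    Continuous fun z : ℝ × ℝ => ∫ t, inner ℝ (G (t + z.1)) (U (t + z.2) + U t) * φ t := by
  have : Fact ((2 : ENNReal) ≠ ⊤) := ⟨by norm_num⟩
  obtain ⟨c, hcb⟩ := hc.exists_bound_of_continuous hφ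
  have hΦ : MemLp φ ⊤ volume :=
    memLp_top_of_bound hφ.aestronglyMeasurable c (Eventually.of_forall hcb)
  -- Multiplication by `φ` is a bounded operator `M` on `L²` (Hölder with exponents `∞` and `2`),
  -- and translations act continuously on `L²`; the integral is an inner product built from the two.
  let B : ℝ →L[ℝ] X →L[ℝ] X := ContinuousLinearMap.lsmul ℝ ℝ
  let M : Lp X 2 (volume : Measure ℝ) →L[ℝ] Lp X 2 (volume : Measure ℝ) :=
    B.holderL volume ⊤ 2 2 hΦ.toLp
  have h1 : Continuous fun z : ℝ × ℝ => inner ℝ (DomAddAct.mk z.1 +ᵥ hG.toLp)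
      (M ((DomAddAct.mk z.2 +ᵥ hU.toLp) + hU.toLp)) := by fun_prop
  convert h1 using 2 with z
  rw [L2.inner_def]
  refine integral_congr_ae ?_
  simp only [M, ContinuousLinearMap.holderL_apply_apply]
  have e2 : ((DomAddAct.mk z.2 +ᵥ hU.toLp) + hU.toLp : Lp X 2 (volume : Measure ℝ)) =ᵐ[volume]
      fun t => (DomAddAct.mk z.2 +ᵥ hU.toLp : Lp X 2 (volume : Measure ℝ)) t + (hU.toLp : Lp X 2 volume) t :=
    Lp.coeFn_add _ _
  have e3 : (hU.toLp : ℝ → X) =ᵐ[volume] U := hU.coeFn_toLp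
  have e4 : (hΦ.toLp : ℝ → ℝ) =ᵐ[volume] φ := hΦ.coeFn_toLp
  have e1 := B.coeFn_holder (r := 2) hΦ.toLp ((DomAddAct.mk z.2 +ᵥ hU.toLp) + hU.toLp)
  have e5 := coeFn_vadd_toLp hG z.1
  have e6 := coeFn_vadd_toLp hU z.2
  filter_upwards [e1, e2, e3, e4, e5, e6] with t h1 h2 h3 h4 h5 h6
  rw [h1, h2, h3, h4, h5, h6]
  simp only [B, ContinuousLinearMap.lsmul_apply, real_inner_smul_right]
  rw [mul_comm]

/-- Needed for Fubini in the energy identity. The shear `(s, t) ↦ (s, t + s)` preserves the product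
measure, so the shifted `G` stays square integrable on the product. -/
theorem integrable_shift_pairing {U G : ℝ → X} (hU : MemLp U 2 volume)
    (hG : MemLp G 2 volume) {φ : ℝ → ℝ} (hφ : Continuous φ) (hc : HasCompactSupport φ) (h : ℝ) :
    Integrable (Function.uncurry fun s t : ℝ => inner ℝ (G (t + s)) (U (t + h) + U t) * φ t)
      ((volume.restrict (uIoc 0 h)).prod volume) := by
  obtain ⟨c, hcb⟩ := hc.exists_bound_of_continuous hφ
  have : IsFiniteMeasure (volume.restrict (uIoc 0 h)) := ⟨by simp [uIoc]⟩
  have mp := measurePreserving_prod_add_right (volume.restrict (uIoc 0 h)) (volume : Measure ℝ)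
  have hR : MemLp (fun t => U (t + h) + U t) 2 volume :=
    (hU.comp_measurePreserving (measurePreserving_add_right volume h)).add hU
  have i1 : Integrable (fun z : ℝ × ℝ => ‖G (z.2 + z.1)‖ ^ 2)
      ((volume.restrict (uIoc 0 h)).prod volume) := by
    have := (hG.integrable_norm_pow two_ne_zero).comp_snd (volume.restrict (uIoc 0 h))
    exact mp.integrable_comp_of_integrable this
  have i2 : Integrable (fun z : ℝ × ℝ => ‖U (z.2 + h) + U z.2‖ ^ 2)
      ((volume.restrict (uIoc 0 h)).prod volume) :=
    (hR.integrable_norm_pow two_ne_zero).comp_snd (volume.restrict (uIoc 0 h))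
  refine ((i1.add i2).const_mul c).mono' ?_ (Eventually.of_forall fun z => ?_)
  · refine AEStronglyMeasurable.mul (AEStronglyMeasurable.inner (𝕜 := ℝ) ?_ hR.1.comp_snd)
      hφ.aestronglyMeasurable.comp_snd
    exact hG.1.comp_snd.comp_measurePreserving mp
  · simp only [Function.uncurry, norm_mul, Pi.add_apply]
    have h1 := norm_inner_le_norm (𝕜 := ℝ) (G (z.2 + z.1)) (U (z.2 + h) + U z.2)
    have h2 := hcb z.2
    have h3 : ‖inner ℝ (G (z.2 + z.1)) (U (z.2 + h) + U z.2)‖ ≤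
        ‖G (z.2 + z.1)‖ ^ 2 + ‖U (z.2 + h) + U z.2‖ ^ 2 := by
      nlinarith [sq_nonneg (‖G (z.2 + z.1)‖ - ‖U (z.2 + h) + U z.2‖),
        sq_nonneg ‖G (z.2 + z.1)‖, sq_nonneg ‖U (z.2 + h) + U z.2‖]
    rw [mul_comm]
    exact mul_le_mul h2 h3 (norm_nonneg _) ((norm_nonneg _).trans h2)

variable [CompleteSpace X] [NormedAddCommGroup K] [InnerProductSpace ℝ K]

theorem inner_riesz (f : StrongDual ℝ X) (x : X) : inner ℝ (riesz X f) x = f x :=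
  InnerProductSpace.toDual_symm_apply

/-- Translation invariance moves the difference quotient from `e`, which is only integrable, to the
Lipschitz function `φ`, where dominated convergence applies. -/
theorem tendsto_integral_diffQuot {e φ : ℝ → ℝ} (he : Integrable e) (hφ : ContDiff ℝ 1 φ)
    (hc : HasCompactSupport φ) :
    Tendsto (fun h => h⁻¹ * ∫ t, (e (t + h) - e t) * φ t) (𝓝[>] 0)
      (𝓝 (-∫ t, e t * deriv φ t)) := by
  obtain ⟨c, hcb⟩ := hc.exists_bound_of_continuous hφ.continuous
  obtain ⟨C, hC⟩ := hφ.lipschitzWith_of_hasCompactSupport hc one_ne_zero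
  have hi : ∀ h, Integrable fun t => e t * φ (t - h) := fun h =>
    he.mul_bdd (hφ.continuous.comp (continuous_sub_right h)).aestronglyMeasurable
      (Eventually.of_forall fun t => hcb _)
  have h0 : ∀ h, h⁻¹ * ∫ t, (e (t + h) - e t) * φ t =
      ∫ t, e t * (h⁻¹ * (φ (t - h) - φ t)) := by
    intro h
    have e1 : ∫ t, e (t + h) * φ t = ∫ t, e t * φ (t - h) := by
      rw [← integral_add_right_eq_self (fun t => e t * φ (t - h)) h]
      simp
    have i1 : Integrable fun t => e (t + h) * φ t := by
      have := (measurePreserving_add_right volume h).integrable_comp_of_integrable (hi h)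
      simpa [Function.comp_def] using this
    have i2 : Integrable fun t => e t * φ t := by simpa using hi 0
    simp_rw [sub_mul]
    rw [integral_sub i1 i2, e1, ← integral_sub (hi h) i2, ← integral_const_mul]
    exact integral_congr_ae (Eventually.of_forall fun t => by ring)
  simp_rw [h0]
  rw [← integral_neg]
  refine tendsto_integral_filter_of_dominated_convergence (fun t => ‖e t‖ * C)
    (Eventually.of_forall fun h => ?_) ?_ (he.norm.mul_const _) (Eventually.of_forall fun t => ?_)
  · refine he.1.mul (Continuous.aestronglyMeasurable ?_)
    exact continuous_const.mul ((hφ.continuous.comp (continuous_sub_right h)).sub hφ.continuous)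
  · filter_upwards [self_mem_nhdsWithin] with h hh
    refine Eventually.of_forall fun t => ?_
    rw [norm_mul]
    refine mul_le_mul_of_nonneg_left ?_ (norm_nonneg _)
    have := hC.dist_le_mul (t - h) t
    rw [dist_eq_norm, dist_eq_norm] at this
    rw [norm_mul, norm_inv, inv_mul_le_iff₀ (norm_pos_iff.2 (ne_of_gt hh))]
    simpa [mul_comm] using this
  · have h1 : HasDerivAt φ (deriv φ t) t := (hφ.differentiable one_ne_zero t).hasDerivAt
    have h2 : Tendsto (fun h : ℝ => -h) (𝓝[>] 0) (𝓝[≠] 0) := by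
      refine tendsto_nhdsWithin_iff.2 ⟨?_, ?_⟩
      · exact (continuous_neg.tendsto' 0 0 neg_zero).mono_left nhdsWithin_le_nhds
      · filter_upwards [self_mem_nhdsWithin] with h hh
        simpa using ne_of_gt hh
    have h3 := (h1.tendsto_slope_zero.comp h2).neg.const_mul (e t)
    rw [mul_neg] at h3
    refine h3.congr fun h => ?_
    simp [sub_eq_add_neg, smul_eq_mul, inv_neg]

/-- The weak derivative of `‖u‖²` is `2⟨u', u⟩`. -/
theorem integral_normSq_mul_deriv {T : ℝ} (hT : 0 < T) (j : X →L[ℝ] K) {u : ℝ → X}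
    {g : ℝ → StrongDual ℝ X} (hu : MemLp u 2 (timeMeasure T)) (hg : MemLp g 2 (timeMeasure T))
    {k₀ : K} (h : ∀ᵐ t ∂timeMeasure T, ∀ R, inner ℝ (j (u t)) (j R) =
      inner ℝ k₀ (j R) + ∫ s in (0 : ℝ)..t, g s R) {φ : ℝ → ℝ} (hφ : IsTestFunction T φ) :
    -(∫ t in (0 : ℝ)..T, ‖j (u t)‖ ^ 2 * deriv φ t) =
      ∫ t in (0 : ℝ)..T, 2 * g t (u t) * φ t := by
  obtain ⟨a, b, ha, hb, hab, hz⟩ := hφ.exists_Icc hT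
  have hz' : ∀ t, t ∉ Icc 0 T → φ t = 0 := fun t ht =>
    hz t fun h => ht ⟨ha.le.trans h.1, h.2.trans hb.le⟩
  have hg1 : Integrable g (timeMeasure T) := hg.integrable one_le_two
  have hgR : ∀ R, Integrable (fun t => g t R) (timeMeasure T) := fun R =>
    (ContinuousLinearMap.apply ℝ ℝ R).integrable_comp hg1
  -- Extension by zero makes translations on `L²(ℝ)` available; the compact support of `φ` in `(0,
  -- T)` hides the jumps at the endpoints.
  set U : ℝ → X := (Icc 0 T).indicator u
  set G : ℝ → X := (Icc 0 T).indicator fun t => riesz X (g t)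
  have hU : MemLp U 2 volume := (memLp_indicator_iff_restrict measurableSet_Icc).2 hu
  have hG : MemLp G 2 volume :=
    (memLp_indicator_iff_restrict measurableSet_Icc).2 ((riesz X).comp_memLp' hg)
  have hcont := exists_continuous_shift_pairing hU hG hφ.1.continuous hφ.2.1
  set F : ℝ → ℝ → ℝ := fun s h => ∫ t, inner ℝ (G (t + s)) (U (t + h) + U t) * φ t
  have hgood : ∀ᵐ t : ℝ, t ∈ Icc 0 T → ∀ R, inner ℝ (j (u t)) (j R) =
      inner ℝ k₀ (j R) + ∫ s in (0 : ℝ)..t, g s R := (ae_restrict_iff' measurableSet_Icc).1 h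
  -- By `‖x‖² - ‖y‖² = (x - y, x + y)` the increment of the energy is `j (u (t + h)) - j (u t)`
  -- paired with `R = U (t + h) + U t`, and the integrated equation turns this into the integral of
  -- `g s R` over `[t, t + h]`. The restriction `h < T - b` keeps `t + h` in `[0, T]` on the support
  -- of `φ`.
  have key : ∀ h ∈ Ioo 0 (T - b), ∫ t, (‖j (U (t + h))‖ ^ 2 - ‖j (U t)‖ ^ 2) * φ t =
      ∫ s in (0 : ℝ)..h, F s h := by
    intro h hh
    rw [intervalIntegral_integral_swap (integrable_shift_pairing hU hG hφ.1.continuous hφ.2.1 h)]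
    refine integral_congr_ae ?_
    have hgood' := (measurePreserving_add_right volume h).quasiMeasurePreserving.ae hgood
    filter_upwards [hgood, hgood'] with t h1 h2
    by_cases ht : t ∈ Icc a b
    swap
    · simp [hz t ht]
    have ht1 : t ∈ Icc 0 T := ⟨ha.le.trans ht.1, ht.2.trans hb.le⟩
    have ht2 : t + h ∈ Icc 0 T := ⟨by linarith [ht1.1, hh.1], by linarith [ht.2, hh.2]⟩
    rw [intervalIntegral.integral_mul_const]
    congr 1
    set R := U (t + h) + U t with hR
    have e1 : ‖j (U (t + h))‖ ^ 2 - ‖j (U t)‖ ^ 2 =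
        inner ℝ (j (U (t + h))) (j R) - inner ℝ (j (U t)) (j R) := by
      rw [hR, map_add, inner_add_right, inner_add_right, real_inner_self_eq_norm_sq,
        real_inner_self_eq_norm_sq, real_inner_comm (j (U t)) (j (U (t + h)))]
      ring
    have e2 : U (t + h) = u (t + h) := indicator_of_mem ht2 _
    have e3 : U t = u t := indicator_of_mem ht1 _
    have hR0 : (0 : ℝ) ∈ Icc 0 T := ⟨le_rfl, hT.le⟩
    rw [e1, e2, e3, h1 ht1, h2 ht2, add_sub_add_left_eq_sub,
      intervalIntegral.integral_interval_sub_left (intervalIntegrable_of_timeMeasure (hgR R) hR0 ht2)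
        (intervalIntegrable_of_timeMeasure (hgR R) hR0 ht1)]
    have e4 := intervalIntegral.integral_comp_add_left (a := 0) (b := h) (fun s => g s R) t
    rw [add_zero] at e4
    rw [← e4]
    refine intervalIntegral.integral_congr fun s hs => ?_
    rw [uIcc_of_le hh.1.le] at hs
    have : t + s ∈ Icc 0 T := ⟨by linarith [ht1.1, hs.1], by linarith [ht2.2, hs.2]⟩
    simp only [G, indicator_of_mem this, inner_riesz]
  have he : Integrable fun t => ‖j (U t)‖ ^ 2 :=
    (j.comp_memLp' hU).integrable_norm_pow two_ne_zero
  have lim1 := tendsto_integral_diffQuot he (hφ.1.of_le (by simp)) hφ.2.1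
  -- A mean over `[0, h]` of a jointly continuous function. The value `F 0 0` pairs `g t` with `2 u
  -- t`, which is the source of the factor two.
  have lim2 : Tendsto (fun h => h⁻¹ * ∫ s in (0 : ℝ)..h, F s h) (𝓝[>] 0) (𝓝 (F 0 0)) := by
    rw [Metric.tendsto_nhdsWithin_nhds]
    intro ε hε
    obtain ⟨δ, hδ, H⟩ := Metric.continuousAt_iff.1 (hcont.continuousAt (x := (0, 0))) (ε / 2)
      (half_pos hε)
    refine ⟨δ, hδ, fun h (hh : 0 < h) hd => ?_⟩
    have hd' : h < δ := by simpa [abs_of_pos hh] using hd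
    have hFi : IntervalIntegrable (fun s => F s h) volume 0 h :=
      Continuous.intervalIntegrable
        (hcont.comp (continuous_id.prodMk (continuous_const (y := h)))) _ _
    have e1 : h⁻¹ * (∫ s in (0 : ℝ)..h, F s h) - F 0 0 =
        h⁻¹ * ∫ s in (0 : ℝ)..h, (F s h - F 0 0) := by
      rw [intervalIntegral.integral_sub hFi (by simp)]
      simp only [intervalIntegral.integral_const, sub_zero, smul_eq_mul]
      field_simp
    have e2 := intervalIntegral.norm_integral_le_of_norm_le_const (a := 0) (b := h)
      (f := fun s => F s h - F 0 0) (C := ε / 2) fun s hs => by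
        rw [uIoc_of_le hh.le] at hs
        have : dist (s, h) ((0 : ℝ), (0 : ℝ)) < δ := by
          rw [Prod.dist_eq]
          simp only [Real.dist_eq, sub_zero, abs_of_pos hs.1, abs_of_pos hh]
          exact max_lt (hs.2.trans_lt hd') hd'
        exact (H this).le
    rw [dist_eq_norm, e1, norm_mul, norm_inv, Real.norm_of_nonneg hh.le]
    rw [sub_zero, abs_of_pos hh] at e2
    rw [inv_mul_lt_iff₀ hh]
    nlinarith
  have hev : (fun h => h⁻¹ * ∫ t, (‖j (U (t + h))‖ ^ 2 - ‖j (U t)‖ ^ 2) * φ t) =ᶠ[𝓝[>] 0]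
      fun h => h⁻¹ * ∫ s in (0 : ℝ)..h, F s h := by
    filter_upwards [Ioo_mem_nhdsGT (sub_pos.2 hb)] with h hh
    rw [key h hh]
  have := tendsto_nhds_unique (lim1.congr' hev) lim2
  have hdz : ∀ t, t ∉ Icc 0 T → deriv φ t = 0 := fun t ht => by
    refine image_eq_zero_of_notMem_tsupport fun h' => ht ?_
    exact Ioo_subset_Icc_self (hφ.2.2 (tsupport_deriv_subset h'))
  have A1 : ∫ t in (0 : ℝ)..T, ‖j (u t)‖ ^ 2 * deriv φ t = ∫ t, ‖j (U t)‖ ^ 2 * deriv φ t := by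
    rw [intervalIntegral_eq_timeMeasure hT.le]
    refine (setIntegral_congr_fun (g := fun t => ‖j (U t)‖ ^ 2 * deriv φ t) measurableSet_Icc
      fun t ht => ?_).trans (setIntegral_eq_integral_of_forall_compl_eq_zero
        fun t ht => by rw [hdz t ht, mul_zero])
    simp only [U, indicator_of_mem ht]
  have A2 : ∫ t in (0 : ℝ)..T, 2 * g t (u t) * φ t = F 0 0 := by
    rw [intervalIntegral_eq_timeMeasure hT.le]
    refine (setIntegral_congr_fun (g := fun t => inner ℝ (G (t + 0)) (U (t + 0) + U t) * φ t)
      measurableSet_Icc fun t ht => ?_).trans (setIntegral_eq_integral_of_forall_compl_eq_zero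
        fun t ht => by rw [hz' t ht, mul_zero])
    simp only [U, G, add_zero, indicator_of_mem ht, inner_add_right, inner_riesz]
    ring
  rw [A1, A2, this]

end Energy

/-! ### Continuous representatives and the energy identity at every time -/

section Evolution

open Filter Topology

variable {X K : Type*} [NormedAddCommGroup X] [InnerProductSpace ℝ X]
  [NormedAddCommGroup K] [InnerProductSpace ℝ K]

/-- `u ∈ L²(0, T; X)` has the derivative `g` in `X*` and the initial value `k₀`, and `p` is its
continuous representative in the pivot space `K`. -/
structure IsSol (j : X →L[ℝ] K) (T : ℝ) (g : ℝ → StrongDual ℝ X) (k₀ : K) (u : ℝ → X)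
    (p : ℝ → K) : Prop where
  memLp : MemLp u 2 (timeMeasure T)
  cont : ContinuousOn p (Icc 0 T)
  ae_eq : ∀ᵐ t ∂timeMeasure T, j (u t) = p t
  eq : ∀ t ∈ Icc 0 T, ∀ R, inner ℝ (p t) (j R) = inner ℝ k₀ (j R) + ∫ s in (0 : ℝ)..t, g s R

/-- Full measure forces density in the open interval, whose closure is `[0, T]`. This carries closed
conditions from almost every time to every time. -/
theorem Icc_subset_closure_of_ae {T : ℝ} (hT : 0 < T) {q : ℝ → Prop}
    (h : ∀ᵐ t ∂timeMeasure T, q t) : Icc 0 T ⊆ closure {t | t ∈ Icc 0 T ∧ q t} := by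
  have h1 : ∀ᵐ t : ℝ, t ∈ Icc 0 T → q t := (ae_restrict_iff' measurableSet_Icc).1 h
  have h2 : Dense {t | t ∈ Icc 0 T → q t} := Measure.dense_of_ae h1
  have h3 := h2.open_subset_closure_inter (isOpen_Ioo (a := 0) (b := T))
  refine (closure_Ioo hT.ne).symm.subset.trans ?_
  refine closure_minimal (h3.trans (closure_mono ?_)) isClosed_closure
  exact fun t ht => ⟨Ioo_subset_Icc_self ht.1, ht.2 (Ioo_subset_Icc_self ht.1)⟩

variable {T : ℝ} {j : X →L[ℝ] K} {u : ℝ → X} {g : ℝ → StrongDual ℝ X} {k₀ : K}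

theorem integrable_pairing (hu : MemLp u 2 (timeMeasure T)) (hg : MemLp g 2 (timeMeasure T)) :
    Integrable (fun t => g t (u t)) (timeMeasure T) := by
  refine ((hg.integrable_norm_pow two_ne_zero).add (hu.integrable_norm_pow two_ne_zero)).mono' ?_
    (Eventually.of_forall fun t => ?_)
  · exact isBoundedBilinearMap_apply.continuous.comp_aestronglyMeasurable (hg.1.prodMk hu.1)
  · have := (g t).le_opNorm (u t)
    simp only [Pi.add_apply]
    nlinarith [sq_nonneg (‖g t‖ - ‖u t‖), sq_nonneg ‖g t‖, sq_nonneg ‖u t‖]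

theorem integrable_apply (hg : Integrable g (timeMeasure T)) (R : X) :
    Integrable (fun t => g t R) (timeMeasure T) :=
  (ContinuousLinearMap.apply ℝ ℝ R).integrable_comp hg

namespace IsSol

variable {p : ℝ → K}

theorem sub {g' : ℝ → StrongDual ℝ X} {k₀' : K} {u' : ℝ → X} {p' : ℝ → K}
    (h : IsSol j T g k₀ u p) (h' : IsSol j T g' k₀' u' p') (hg : Integrable g (timeMeasure T))
    (hg' : Integrable g' (timeMeasure T)) :
    IsSol j T (fun t => g t - g' t) (k₀ - k₀') (fun t => u t - u' t) (fun t => p t - p' t) where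
  memLp := h.memLp.sub h'.memLp
  cont := h.cont.sub h'.cont
  ae_eq := by
    filter_upwards [h.ae_eq, h'.ae_eq] with t h1 h2
    rw [map_sub, h1, h2]
  eq t ht R := by
    have h0 : (0 : ℝ) ∈ Icc 0 T := ⟨le_rfl, ht.1.trans ht.2⟩
    simp only [sub_apply]
    rw [inner_sub_left, inner_sub_left, h.eq t ht, h'.eq t ht, intervalIntegral.integral_sub
      (intervalIntegrable_of_timeMeasure (integrable_apply hg R) h0 ht)
      (intervalIntegrable_of_timeMeasure (integrable_apply hg' R) h0 ht)]
    ring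

theorem congr {g' : ℝ → StrongDual ℝ X} (h : IsSol j T g k₀ u p)
    (hg : ∀ᵐ t ∂timeMeasure T, g t = g' t) : IsSol j T g' k₀ u p where
  memLp := h.memLp
  cont := h.cont
  ae_eq := h.ae_eq
  eq t ht R := by
    rw [h.eq t ht R]
    congr 1
    refine intervalIntegral.integral_congr_ae ?_
    filter_upwards [(ae_restrict_iff' measurableSet_Icc).1 hg] with s hs h's
    rw [uIoc_of_le ht.1] at h's
    rw [hs ⟨h's.1.le, h's.2.trans ht.2⟩]

theorem initial (hj : DenseRange j) (hT : 0 ≤ T) (h : IsSol j T g k₀ u p) : p 0 = k₀ := by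
  refine hj.eq_of_inner_left ℝ fun R => ?_
  simpa using h.eq 0 ⟨le_rfl, hT⟩ R

end IsSol

/-- `q` marks the times at which both the integrated equation and the energy identity hold.
Expanding the square and using both gives the integral of `2 g r (u r - u s)` from `s` to `t`, and
Young's inequality bounds the integrand. -/
theorem norm_sub_sq_le_of_good {c : ℝ} (hu : MemLp u 2 (timeMeasure T))
    (hg : MemLp g 2 (timeMeasure T))
    {q : ℝ → Prop} (hq : ∀ t, q t → (∀ R, inner ℝ (j (u t)) (j R) =
      inner ℝ k₀ (j R) + ∫ s in (0 : ℝ)..t, g s R) ∧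
        ‖j (u t)‖ ^ 2 = c + ∫ s in (0 : ℝ)..t, 2 * g s (u s))
    {a b s t : ℝ} (hab : a ≤ b) (h0a : 0 ≤ a) (hbT : b ≤ T)
    (hs : q s) (ht : q t) (hs' : s ∈ Icc a b) (ht' : t ∈ Icc a b) :
    ‖j (u t) - j (u s)‖ ^ 2 ≤
      ∫ r in a..b, (2 * ‖g r‖ ^ 2 + ‖u r‖ ^ 2 + ‖u s‖ ^ 2) := by
  have hsub : ∀ r ∈ Icc a b, r ∈ Icc 0 T := fun r hr => ⟨h0a.trans hr.1, hr.2.trans hbT⟩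
  have h0 : (0 : ℝ) ∈ Icc 0 T := ⟨le_rfl, h0a.trans (hab.trans hbT)⟩
  have i1 := (integrable_pairing hu hg).const_mul 2
  have i2 := integrable_apply (hg.integrable one_le_two) (u s)
  have i3 : Integrable (fun r => 2 * ‖g r‖ ^ 2 + ‖u r‖ ^ 2 + ‖u s‖ ^ 2) (timeMeasure T) :=
    (((hg.integrable_norm_pow two_ne_zero).const_mul 2).add
      (hu.integrable_norm_pow two_ne_zero)).add (integrable_const _)
  have e1 : ‖j (u t) - j (u s)‖ ^ 2 = ∫ r in s..t, (2 * g r (u r) - 2 * g r (u s)) := by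
    rw [intervalIntegral.integral_sub
      (intervalIntegrable_of_timeMeasure i1 (hsub s hs') (hsub t ht'))
      ((intervalIntegrable_of_timeMeasure i2 (hsub s hs') (hsub t ht')).const_mul 2),
      intervalIntegral.integral_const_mul 2 fun r => g r (u s),
      ← intervalIntegral.integral_interval_sub_left
        (intervalIntegrable_of_timeMeasure i1 h0 (hsub t ht'))
        (intervalIntegrable_of_timeMeasure i1 h0 (hsub s hs')),
      ← intervalIntegral.integral_interval_sub_left
        (intervalIntegrable_of_timeMeasure i2 h0 (hsub t ht'))
        (intervalIntegrable_of_timeMeasure i2 h0 (hsub s hs')), norm_sub_sq_real, (hq t ht).1,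
      (hq t ht).2]
    have := (hq s hs).1 (u s)
    rw [real_inner_self_eq_norm_sq] at this
    have := (hq s hs).2
    linarith
  rw [e1]
  rw [← Real.norm_of_nonneg (e1 ▸ sq_nonneg _ : 0 ≤ ∫ r in s..t, (2 * g r (u r) - 2 * g r (u s)))]
  refine ((intervalIntegral.norm_integral_le_integral_norm_uIoc).trans ?_)
  rw [intervalIntegral.integral_of_le hab]
  have hsub2 : uIoc s t ⊆ Ioc a b := by
    rw [uIoc]
    exact Ioc_subset_Ioc (le_min hs'.1 ht'.1) (max_le hs'.2 ht'.2)
  have i3' : IntegrableOn (fun r => 2 * ‖g r‖ ^ 2 + ‖u r‖ ^ 2 + ‖u s‖ ^ 2) (Ioc a b) :=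
    IntegrableOn.mono_set i3 fun r hr => hsub r (Ioc_subset_Icc_self hr)
  refine (setIntegral_mono_on ?_ (i3'.mono_set hsub2) measurableSet_uIoc fun r _ => ?_).trans
    (setIntegral_mono_set i3' (Eventually.of_forall fun r => by positivity)
      hsub2.eventuallyLE)
  · exact (IntegrableOn.mono_set (i1.sub (i2.const_mul 2))
      fun r hr => hsub r (Ioc_subset_Icc_self (hsub2 hr))).norm
  · have h1 := (g r).le_opNorm (u r)
    have h2 := (g r).le_opNorm (u s)
    have h3 := norm_sub_le (2 * g r (u r)) (2 * g r (u s))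
    rw [norm_mul, norm_mul, Real.norm_ofNat] at h3
    nlinarith [sq_nonneg (‖g r‖ - ‖u r‖), sq_nonneg (‖g r‖ - ‖u s‖)]

variable [CompleteSpace X]

theorem exists_ae_normSq_eq (hT : 0 < T) (hu : MemLp u 2 (timeMeasure T))
    (hg : MemLp g 2 (timeMeasure T)) (h : ∀ᵐ t ∂timeMeasure T, ∀ R, inner ℝ (j (u t)) (j R) =
      inner ℝ k₀ (j R) + ∫ s in (0 : ℝ)..t, g s R) :
    ∃ c, ∀ᵐ t ∂timeMeasure T, ‖j (u t)‖ ^ 2 = c + ∫ s in (0 : ℝ)..t, 2 * g s (u s) :=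
  ae_eq_primitive_of_weakDeriv hT ((j.comp_memLp' hu).integrable_norm_pow two_ne_zero)
    ((integrable_pairing hu hg).const_mul 2) fun _ hφ => integral_normSq_mul_deriv hT j hu hg h hφ

/-- A function with square integrable derivative in `X*` has a representative that is continuous
with values in the pivot space. -/
theorem exists_isSol [CompleteSpace K] (hT : 0 < T) (hu : MemLp u 2 (timeMeasure T))
    (hg : MemLp g 2 (timeMeasure T)) (h : ∀ᵐ t ∂timeMeasure T, ∀ R, inner ℝ (j (u t)) (j R) =
      inner ℝ k₀ (j R) + ∫ s in (0 : ℝ)..t, g s R) : ∃ p, IsSol j T g k₀ u p := by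
  obtain ⟨c, hc⟩ := exists_ae_normSq_eq hT hu hg h
  set q : ℝ → Prop := fun t => (∀ R, inner ℝ (j (u t)) (j R) =
      inner ℝ k₀ (j R) + ∫ s in (0 : ℝ)..t, g s R) ∧
        ‖j (u t)‖ ^ 2 = c + ∫ s in (0 : ℝ)..t, 2 * g s (u s) with hqdef
  have hq : ∀ᵐ t ∂timeMeasure T, q t := by filter_upwards [h, hc] with t h1 h2 using ⟨h1, h2⟩
  have hcl := Icc_subset_closure_of_ae hT hq
  set 𝒢 := {t | t ∈ Icc 0 T ∧ q t}
  have iu := hu.integrable_norm_pow two_ne_zero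
  have ig := hg.integrable_norm_pow two_ne_zero
  have iρ : Integrable (fun r => ‖g r‖ ^ 2 + ‖u r‖ ^ 2) (timeMeasure T) := ig.add iu
  set Φ : ℝ → ℝ := fun t => ∫ r in (0 : ℝ)..t, (‖g r‖ ^ 2 + ‖u r‖ ^ 2)
  have hΦ : ContinuousOn Φ (Icc 0 T) := continuousOn_primitive_timeMeasure iρ
  have h0 : (0 : ℝ) ∈ Icc 0 T := ⟨le_rfl, hT.le⟩
  have key : ∀ a ∈ 𝒢, ∀ b ∈ 𝒢, a < b → ‖j (u a) - j (u b)‖ ^ 2 ≤ 8 * |Φ a - Φ b| := by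
    intro a ha b hb hab
    -- The increment estimate contains `‖u s‖²` times the length of the interval. At a good time `s`
    -- where `‖u s‖²` is at most its mean, that term is bounded by the integral of `‖u‖²`, so `Φ`
    -- alone controls the increments. Each half costs `2 (Φ b - Φ a)`, and `(x + y)² ≤ 2 x² + 2 y²`
    -- makes this `8`.
    obtain ⟨s, hs, hsq, hsu⟩ : ∃ s ∈ Icc a b, q s ∧ (b - a) * ‖u s‖ ^ 2 ≤ ∫ r in a..b, ‖u r‖ ^ 2 := by
      have hsub : Ioc a b ⊆ Icc 0 T := fun r hr => ⟨ha.1.1.trans hr.1.le, hr.2.trans hb.1.2⟩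
      have hIf : IsFiniteMeasure (volume.restrict (Ioc a b)) := ⟨by simp⟩
      have hN : volume.restrict (Ioc a b) {t | ¬ (t ∈ Ioc a b ∧ q t)} = 0 := by
        have h1 : ∀ᵐ t ∂volume.restrict (Ioc a b), q t := ae_restrict_of_ae_restrict_of_subset hsub hq
        have h2 := h1.and (ae_restrict_mem (μ := volume) (measurableSet_Ioc (a := a) (b := b)))
        exact ae_iff.1 (h2.mono fun t ht => ht.symm)
      have hne : volume.restrict (Ioc a b) ≠ 0 := by
        intro h0
        have := congrArg (fun m => m univ) h0
        simp at this
        linarith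
      have iu' : IntegrableOn (fun r => ‖u r‖ ^ 2) (Icc 0 T) := iu
      obtain ⟨s, hs, hle⟩ := exists_notMem_null_le_average (f := fun r => ‖u r‖ ^ 2) hne
        (iu'.mono_set hsub) hN
      rw [mem_ofPred_eq, not_not] at hs
      refine ⟨s, Ioc_subset_Icc_self hs.1, hs.2, ?_⟩
      rw [setAverage_eq, smul_eq_mul, ← intervalIntegral.integral_of_le hab.le] at hle
      simp only [Measure.real, Real.volume_Ioc, ENNReal.toReal_ofReal (sub_pos.2 hab).le] at hle
      rwa [← div_eq_inv_mul, le_div_iff₀' (sub_pos.2 hab)] at hle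
    have hI : ∫ r in a..b, (2 * ‖g r‖ ^ 2 + ‖u r‖ ^ 2 + ‖u s‖ ^ 2) ≤ 2 * (Φ b - Φ a) := by
      have i1 := intervalIntegrable_of_timeMeasure iu ha.1 hb.1
      have i2 := intervalIntegrable_of_timeMeasure ig ha.1 hb.1
      rw [intervalIntegral.integral_add ((i2.const_mul 2).add i1) (by simp),
        intervalIntegral.integral_add (i2.const_mul 2) i1, intervalIntegral.integral_const_mul,
        intervalIntegral.integral_const, smul_eq_mul]
      simp only [Φ]
      rw [intervalIntegral.integral_interval_sub_left
        (intervalIntegrable_of_timeMeasure iρ h0 hb.1)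
        (intervalIntegrable_of_timeMeasure iρ h0 ha.1), intervalIntegral.integral_add i2 i1]
      linarith
    have e1 := norm_sub_sq_le_of_good hu hg (q := q) (fun _ h => h) hab.le ha.1.1 hb.1.2 hsq ha.2 hs
      ⟨le_rfl, hab.le⟩
    have e2 := norm_sub_sq_le_of_good hu hg (q := q) (fun _ h => h) hab.le ha.1.1 hb.1.2 hsq hb.2 hs
      ⟨hab.le, le_rfl⟩
    have e3 : ‖j (u a) - j (u b)‖ ≤ ‖j (u a) - j (u s)‖ + ‖j (u b) - j (u s)‖ := by
      rw [norm_sub_rev (j (u b))]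
      exact norm_sub_le_norm_sub_add_norm_sub _ _ _
    have e4 := neg_abs_le (Φ a - Φ b)
    nlinarith [norm_nonneg (j (u a) - j (u b)), sq_nonneg (‖j (u a) - j (u s)‖ - ‖j (u b) - j (u s)‖)]
  have key2 : ∀ a ∈ 𝒢, ∀ b ∈ 𝒢, dist (j (u a)) (j (u b)) ≤ √(8 * |Φ a - Φ b|) := by
    intro a ha b hb
    refine Real.le_sqrt_of_sq_le ?_
    rcases lt_trichotomy a b with hab | rfl | hab
    · rw [dist_eq_norm]; exact key a ha b hb hab
    · simp
    · rw [dist_comm, dist_eq_norm, abs_sub_comm]; exact key b hb a ha hab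
  have hlim : ∀ x ∈ Icc 0 T, ∃ y, Tendsto (fun t => j (u t)) (𝓝[𝒢] x) (𝓝 y) := by
    intro x hx
    have hne : (𝓝[𝒢] x).NeBot := mem_closure_iff_nhdsWithin_neBot.1 (hcl hx)
    rw [← cauchy_map_iff_exists_tendsto, cauchy_map_iff]
    refine ⟨hne, tendsto_uniformity_iff_dist_tendsto_zero.2 ?_⟩
    have hΦx : Tendsto Φ (𝓝[𝒢] x) (𝓝 (Φ x)) :=
      (hΦ x hx).mono_left (nhdsWithin_mono _ fun t ht => ht.1)
    have h1 : Tendsto (fun z : ℝ × ℝ => √(8 * |Φ z.1 - Φ z.2|)) (𝓝[𝒢] x ×ˢ 𝓝[𝒢] x) (𝓝 0) := by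
      have := ((hΦx.comp tendsto_fst).sub (hΦx.comp (tendsto_snd (f := 𝓝[𝒢] x)))).abs.const_mul 8
      have := this.sqrt
      simpa using this
    refine squeeze_zero' (Eventually.of_forall fun z => dist_nonneg) ?_ h1
    filter_upwards [prod_mem_prod self_mem_nhdsWithin self_mem_nhdsWithin] with z hz
    exact key2 _ hz.1 _ hz.2
  -- The modulus of continuity on the dense set of good times makes the limits exist, so `j ∘ u`
  -- extends continuously from there to `[0, T]`.
  set p := extendFrom 𝒢 fun t => j (u t)
  have hp : ContinuousOn p (Icc 0 T) := continuousOn_extendFrom hcl hlim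
  have hpG : ∀ t ∈ 𝒢, p t = j (u t) := by
    intro t ht
    obtain ⟨y, hy⟩ := hlim t ht.1
    have : y = j (u t) :=
      tendsto_nhds_unique (hy.mono_left (pure_le_nhdsWithin ht)) (tendsto_pure_nhds _ _)
    exact extendFrom_eq (hcl ht.1) (this ▸ hy)
  have hae : ∀ᵐ t ∂timeMeasure T, j (u t) = p t := by
    filter_upwards [hq, ae_restrict_mem measurableSet_Icc] with t h1 h2 using (hpG t ⟨h2, h1⟩).symm
  refine ⟨p, hu, hp, hae, fun t ht R => ?_⟩
  refine Measure.eqOn_Icc_of_ae_eq volume hT.ne (f := fun t => inner ℝ (p t) (j R))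
    (g := fun t => inner ℝ k₀ (j R) + ∫ s in (0 : ℝ)..t, g s R) ?_
    (hp.inner continuousOn_const) (continuousOn_const.add (continuousOn_primitive_timeMeasure
      (integrable_apply (hg.integrable one_le_two) R))) ht
  filter_upwards [hae, h] with t h1 h2
  rw [← h1, h2]

namespace IsSol

variable {p : ℝ → K}

/-- Both sides are continuous and agree almost everywhere up to a constant. The constant is read off
at time `0`, where density of `j` identifies `p 0` with `k₀`. -/
theorem energy (hj : DenseRange j) (hT : 0 < T) (h : IsSol j T g k₀ u p)
    (hg : MemLp g 2 (timeMeasure T)) :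
    ∀ t ∈ Icc 0 T, ‖p t‖ ^ 2 = ‖k₀‖ ^ 2 + ∫ s in (0 : ℝ)..t, 2 * g s (u s) := by
  have h1 : ∀ᵐ t ∂timeMeasure T, ∀ R, inner ℝ (j (u t)) (j R) =
      inner ℝ k₀ (j R) + ∫ s in (0 : ℝ)..t, g s R := by
    filter_upwards [h.ae_eq, ae_restrict_mem measurableSet_Icc] with t h1 h2 R
    rw [h1, h.eq t h2]
  obtain ⟨c, hc⟩ := exists_ae_normSq_eq hT h.memLp hg h1
  have h2 : EqOn (fun t => ‖p t‖ ^ 2) (fun t => c + ∫ s in (0 : ℝ)..t, 2 * g s (u s)) (Icc 0 T) := by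
    refine Measure.eqOn_Icc_of_ae_eq volume hT.ne ?_ (h.cont.norm.pow 2)
      (continuousOn_const.add (continuousOn_primitive_timeMeasure
        ((integrable_pairing h.memLp hg).const_mul 2)))
    filter_upwards [hc, h.ae_eq] with t h1 h2
    rw [← h2, h1]
  have h3 := h2 ⟨le_rfl, hT.le⟩
  simp only [intervalIntegral.integral_same, add_zero, h.initial hj hT.le] at h3
  intro t ht
  rw [h3]
  exact h2 ht

end IsSol

end Evolution

theorem memLp_fun_add {E α : Type*} [NormedAddCommGroup E] [MeasurableSpace α] {m : Measure α}
    {p : ENNReal} {f g : α → E} (hf : MemLp f p m) (hg : MemLp g p m) :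
    MemLp (fun t => f t + g t) p m := hf.add hg

theorem memLp_fun_sub {E α : Type*} [NormedAddCommGroup E] [MeasurableSpace α] {m : Measure α}
    {p : ENNReal} {f g : α → E} (hf : MemLp f p m) (hg : MemLp g p m) :
    MemLp (fun t => f t - g t) p m := hf.sub hg

theorem integrable_fun_add {E α : Type*} [NormedAddCommGroup E] [MeasurableSpace α] {m : Measure α}
    {f g : α → E} (hf : Integrable f m) (hg : Integrable g m) :
    Integrable (fun t => f t + g t) m := hf.add hg

theorem integrable_fun_sub {E α : Type*} [NormedAddCommGroup E] [MeasurableSpace α] {m : Measure α}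
    {f g : α → E} (hf : Integrable f m) (hg : Integrable g m) :
    Integrable (fun t => f t - g t) m := hf.sub hg

/-! ### A time-delay approximation of linear evolution equations -/

section Resolvent

open Filter Topology

variable {X : Type*} [NormedAddCommGroup X] [InnerProductSpace ℝ X] [CompleteSpace X]

theorem inner_riesz_right (u : X) (f : StrongDual ℝ X) : inner ℝ u (riesz X f) = f u := by
  rw [real_inner_comm, inner_riesz]

theorem toDualV_apply {K : Type*} [NormedAddCommGroup K]
    [InnerProductSpace ℝ K] [CompleteSpace K] (j : X →L[ℝ] K) (k : K) (R : X) : toDualV j k R = inner ℝ k (j R) := rfl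


theorem exists_solution_of_coercive (A : X →L[ℝ] StrongDual ℝ X) {α : ℝ} (hα : 0 < α)
    (hA : ∀ u, α * ‖u‖ ^ 2 ≤ A u u) (f : StrongDual ℝ X) : ∃ u, A u = f := by
  have hc : IsCoercive A := ⟨α, hα, fun u => by simpa [sq, mul_assoc] using hA u⟩
  refine ⟨hc.continuousLinearEquivOfBilin.symm (riesz X f), ?_⟩
  ext R
  rw [← hc.continuousLinearEquivOfBilin_apply, ContinuousLinearEquiv.apply_symm_apply, inner_riesz]

theorem norm_le_of_coercive {A : X →L[ℝ] StrongDual ℝ X} {α : ℝ} (hα : 0 < α)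
    (hA : ∀ u, α * ‖u‖ ^ 2 ≤ A u u) {f : StrongDual ℝ X} {u : X} (hu : A u = f) :
    ‖u‖ ≤ α⁻¹ * ‖f‖ := by
  have h1 := (hA u).trans ((le_abs_self _).trans ((A u).le_opNorm u))
  rw [hu] at h1
  rcases (norm_nonneg u).eq_or_lt with h0 | h0
  · rw [← h0]; positivity
  · rw [le_inv_mul_iff₀ hα]
    nlinarith

/-- The step `τ = α / β²` minimises `1 - 2 τ α + τ² β²`, so Richardson's iteration for `A u = f`
contracts with a factor depending only on `α` and `β`. -/
theorem norm_richardson_le {A : X →L[ℝ] StrongDual ℝ X} {α β : ℝ} (hα : 0 < α) (hβ : 0 < β)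
    (hA : ∀ u, α * ‖u‖ ^ 2 ≤ A u u) (hA' : ∀ u, ‖A u‖ ≤ β * ‖u‖) (v : X) :
    ‖v - (α / β ^ 2) • riesz X (A v)‖ ≤ √(1 - α ^ 2 / β ^ 2) * ‖v‖ := by
  rw [← Real.sqrt_sq (norm_nonneg v), ← Real.sqrt_mul' _ (sq_nonneg _)]
  refine Real.le_sqrt_of_sq_le ?_
  rw [norm_sub_sq_real, inner_smul_right, real_inner_comm, inner_riesz, norm_smul, norm_riesz,
    Real.norm_of_nonneg (by positivity), mul_pow]
  have h1 := pow_le_pow_left₀ (norm_nonneg _) (hA' v) 2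
  rw [mul_pow] at h1
  have h2 := hA v
  have h3 : (α / β ^ 2) ^ 2 * ‖A v‖ ^ 2 ≤ (α / β ^ 2) ^ 2 * (β ^ 2 * ‖v‖ ^ 2) := by gcongr
  have h4 : (α / β ^ 2) * (α * ‖v‖ ^ 2) ≤ (α / β ^ 2) * A v v := by gcongr
  have h5 : (α / β ^ 2) ^ 2 * (β ^ 2 * ‖v‖ ^ 2) = α ^ 2 / β ^ 2 * ‖v‖ ^ 2 := by field_simp
  have h6 : (α / β ^ 2) * (α * ‖v‖ ^ 2) = α ^ 2 / β ^ 2 * ‖v‖ ^ 2 := by field_simp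
  nlinarith

/-- Solving for each `t` separately gives no measurability in `t`. The Richardson iterates starting
from `0` are measurable by construction, and they converge to the solution pointwise. -/
theorem aestronglyMeasurable_solution [TopologicalSpace.SeparableSpace X] {Ω : Type*}
    [MeasurableSpace Ω] {m : Measure Ω} {A : Ω → X →L[ℝ] StrongDual ℝ X} {α β : ℝ} (hα : 0 < α)
    (hβ : 0 < β) (hA : ∀ᵐ t ∂m, ∀ u, α * ‖u‖ ^ 2 ≤ A t u u)
    (hA' : ∀ᵐ t ∂m, ∀ u, ‖A t u‖ ≤ β * ‖u‖) (hm : ∀ u v, AEMeasurable (fun t => A t u v) m)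
    {f : Ω → StrongDual ℝ X} (hf : AEStronglyMeasurable f m) {u : Ω → X}
    (hu : ∀ᵐ t ∂m, A t (u t) = f t) : AEStronglyMeasurable u m := by
  let v : ℕ → Ω → X := fun n => Nat.rec (fun _ => 0)
    (fun _ w t => w t - (α / β ^ 2) • riesz X (A t (w t) - f t)) n
  have hv : ∀ n, AEStronglyMeasurable (v n) m := by
    intro n
    induction n with
    | zero => exact aestronglyMeasurable_const
    | succ n ih => exact ih.sub (((riesz X).continuous.comp_aestronglyMeasurable
        ((aestronglyMeasurable_bilin hm ih).sub hf)).const_smul _)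
  refine aestronglyMeasurable_of_tendsto_ae atTop hv ?_
  filter_upwards [hA, hA', hu] with t h1 h2 h3
  set q := √(1 - α ^ 2 / β ^ 2)
  have hq : q < 1 := by
    rw [Real.sqrt_lt' one_pos]
    have : 0 < α ^ 2 / β ^ 2 := by positivity
    linarith
  have hb : ∀ n, ‖v n t - u t‖ ≤ q ^ n * ‖u t‖ := by
    intro n
    induction n with
    | zero => simp [v]
    | succ n ih =>
      have e : v (n + 1) t - u t =
          (v n t - u t) - (α / β ^ 2) • riesz X (A t (v n t - u t)) := by
        rw [map_sub (A t), h3]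
        exact sub_right_comm _ _ _
      have e' : q ^ (n + 1) * ‖u t‖ = q * (q ^ n * ‖u t‖) := by ring
      rw [e, e']
      exact (norm_richardson_le hα hβ h1 h2 _).trans
        (mul_le_mul_of_nonneg_left ih (Real.sqrt_nonneg _))
  rw [tendsto_iff_norm_sub_tendsto_zero]
  refine squeeze_zero (fun n => norm_nonneg _) hb ?_
  simpa using (tendsto_pow_atTop_nhds_zero_of_lt_one (Real.sqrt_nonneg _) hq).mul_const ‖u t‖

end Resolvent

/-! ### The delayed equation and its a priori bound -/

section Scheme

open Filter Topology

variable {X K : Type*} [NormedAddCommGroup X] [InnerProductSpace ℝ X] [CompleteSpace X]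
  [TopologicalSpace.SeparableSpace X]
  [NormedAddCommGroup K] [InnerProductSpace ℝ K] [CompleteSpace K]

/-- The operator `h⁻¹ j* j + L` of one implicit time step of length `h`. -/
def stepOp (j : X →L[ℝ] K) (h : ℝ) (L : X →L[ℝ] StrongDual ℝ X) : X →L[ℝ] StrongDual ℝ X :=
  h⁻¹ • (toDualV j).comp j + L

theorem stepOp_apply (j : X →L[ℝ] K) (h : ℝ) (L : X →L[ℝ] StrongDual ℝ X) (u v : X) :
    stepOp j h L u v = h⁻¹ * inner ℝ (j u) (j v) + L u v := by
  simp [stepOp, toDualV_apply]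

theorem stepOp_coercive (j : X →L[ℝ] K) {h : ℝ} (hh : 0 < h) {L : X →L[ℝ] StrongDual ℝ X} {α : ℝ}
    (hL : ∀ u, α * ‖u‖ ^ 2 ≤ L u u) (u : X) : α * ‖u‖ ^ 2 ≤ stepOp j h L u u := by
  rw [stepOp_apply, real_inner_self_eq_norm_sq]
  have : 0 ≤ h⁻¹ * ‖j u‖ ^ 2 := by positivity
  linarith [hL u]

/-- The data of a linear evolution equation `u' + L(t) u = F` on `[0, T]`. -/
structure EvolutionData (X : Type*) [NormedAddCommGroup X] [InnerProductSpace ℝ X] (T : ℝ)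
    (L : ℝ → X →L[ℝ] StrongDual ℝ X) (α β : ℝ) : Prop where
  α_pos : 0 < α
  β_pos : 0 < β
  coercive : ∀ t ∈ Icc 0 T, ∀ u, α * ‖u‖ ^ 2 ≤ L t u u
  bounded : ∀ t ∈ Icc 0 T, ∀ u, ‖L t u‖ ≤ β * ‖u‖
  measurable : ∀ u v, AEMeasurable (fun t => L t u v) (timeMeasure T)

variable {T : ℝ} {L : ℝ → X →L[ℝ] StrongDual ℝ X} {α β : ℝ}

theorem EvolutionData.memLp_step (hL : EvolutionData X T L α β) (j : X →L[ℝ] K) {h : ℝ}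
    (hh : 0 < h) {F : ℝ → StrongDual ℝ X} (hF : MemLp F 2 (timeMeasure T)) {w : ℝ → K}
    (hw : MemLp w 2 (timeMeasure T)) {u : ℝ → X} (hu : ∀ t ∈ Icc 0 T, stepOp j h (L t) (u t) =
      F t + toDualV j (h⁻¹ • w t)) : MemLp u 2 (timeMeasure T) := by
  set f : ℝ → StrongDual ℝ X := fun t => F t + toDualV j (h⁻¹ • w t)
  have hf : MemLp f 2 (timeMeasure T) := memLp_fun_add hF ((toDualV j).comp_memLp' (hw.const_smul h⁻¹))
  have hu' : ∀ t ∈ Icc 0 T, stepOp j h (L t) (u t) = f t := hu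
  have hmem : ∀ᵐ t ∂timeMeasure T, t ∈ Icc 0 T := ae_restrict_mem measurableSet_Icc
  have hb : 0 < h⁻¹ * ‖(toDualV j).comp j‖ + β := by
    have := hL.β_pos
    positivity
  have h1 : ∀ᵐ t ∂timeMeasure T, ∀ u, α * ‖u‖ ^ 2 ≤ stepOp j h (L t) u u :=
    hmem.mono fun t ht => stepOp_coercive j hh (hL.coercive t ht)
  have h2 : ∀ᵐ t ∂timeMeasure T, ∀ u,
      ‖stepOp j h (L t) u‖ ≤ (h⁻¹ * ‖(toDualV j).comp j‖ + β) * ‖u‖ := by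
    filter_upwards [hmem] with t ht u
    have e1 : stepOp j h (L t) u = h⁻¹ • (toDualV j).comp j u + L t u := rfl
    rw [e1, add_mul]
    refine (norm_add_le _ _).trans (add_le_add ?_ (hL.bounded t ht u))
    rw [norm_smul, norm_inv, Real.norm_of_nonneg hh.le, mul_assoc]
    exact mul_le_mul_of_nonneg_left (ContinuousLinearMap.le_opNorm _ _) (by positivity)
  have h3 : ∀ u v, AEMeasurable (fun t => stepOp j h (L t) u v) (timeMeasure T) := by
    intro u v
    simp_rw [stepOp_apply]
    exact (hL.measurable u v).const_add _
  have h4 : AEStronglyMeasurable u (timeMeasure T) :=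
    aestronglyMeasurable_solution hL.α_pos hb h1 h2 h3 hf.1 (hmem.mono hu')
  refine hf.of_le_mul (c := α⁻¹) h4 ?_
  filter_upwards [hmem, h1] with t ht h1
  exact norm_le_of_coercive hL.α_pos h1 (hu' t ht)

/-- Solution of the delayed equation `h⁻¹ (u(t) - u(t - h)) + L(t) u(t) = F(t)`, `u = k₀` for
negative times. -/
structure IsDelaySol (j : X →L[ℝ] K) (T : ℝ) (L : ℝ → X →L[ℝ] StrongDual ℝ X)
    (F : ℝ → StrongDual ℝ X) (k₀ : K) (h : ℝ) (u : ℝ → X) (κ : ℝ → K) : Prop where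
  memLp : MemLp u 2 (timeMeasure T)
  memLp' : MemLp κ 2 (volume.restrict (Icc (-h) T))
  eq_neg : ∀ t < 0, κ t = k₀
  eq_pos : ∀ t ∈ Icc 0 T, κ t = j (u t)
  step : ∀ t ∈ Icc 0 T, ∀ R, h⁻¹ * inner ℝ (κ t - κ (t - h)) (j R) + L t (u t) R = F t R

/-- The value at `t` is obtained from the value at `t - h` by one coercive problem with the operator
`L t` itself, so the coefficients are never averaged in time. Iterating this step map from the
constant `k₀` settles the solution on one more interval of length `h` each time, and values in `𝒞`
persist by induction. -/
theorem exists_isDelaySol (hL : EvolutionData X T L α β) (j : X →L[ℝ] K) {h : ℝ}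
    (hh : 0 < h) {F : ℝ → StrongDual ℝ X} (hF : MemLp F 2 (timeMeasure T)) {k₀ : K} {𝒞 : Set K}
    (hk₀ : k₀ ∈ 𝒞) (h𝒞 : ∀ t ∈ Icc 0 T, ∀ k ∈ 𝒞, ∀ u : X,
      (∀ R, h⁻¹ * inner ℝ (j u - k) (j R) + L t u R = F t R) → j u ∈ 𝒞) :
    ∃ u κ, IsDelaySol j T L F k₀ h u κ ∧ ∀ t ∈ Icc 0 T, j (u t) ∈ 𝒞 := by
  have hJ : ∀ t : ℝ, ∀ k : K, ∃ u : X, t ∈ Icc 0 T →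
      stepOp j h (L t) u = F t + toDualV j (h⁻¹ • k) := by
    intro t k
    by_cases ht : t ∈ Icc 0 T
    · obtain ⟨u, hu⟩ := exists_solution_of_coercive (stepOp j h (L t)) hL.α_pos
        (stepOp_coercive j hh (hL.coercive t ht)) (F t + toDualV j (h⁻¹ • k))
      exact ⟨u, fun _ => hu⟩
    · exact ⟨0, fun h' => absurd h' ht⟩
  choose J hJ using hJ
  have hJ' : ∀ t ∈ Icc 0 T, ∀ k, ∀ R, h⁻¹ * inner ℝ (j (J t k) - k) (j R) + L t (J t k) R = F t R := by
    intro t ht k R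
    have := DFunLike.congr_fun (hJ t k ht) R
    rw [stepOp_apply, add_apply, toDualV_apply, real_inner_smul_left] at this
    rw [inner_sub_left]
    linarith
  obtain ⟨v, v_zero, v_succ⟩ : ∃ v : ℕ → ℝ → K, v 0 = (fun _ => k₀) ∧ ∀ n, v (n + 1) =
      (Iio 0).piecewise (fun _ => k₀) fun t => j (J t (v n (t - h))) :=
    ⟨fun n => Nat.rec (fun _ => k₀)
      (fun _ w => (Iio 0).piecewise (fun _ => k₀) fun t => j (J t (w (t - h)))) n, rfl, fun _ => rfl⟩
  have v_neg : ∀ n, ∀ t < 0, v n t = k₀ := by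
    intro n t ht
    cases n with
    | zero => rw [v_zero]
    | succ n => rw [v_succ]; exact if_pos ht
  have v_pos : ∀ n, ∀ t, 0 ≤ t → v (n + 1) t = j (J t (v n (t - h))) := fun n t ht => by
    rw [v_succ]; exact if_neg (not_lt.2 ht)
  have v_stable : ∀ n : ℕ, ∀ t < n * h, v (n + 1) t = v n t := by
    intro n
    induction n with
    | zero =>
      intro t ht
      rw [Nat.cast_zero, zero_mul] at ht
      rw [v_neg _ t ht, v_neg _ t ht]
    | succ n ih =>
      intro t ht
      rcases lt_or_ge t 0 with h0 | h0
      · rw [v_neg _ t h0, v_neg _ t h0]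
      · rw [v_pos _ t h0, v_pos _ t h0, ih (t - h) (by push_cast at ht; linarith)]
  have v_mem : ∀ n, ∀ t ≤ T, v n t ∈ 𝒞 := by
    intro n
    induction n with
    | zero => rw [v_zero]; exact fun t _ => hk₀
    | succ n ih =>
      intro t ht
      rcases lt_or_ge t 0 with h0 | h0
      · rw [v_neg _ t h0]; exact hk₀
      · rw [v_pos _ t h0]
        exact h𝒞 t ⟨h0, ht⟩ _ (ih (t - h) (by linarith)) _ (hJ' t ⟨h0, ht⟩ _)
  have shift : ∀ n, MemLp (v n) 2 (volume.restrict (Icc (-h) T)) →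
      MemLp (fun t => v n (t - h)) 2 (timeMeasure T) := by
    intro n hn
    have mp := (measurePreserving_sub_right volume h).restrict_preimage
      (measurableSet_Icc (a := -h) (b := T - h))
    have e : (fun x => x - h) ⁻¹' Icc (-h) (T - h) = Icc 0 T := by
      ext t; simp
    rw [e] at mp
    exact (hn.mono_measure (Measure.restrict_mono_set _ (Icc_subset_Icc_right
      (by linarith)))).comp_measurePreserving mp
  have v_memLp : ∀ n, MemLp (v n) 2 (volume.restrict (Icc (-h) T)) := by
    intro n
    induction n with
    | zero => rw [v_zero]; exact memLp_const k₀
    | succ n ih =>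
      rw [v_succ]
      refine MemLp.piecewise measurableSet_Iio (memLp_const k₀) ?_
      have e : (Iio (0 : ℝ))ᶜ ∩ Icc (-h) T = Icc 0 T := by
        ext t
        simp only [mem_inter_iff, mem_compl_iff, mem_Iio, mem_Icc, not_lt]
        exact ⟨fun h' => ⟨h'.1, h'.2.2⟩, fun h' => ⟨h'.1, by linarith [h'.1], h'.2⟩⟩
      rw [Measure.restrict_restrict measurableSet_Iio.compl, e]
      exact j.comp_memLp' (hL.memLp_step j hh hF (shift n ih) fun t ht => hJ t _ ht)
  -- Once `N h > T`, a further iteration changes nothing on `[0, T]`, so the iterate is a fixed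
  -- point of the step map there.
  obtain ⟨N, hN⟩ := exists_nat_gt (T / h)
  rw [div_lt_iff₀ hh] at hN
  have fix : ∀ t ∈ Icc 0 T, v N t = j (J t (v N (t - h))) := fun t ht => by
    rw [← v_pos N t ht.1, v_stable N t (ht.2.trans_lt hN)]
  refine ⟨fun t => J t (v N (t - h)), v N, ⟨?_, v_memLp N, v_neg N, fix, ?_⟩, ?_⟩
  · exact hL.memLp_step j hh hF (shift N (v_memLp N)) fun t ht => hJ t _ ht
  · intro t ht R
    rw [fix t ht]
    exact hJ' t ht _ R
  · intro t ht
    rw [← fix t ht]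
    exact v_mem N t ht.2

/-- Test with `u t` and use `(x - y, x) ≥ (‖x‖² - ‖y‖²) / 2`. The time integral telescopes to two
strips: `[T - h, T]`, which has the good sign, and `[-h, 0]`, where `κ` is `k₀`. The resulting bound
does not depend on `h`. -/
theorem IsDelaySol.bound (hL : EvolutionData X T L α β) {j : X →L[ℝ] K} {h : ℝ}
    (hh : 0 < h) (hhT : h ≤ T) {F : ℝ → StrongDual ℝ X} (hF : MemLp F 2 (timeMeasure T)) {k₀ : K}
    {u : ℝ → X} {κ : ℝ → K} (hu : IsDelaySol j T L F k₀ h u κ) :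
    ∫ t, ‖u t‖ ^ 2 ∂timeMeasure T ≤ α⁻¹ * (‖k₀‖ ^ 2 + α⁻¹ * ∫ t, ‖F t‖ ^ 2 ∂timeMeasure T) := by
  have hα := hL.α_pos
  have hT : 0 ≤ T := hh.le.trans hhT
  have ie : IntegrableOn (fun t => ‖κ t‖ ^ 2) (Icc (-h) T) := hu.memLp'.integrable_norm_pow two_ne_zero
  have ii : ∀ a ∈ Icc (-h) T, ∀ b ∈ Icc (-h) T,
      IntervalIntegrable (fun t => ‖κ t‖ ^ 2) volume a b := fun a ha b hb =>
    (ie.mono_set (uIcc_subset_Icc ha hb)).intervalIntegrable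
  have m1 : -h ∈ Icc (-h) T := ⟨le_rfl, by linarith⟩
  have m2 : (0 : ℝ) ∈ Icc (-h) T := ⟨by linarith, hT⟩
  have m3 : T - h ∈ Icc (-h) T := ⟨by linarith, by linarith⟩
  have m4 : T ∈ Icc (-h) T := ⟨by linarith, le_rfl⟩
  have ic : IntervalIntegrable (fun t => ‖κ (t - h)‖ ^ 2) volume 0 T := by
    have := (ii _ m1 _ m3).comp_sub_right h
    simpa using this
  have iu := intervalIntegrable_of_timeMeasure (hu.memLp.integrable_norm_pow two_ne_zero)
    (left_mem_Icc.2 hT) (right_mem_Icc.2 hT)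
  have iF := intervalIntegrable_of_timeMeasure (hF.integrable_norm_pow two_ne_zero)
    (left_mem_Icc.2 hT) (right_mem_Icc.2 hT)
  have key : ∀ t ∈ Icc 0 T, h⁻¹ * (‖κ t‖ ^ 2 - ‖κ (t - h)‖ ^ 2) + α * ‖u t‖ ^ 2 ≤
      α⁻¹ * ‖F t‖ ^ 2 := by
    intro t ht
    have h1 := hu.step t ht (u t)
    rw [← hu.eq_pos t ht] at h1
    have h2 := hL.coercive t ht (u t)
    have h3 := (le_abs_self _).trans ((F t).le_opNorm (u t))
    have h4 : (‖κ t‖ ^ 2 - ‖κ (t - h)‖ ^ 2) / 2 ≤ inner ℝ (κ t - κ (t - h)) (κ t) := by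
      rw [inner_sub_left, real_inner_self_eq_norm_sq]
      have := real_inner_le_norm (κ (t - h)) (κ t)
      nlinarith [sq_nonneg (‖κ (t - h)‖ - ‖κ t‖)]
    have h5 := mul_le_mul_of_nonneg_left h4 (inv_pos.2 hh).le
    have h6 : 2 * (‖F t‖ * ‖u t‖) ≤ α⁻¹ * ‖F t‖ ^ 2 + α * ‖u t‖ ^ 2 := by
      have h7 : 0 ≤ α⁻¹ * (‖F t‖ - α * ‖u t‖) ^ 2 := by positivity
      have h8 : α⁻¹ * (‖F t‖ - α * ‖u t‖) ^ 2 =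
          α⁻¹ * ‖F t‖ ^ 2 + α * ‖u t‖ ^ 2 - 2 * (‖F t‖ * ‖u t‖) := by
        field_simp
        ring
      linarith
    linarith
  have hint := intervalIntegral.integral_mono_on hT
    ((((ii _ m2 _ m4).sub ic).const_mul h⁻¹).add (iu.const_mul α)) (iF.const_mul α⁻¹) key
  rw [intervalIntegral.integral_add (((ii _ m2 _ m4).sub ic).const_mul h⁻¹) (iu.const_mul α),
    intervalIntegral.integral_const_mul, intervalIntegral.integral_const_mul,
    intervalIntegral.integral_const_mul, intervalIntegral.integral_sub (ii _ m2 _ m4) ic,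
    intervalIntegral.integral_comp_sub_right (fun t => ‖κ t‖ ^ 2) h, zero_sub,
    ← intervalIntegral.integral_add_adjacent_intervals (ii _ m1 _ m2) (ii _ m2 _ m3),
    ← intervalIntegral.integral_add_adjacent_intervals (ii _ m2 _ m3) (ii _ m3 _ m4),
    intervalIntegral_eq_timeMeasure hT, intervalIntegral_eq_timeMeasure hT] at hint
  -- The point `0` has to be removed: `κ 0` is already `j (u 0)`, which may differ from `k₀`.
  have e1 : ∫ t in (-h)..0, ‖κ t‖ ^ 2 = h * ‖k₀‖ ^ 2 := by
    rw [intervalIntegral.integral_congr_ae (g := fun _ => ‖k₀‖ ^ 2)]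
    · simp
    · filter_upwards [compl_mem_ae_iff.2 (measure_singleton (0 : ℝ))] with t h0 ht
      rw [uIoc_of_le (by linarith)] at ht
      rw [hu.eq_neg t (lt_of_le_of_ne ht.2 h0)]
  have e2 : 0 ≤ ∫ t in (T - h)..T, ‖κ t‖ ^ 2 :=
    intervalIntegral.integral_nonneg (by linarith) fun t _ => by positivity
  rw [e1] at hint
  rw [le_inv_mul_iff₀ hα]
  have e3 : h⁻¹ * (h * ‖k₀‖ ^ 2) = ‖k₀‖ ^ 2 := by field_simp
  have e4 := mul_nonneg (inv_pos.2 hh).le e2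
  nlinarith

end Scheme

/-! ### Weak limits along ultrafilters -/

section WeakLimits

open Filter Topology

/-- Banach–Alaoglu along an ultrafilter, which dispenses with subsequences. -/
theorem exists_weak_limit {E : Type*} [NormedAddCommGroup E] [InnerProductSpace ℝ E]
    [CompleteSpace E] {ι : Type*} (l : Ultrafilter ι) (x : ι → E) {M : ℝ} (h : ∀ n, ‖x n‖ ≤ M) :
    ∃ x₀, ∀ y, Tendsto (fun n => inner ℝ (x n) y) l (𝓝 (inner ℝ x₀ y)) := by
  have hc := WeakDual.isCompact_closedBall (𝕜 := ℝ) (E := E) 0 M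
  let F : ι → WeakDual ℝ E := fun n => StrongDual.toWeakDual (InnerProductSpace.toDual ℝ E (x n))
  obtain ⟨f, -, hf⟩ := hc.ultrafilter_le_nhds (l.map F) (by
    refine tendsto_principal.2 (Eventually.of_forall fun n => ?_)
    simpa [F] using h n)
  have hf' : Tendsto F l (𝓝 f) := hf
  refine ⟨(InnerProductSpace.toDual ℝ E).symm (WeakDual.toStrongDual f), fun y => ?_⟩
  have h1 := ((WeakDual.eval_continuous (𝕜 := ℝ) y).tendsto f).comp hf'
  rw [InnerProductSpace.toDual_symm_apply]
  refine h1.congr fun n => ?_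
  exact InnerProductSpace.toDual_apply_apply

theorem exists_weak_limit_memLp {X : Type*} [NormedAddCommGroup X] [InnerProductSpace ℝ X]
    [CompleteSpace X] {α ι : Type*} [MeasurableSpace α] {m : Measure α} (l : Ultrafilter ι)
    {u : ι → α → X} (hu : ∀ n, MemLp (u n) 2 m) {M : ℝ} (hM : ∀ n, ∫ t, ‖u n t‖ ^ 2 ∂m ≤ M) :
    ∃ u₀, MemLp u₀ 2 m ∧ ∀ z, MemLp z 2 m →
      Tendsto (fun n => ∫ t, inner ℝ (u n t) (z t) ∂m) l (𝓝 (∫ t, inner ℝ (u₀ t) (z t) ∂m)) := by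
  have e : ∀ {f g : α → X} (hf : MemLp f 2 m) (hg : MemLp g 2 m),
      inner ℝ (hf.toLp f) (hg.toLp g) = ∫ t, inner ℝ (f t) (g t) ∂m := by
    intro f g hf hg
    rw [L2.inner_def]
    refine integral_congr_ae ?_
    filter_upwards [hf.coeFn_toLp, hg.coeFn_toLp] with t h1 h2
    rw [h1, h2]
  obtain ⟨x₀, h₀⟩ := exists_weak_limit l (fun n => (hu n).toLp (u n)) (M := √M) (fun n => by
    refine Real.le_sqrt_of_sq_le ?_
    rw [← real_inner_self_eq_norm_sq, e]
    simpa only [real_inner_self_eq_norm_sq] using hM n)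
  refine ⟨x₀, Lp.memLp x₀, fun z hz => ?_⟩
  have := h₀ (hz.toLp z)
  simp only [e] at this
  have e2 := e (Lp.memLp x₀) hz
  rw [Lp.toLp_coeFn] at e2
  rwa [← e2]

/-- Testing the weak convergence with `x` times the indicator of `s` bounds the integral over every
measurable `s`, hence the integrand almost everywhere. This is how half-space constraints survive
the limit. -/
theorem ae_le_of_weak_limit {X : Type*} [NormedAddCommGroup X] [InnerProductSpace ℝ X]
    [CompleteSpace X] {α ι : Type*} [MeasurableSpace α] {m : Measure α} [IsFiniteMeasure m]
    {l : Filter ι} [l.NeBot]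
    {u : ι → α → X} {u₀ : α → X} (hu : ∀ n, MemLp (u n) 2 m) (hu₀ : MemLp u₀ 2 m)
    (h : ∀ z, MemLp z 2 m →
      Tendsto (fun n => ∫ t, inner ℝ (u n t) (z t) ∂m) l (𝓝 (∫ t, inner ℝ (u₀ t) (z t) ∂m)))
    {c : ℝ} (x : X) (hx : ∀ n, ∀ᵐ t ∂m, inner ℝ (u n t) x ≤ c) :
    ∀ᵐ t ∂m, inner ℝ (u₀ t) x ≤ c := by
  have hi : ∀ {f : α → X}, MemLp f 2 m → Integrable (fun t => inner ℝ (f t) x) m := fun hf =>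
    (hf.integrable one_le_two).inner_const x
  have h0 : 0 ≤ᵐ[m] fun t => c - inner ℝ (u₀ t) x := by
    refine ae_nonneg_of_forall_setIntegral_nonneg ((integrable_const c).sub (hi hu₀)) ?_
    intro s hs _
    have e : ∀ {f : α → X}, (∫ t, inner ℝ (f t) (s.indicator (fun _ => x) t) ∂m) =
        ∫ t in s, inner ℝ (f t) x ∂m := by
      intro f
      rw [← integral_indicator hs]
      refine integral_congr_ae (Eventually.of_forall fun t => ?_)
      by_cases ht : t ∈ s <;> simp [ht]
    have h1 := h (s.indicator fun _ => x) ((memLp_const x).indicator hs)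
    simp only [e] at h1
    rw [integral_sub (integrable_const c).integrableOn (hi hu₀).integrableOn, sub_nonneg]
    refine le_of_tendsto h1 (Eventually.of_forall fun n => ?_)
    refine setIntegral_mono_ae (hi (hu n)).integrableOn (integrable_const c).integrableOn (hx n)
  filter_upwards [h0] with t ht
  simpa using ht

end WeakLimits

/-! ### The delayed equation in weak form -/

section Delay

open Filter Topology

variable {X K : Type*} [NormedAddCommGroup X] [InnerProductSpace ℝ X] [CompleteSpace X]
  [TopologicalSpace.SeparableSpace X]
  [NormedAddCommGroup K] [InnerProductSpace ℝ K] [CompleteSpace K]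
  {T : ℝ} {L : ℝ → X →L[ℝ] StrongDual ℝ X} {α β : ℝ}

theorem EvolutionData.memLp_apply (hL : EvolutionData X T L α β) {u : ℝ → X}
    (hu : MemLp u 2 (timeMeasure T)) : MemLp (fun t => L t (u t)) 2 (timeMeasure T) := by
  refine hu.of_le_mul (c := β) (aestronglyMeasurable_bilin hL.measurable hu.1) ?_
  filter_upwards [ae_restrict_mem measurableSet_Icc] with t ht using hL.bounded t ht _

/-- Moving `L t` onto the test element writes `L t (u t) R` as an inner product of `u t` with a
fixed `L²` function, so weak convergence of `u` suffices in that term. -/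
theorem EvolutionData.memLp_flip (hL : EvolutionData X T L α β) (R : X) :
    MemLp (fun t => riesz X ((L t).flip R)) 2 (timeMeasure T) := by
  refine MemLp.of_bound ((riesz X).continuous.comp_aestronglyMeasurable
    (aestronglyMeasurable_of_apply fun v => hL.measurable v R)) (β * ‖R‖) ?_
  filter_upwards [ae_restrict_mem measurableSet_Icc] with t ht
  rw [norm_riesz]
  refine ContinuousLinearMap.opNorm_le_bound _ (mul_nonneg hL.β_pos.le (norm_nonneg _)) fun v => ?_
  rw [ContinuousLinearMap.flip_apply]
  refine ((L t v).le_opNorm R).trans ?_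
  have := mul_le_mul_of_nonneg_right (hL.bounded t ht v) (norm_nonneg R)
  linarith

theorem abs_difference_quotient_sub_le {φ : ℝ → ℝ} (hφ : Continuous φ) {κ : NNReal}
    (hκ : LipschitzWith κ φ) (c t : ℝ) {h : ℝ} (hh : 0 < h) :
    |h⁻¹ * ((∫ s in c..t, φ s) - ∫ s in c..t + h, φ s) + φ t| ≤ κ * h := by
  have e1 : (∫ s in c..t, φ s) - ∫ s in c..t + h, φ s = - ∫ s in t..t + h, φ s := by
    rw [← intervalIntegral.integral_add_adjacent_intervals (hφ.intervalIntegrable c t)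
      (hφ.intervalIntegrable t (t + h))]
    ring
  have e2 : h⁻¹ * (- ∫ s in t..t + h, φ s) + φ t = -(h⁻¹ * ∫ s in t..t + h, (φ s - φ t)) := by
    rw [intervalIntegral.integral_sub (hφ.intervalIntegrable _ _) (by simp),
      intervalIntegral.integral_const]
    simp only [add_sub_cancel_left, smul_eq_mul]
    field_simp
    ring
  have e3 : ‖∫ s in t..t + h, (φ s - φ t)‖ ≤ κ * h * |t + h - t| := by
    refine intervalIntegral.norm_integral_le_of_norm_le_const fun s hs => ?_
    rw [uIoc_of_le (by linarith)] at hs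
    have := hκ.dist_le_mul s t
    rw [dist_eq_norm, Real.dist_eq, abs_of_nonneg (by linarith [hs.1])] at this
    refine this.trans ?_
    gcongr
    linarith [hs.2]
  rw [e1, e2, abs_neg, abs_mul, abs_of_pos (inv_pos.2 hh), inv_mul_le_iff₀ hh]
  rw [add_sub_cancel_left, abs_of_pos hh] at e3
  calc _ ≤ _ := e3
    _ = _ := by ring

/-- Summation by parts in time: a shift by `h` moves the difference quotient to `ψ`. Since `ψ` is
constant up to `a ≥ h`, the strip `[-h, 0]` contributes exactly the initial value; since `ψ`
vanishes after `T`, the strip at the other end contributes nothing. -/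
theorem IsDelaySol.integral_eq {j : X →L[ℝ] K} {h a : ℝ} (hL : EvolutionData X T L α β)
    (hh : 0 < h) (ha : h ≤ a) (haT : a ≤ T) {F : ℝ → StrongDual ℝ X}
    (hF : MemLp F 2 (timeMeasure T)) {k₀ : K} {u : ℝ → X} {κ : ℝ → K}
    (hu : IsDelaySol j T L F k₀ h u κ) (R : X) {ψ : ℝ → ℝ} (hψ : Continuous ψ)
    (hψ0 : ∀ t ≤ a, ψ t = ψ 0) (hψT : ∀ t, T ≤ t → ψ t = 0) :
    (∫ t, inner ℝ (j (u t)) (j R) * (h⁻¹ * (ψ t - ψ (t + h))) ∂timeMeasure T) -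
      inner ℝ k₀ (j R) * ψ 0 + ∫ t, L t (u t) R * ψ t ∂timeMeasure T =
      ∫ t, F t R * ψ t ∂timeMeasure T := by
  have hT : 0 ≤ T := by linarith
  set k : ℝ → ℝ := fun t => inner ℝ (κ t) (j R)
  have ik : IntegrableOn k (Icc (-h) T) := (hu.memLp'.integrable one_le_two).inner_const _
  have im : ∀ {f : ℝ → ℝ} {ψ' : ℝ → ℝ} {s t : ℝ}, Continuous ψ' → IntervalIntegrable f volume s t →
      IntervalIntegrable (fun t => f t * ψ' t) volume s t := fun hψ' hf =>
    hf.mul_continuousOn hψ'.continuousOn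
  have ii : ∀ a ∈ Icc (-h) T, ∀ b ∈ Icc (-h) T,
      IntervalIntegrable k volume a b := fun a ha b hb =>
    (ik.mono_set (uIcc_subset_Icc ha hb)).intervalIntegrable
  have m1 : -h ∈ Icc (-h) T := ⟨le_rfl, by linarith⟩
  have m2 : (0 : ℝ) ∈ Icc (-h) T := ⟨by linarith, hT⟩
  have m3 : T - h ∈ Icc (-h) T := ⟨by linarith, by linarith⟩
  have m4 : T ∈ Icc (-h) T := ⟨by linarith, le_rfl⟩
  have ic : IntervalIntegrable (fun t => k (t - h)) volume 0 T := by
    have := (ii _ m1 _ m3).comp_sub_right h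
    simpa using this
  have ti : ∀ {f : ℝ → ℝ}, Integrable f (timeMeasure T) → IntervalIntegrable f volume 0 T :=
    fun hf => intervalIntegrable_of_timeMeasure hf (left_mem_Icc.2 hT) (right_mem_Icc.2 hT)
  have iL : IntervalIntegrable (fun t => L t (u t) R) volume 0 T :=
    ti (integrable_apply ((hL.memLp_apply hu.memLp).integrable one_le_two) R)
  have iF : IntervalIntegrable (fun t => F t R) volume 0 T :=
    ti (integrable_apply (hF.integrable one_le_two) R)
  have hψh : Continuous fun t => ψ (t + h) := by fun_prop
  have key : ∀ t ∈ uIcc 0 T, F t R * ψ t =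
      h⁻¹ * (k t * ψ t) - h⁻¹ * (k (t - h) * ψ t) + L t (u t) R * ψ t := by
    intro t ht
    rw [uIcc_of_le hT] at ht
    rw [← hu.step t ht R, inner_sub_left]
    ring
  have shift : ∫ t in (0 : ℝ)..T, k (t - h) * ψ t =
      inner ℝ k₀ (j R) * ψ 0 * h + ∫ t in (0 : ℝ)..T, k t * ψ (t + h) := by
    have e1 : ∫ t in (0 : ℝ)..T, k (t - h) * ψ t = ∫ t in (-h)..(T - h), k t * ψ (t + h) := by
      have := intervalIntegral.integral_comp_sub_right (a := 0) (b := T)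
        (fun t => k t * ψ (t + h)) h
      simpa using this
    have e2 : ∫ t in (-h)..0, k t * ψ (t + h) = inner ℝ k₀ (j R) * ψ 0 * h := by
      have : ∫ t in (-h)..0, k t * ψ (t + h) = ∫ t in (-h)..0, inner ℝ k₀ (j R) * ψ 0 := by
        refine intervalIntegral.integral_congr_ae ?_
        have h0 : ∀ᵐ t : ℝ, t ≠ 0 := by simp [ae_iff]
        filter_upwards [h0] with t h0 ht
        rw [uIoc_of_le (by linarith)] at ht
        have : t < 0 := lt_of_le_of_ne ht.2 h0
        simp only [k]
        rw [hu.eq_neg t this, hψ0 (t + h) (by linarith)]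
      rw [this, intervalIntegral.integral_const]
      simp
      ring
    have e3 : ∫ t in (T - h)..T, k t * ψ (t + h) = 0 := by
      rw [← intervalIntegral.integral_zero (a := T - h) (b := T) (μ := volume)]
      refine intervalIntegral.integral_congr fun t ht => ?_
      rw [uIcc_of_le (by linarith)] at ht
      simp only [hψT (t + h) (by linarith [ht.1]), mul_zero]
    rw [e1, ← intervalIntegral.integral_add_adjacent_intervals (im hψh (ii _ m1 _ m2))
      (im hψh (ii _ m2 _ m3)), e2,
      ← intervalIntegral.integral_add_adjacent_intervals (im hψh (ii _ m2 _ m3))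
      (im hψh (ii _ m3 _ m4)), e3, add_zero]
  have ek : ∫ t, inner ℝ (j (u t)) (j R) * (h⁻¹ * (ψ t - ψ (t + h))) ∂timeMeasure T =
      h⁻¹ * (∫ t in (0 : ℝ)..T, k t * ψ t) - h⁻¹ * ∫ t in (0 : ℝ)..T, k t * ψ (t + h) := by
    rw [← intervalIntegral.integral_const_mul, ← intervalIntegral.integral_const_mul,
      ← intervalIntegral.integral_sub ((im hψ (ii _ m2 _ m4)).const_mul _)
        ((im hψh (ii _ m2 _ m4)).const_mul _), ← intervalIntegral_eq_timeMeasure hT]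
    refine intervalIntegral.integral_congr fun t ht => ?_
    rw [uIcc_of_le hT] at ht
    simp only [k]
    rw [hu.eq_pos t ht]
    ring
  rw [ek, ← intervalIntegral_eq_timeMeasure hT, ← intervalIntegral_eq_timeMeasure hT,
    intervalIntegral.integral_congr key, intervalIntegral.integral_add
      (((im hψ (ii _ m2 _ m4)).const_mul _).sub ((im hψ ic).const_mul _)) (im hψ iL),
    intervalIntegral.integral_sub ((im hψ (ii _ m2 _ m4)).const_mul _) ((im hψ ic).const_mul _),
    intervalIntegral.integral_const_mul, intervalIntegral.integral_const_mul, shift]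
  field_simp
  ring

end Delay

/-! ### Linear evolution equations in a closed convex set -/

section LinearExistence

open Filter Topology

variable {X K : Type*} [NormedAddCommGroup X] [InnerProductSpace ℝ X] [CompleteSpace X]
  [TopologicalSpace.SeparableSpace X]
  [NormedAddCommGroup K] [InnerProductSpace ℝ K] [CompleteSpace K]
  {T : ℝ} {L : ℝ → X →L[ℝ] StrongDual ℝ X} {α β : ℝ}

theorem memLp_continuous_smul {E : Type*} [NormedAddCommGroup E] [NormedSpace ℝ E] {ψ : ℝ → ℝ}
    (hψ : Continuous ψ) {z : ℝ → E} {p : ENNReal} (hz : MemLp z p (timeMeasure T)) :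
    MemLp (fun t => ψ t • z t) p (timeMeasure T) := by
  obtain ⟨c, hc⟩ := isCompact_Icc.exists_bound_of_continuousOn hψ.continuousOn (s := Icc 0 T)
  refine hz.of_le_mul (c := c) (hψ.aestronglyMeasurable.smul hz.1) ?_
  filter_upwards [ae_restrict_mem measurableSet_Icc] with t ht
  rw [norm_smul]
  exact mul_le_mul_of_nonneg_right (hc t ht) (norm_nonneg _)

/-- It suffices to test an integrated equation with countably many elements. -/
theorem ae_forall_eq_of_forall_ae_eq {j : X →L[ℝ] K} {u : ℝ → X} {g : ℝ → StrongDual ℝ X} {k₀ : K}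
    (hg : Integrable g (timeMeasure T)) (h : ∀ R, ∀ᵐ t ∂timeMeasure T, inner ℝ (j (u t)) (j R) =
      inner ℝ k₀ (j R) + ∫ s in (0 : ℝ)..t, g s R) :
    ∀ᵐ t ∂timeMeasure T, ∀ R, inner ℝ (j (u t)) (j R) =
      inner ℝ k₀ (j R) + ∫ s in (0 : ℝ)..t, g s R := by
  have h1 := ae_all_iff.2 fun n => h (TopologicalSpace.denseSeq X n)
  filter_upwards [h1, ae_restrict_mem measurableSet_Icc] with t h1 ht
  have e : ∀ R, ∫ s in (0 : ℝ)..t, g s R = (∫ s in (0 : ℝ)..t, g s) R := fun R =>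
    (ContinuousLinearMap.intervalIntegral_apply
      (intervalIntegrable_of_timeMeasure hg ⟨le_rfl, ht.1.trans ht.2⟩ ht) R).symm
  simp only [e] at h1 ⊢
  refine congr_fun (Continuous.ext_on (TopologicalSpace.denseRange_denseSeq X) ?_ ?_ ?_)
  · fun_prop
  · fun_prop
  · rintro _ ⟨n, rfl⟩
    exact h1 n

/-- Existence for the linear equation `u' + L(t) u = F` in a closed convex set `𝒞` that is
invariant under the implicit time steps. -/
theorem exists_isSol_linear (hT : 0 < T) (hL : EvolutionData X T L α β) (j : X →L[ℝ] K)
    {F : ℝ → StrongDual ℝ X} (hF : MemLp F 2 (timeMeasure T)) {k₀ : K} {𝒞 : Set K}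
    (hk₀ : k₀ ∈ 𝒞) (h𝒞c : IsClosed 𝒞) (h𝒞v : Convex ℝ 𝒞)
    (h𝒞 : ∀ h > 0, ∀ t ∈ Icc 0 T, ∀ k ∈ 𝒞, ∀ u : X,
      (∀ R, h⁻¹ * inner ℝ (j u - k) (j R) + L t u R = F t R) → j u ∈ 𝒞) :
    ∃ u p, IsSol j T (fun t => F t - L t (u t)) k₀ u p ∧ ∀ t ∈ Icc 0 T, p t ∈ 𝒞 := by
  let h : ℕ → ℝ := fun n => T / (n + 1)
  have hh : ∀ n, 0 < h n := fun n => by positivity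
  have hhT : ∀ n, h n ≤ T := fun n => div_le_self hT.le (by linarith [n.cast_nonneg (α := ℝ)])
  have hlim : Tendsto h (hyperfilter ℕ) (𝓝 0) :=
    (by simpa [h, div_eq_mul_inv] using (tendsto_one_div_add_atTop_nhds_zero_nat (𝕜 := ℝ)).const_mul T :
      Tendsto h atTop (𝓝 0)).mono_left Nat.hyperfilter_le_atTop
  choose u κ hu hmem using fun n => exists_isDelaySol hL j (hh n) hF hk₀ (h𝒞 (h n) (hh n))
  have hbound := fun n => (hu n).bound hL (hh n) (hhT n) hF
  set M := α⁻¹ * (‖k₀‖ ^ 2 + α⁻¹ * ∫ t, ‖F t‖ ^ 2 ∂timeMeasure T)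
  obtain ⟨u₀, hu₀, hw⟩ := exists_weak_limit_memLp (hyperfilter ℕ) (fun n => (hu n).memLp) hbound
  have hLu := hL.memLp_apply hu₀
  have hg : MemLp (fun t => F t - L t (u₀ t)) 2 (timeMeasure T) := memLp_fun_sub hF hLu
  have hgi := hg.integrable one_le_two
  have main : ∀ R, ∀ᵐ t ∂timeMeasure T, inner ℝ (j (u₀ t)) (j R) =
      inner ℝ k₀ (j R) + ∫ s in (0 : ℝ)..t, (F s - L s (u₀ s)) R := by
    intro R
    have iu : ∀ {v : ℝ → X}, MemLp v 2 (timeMeasure T) →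
        Integrable (fun t => inner ℝ (j (v t)) (j R)) (timeMeasure T) := fun hv =>
      ((j.comp_memLp' hv).integrable one_le_two).inner_const _
    have iG := (continuousOn_primitive_timeMeasure (integrable_apply hgi R)).integrableOn_compact
      (μ := volume) isCompact_Icc
    have := ae_eq_zero_of_integral_test hT ((iu hu₀).sub ((integrable_const (inner ℝ k₀ (j R))).add iG)) ?_
    · filter_upwards [this] with t ht using sub_eq_zero.1 ht
    intro φ hφ
    obtain ⟨a, b, ha, hb, hab, h0⟩ := hφ.exists_Icc hT
    have hφc : Continuous φ := hφ.1.continuous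
    obtain ⟨κ', hκ'⟩ := ContDiff.lipschitzWith_of_hasCompactSupport hφ.2.1 hφ.1 (by simp)
    -- Testing the delayed equation with the primitive of `φ` that vanishes at `T` yields in the
    -- limit the integrated equation tested with `φ`. The initial value then appears as the term
    -- with `ψ 0`.
    let ψ : ℝ → ℝ := fun t => ∫ s in T..t, φ s
    have hψ : ContDiff ℝ ∞ ψ := contDiff_primitive hφ.1 T
    have hψc : Continuous ψ := hψ.continuous
    have hψ0 : ∀ t ≤ a / 2, ψ t = ψ 0 := by
      intro t ht
      rw [← sub_eq_zero, intervalIntegral.integral_interval_sub_left (hφc.intervalIntegrable _ _)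
        (hφc.intervalIntegrable _ _), intervalIntegral.integral_congr (g := fun _ => 0),
        intervalIntegral.integral_zero]
      intro s hs
      refine h0 s fun hs' => ?_
      rw [uIcc, mem_Icc] at hs
      have := hs.2.trans (max_le (by linarith : (0:ℝ) ≤ a / 2) ht)
      linarith [hs'.1]
    have hψT : ∀ t, T ≤ t → ψ t = 0 := by
      intro t ht
      simp only [ψ]
      rw [intervalIntegral.integral_congr (g := fun _ => 0), intervalIntegral.integral_zero]
      intro s hs
      refine h0 s fun hs' => ?_
      rw [uIcc_of_le ht] at hs
      linarith [hs'.2, hs.1]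
    -- The difference quotient of `ψ` equals `-φ` up to an error of order `h`, uniformly in time. As
    -- the `u n` are bounded in `L²`, the error vanishes without any strong convergence.
    have l1 : Tendsto (fun n => ∫ t, inner ℝ (j (u n t)) (j R) *
        ((h n)⁻¹ * (ψ t - ψ (t + h n)) + φ t) ∂timeMeasure T) (hyperfilter ℕ) (𝓝 0) := by
      refine squeeze_zero_norm (a := fun n => h n * (κ' * (‖j‖ * ‖j R‖ * (T + M)))) (fun n => ?_) ?_
      · have i1 : Integrable (fun t => 1 + ‖u n t‖ ^ 2) (timeMeasure T) :=
          (integrable_const 1).add ((hu n).memLp.integrable_norm_pow two_ne_zero)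
        refine (norm_integral_le_of_norm_le (i1.const_mul (κ' * h n * (‖j‖ * ‖j R‖)))
          (Eventually.of_forall fun t => ?_)).trans ?_
        · rw [norm_mul, mul_comm]
          have e1 : ‖inner ℝ (j (u n t)) (j R)‖ ≤ ‖j‖ * ‖j R‖ * (1 + ‖u n t‖ ^ 2) := by
            refine (norm_inner_le_norm _ _).trans ?_
            have := j.le_opNorm (u n t)
            have e2 : ‖u n t‖ ≤ 1 + ‖u n t‖ ^ 2 := by nlinarith [sq_nonneg (‖u n t‖ - 1)]
            calc ‖j (u n t)‖ * ‖j R‖ ≤ (‖j‖ * (1 + ‖u n t‖ ^ 2)) * ‖j R‖ := by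
                  refine mul_le_mul_of_nonneg_right (this.trans ?_) (norm_nonneg _)
                  exact mul_le_mul_of_nonneg_left e2 (norm_nonneg _)
              _ = _ := by ring
          rw [mul_assoc (κ' * h n : ℝ)]
          exact mul_le_mul (abs_difference_quotient_sub_le hφc hκ' T t (hh n)) e1 (norm_nonneg _)
            (mul_nonneg κ'.2 (hh n).le)
        · rw [integral_const_mul, integral_add (integrable_const 1)
            ((hu n).memLp.integrable_norm_pow two_ne_zero)]
          have e3 : ∫ _, (1 : ℝ) ∂timeMeasure T = T := by simp [hT.le]
          rw [e3]
          have e4 : κ' * h n * (‖j‖ * ‖j R‖) * (T + ∫ t, ‖u n t‖ ^ 2 ∂timeMeasure T) ≤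
              κ' * h n * (‖j‖ * ‖j R‖) * (T + M) := by
            refine mul_le_mul_of_nonneg_left (add_le_add le_rfl (hbound n)) ?_
            exact mul_nonneg (mul_nonneg κ'.2 (hh n).le) (by positivity)
          exact e4.trans_eq (by ring)
      · simpa using hlim.mul_const (κ' * (‖j‖ * ‖j R‖ * (T + M)))
    have l2 : Tendsto (fun n => ∫ t, inner ℝ (j (u n t)) (j R) * φ t ∂timeMeasure T)
        (hyperfilter ℕ) (𝓝 (∫ t, inner ℝ (j (u₀ t)) (j R) * φ t ∂timeMeasure T)) := by
      have := hw (fun t => φ t • riesz X (toDualV j (j R)))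
        (memLp_continuous_smul hφc (memLp_const _))
      have e : ∀ v : X, ∀ t, inner ℝ v (φ t • riesz X (toDualV j (j R))) =
          inner ℝ (j v) (j R) * φ t := fun v t => by
        rw [real_inner_smul_right, inner_riesz_right, toDualV_apply, real_inner_comm, mul_comm]
      simpa only [e] using this
    have l3 : Tendsto (fun n => ∫ t, L t (u n t) R * ψ t ∂timeMeasure T)
        (hyperfilter ℕ) (𝓝 (∫ t, L t (u₀ t) R * ψ t ∂timeMeasure T)) := by
      have := hw (fun t => ψ t • riesz X ((L t).flip R))
        (memLp_continuous_smul hψc (hL.memLp_flip R))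
      have e : ∀ v : X, ∀ t, inner ℝ v (ψ t • riesz X ((L t).flip R)) =
          L t v R * ψ t := fun v t => by
        rw [real_inner_smul_right, inner_riesz_right, ContinuousLinearMap.flip_apply, mul_comm]
      simpa only [e] using this
    have mulψ : ∀ {f χ : ℝ → ℝ}, Continuous χ → Integrable f (timeMeasure T) →
        Integrable (fun t => f t * χ t) (timeMeasure T) := fun hχ hf =>
      IntegrableOn.mul_continuousOn hf hχ.continuousOn isCompact_Icc
    have l4 : ∀ᶠ n in (hyperfilter ℕ : Filter ℕ), (∫ t, inner ℝ (j (u n t)) (j R) *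
        ((h n)⁻¹ * (ψ t - ψ (t + h n)) + φ t) ∂timeMeasure T) -
        (∫ t, inner ℝ (j (u n t)) (j R) * φ t ∂timeMeasure T) - inner ℝ k₀ (j R) * ψ 0 +
        ∫ t, L t (u n t) R * ψ t ∂timeMeasure T = ∫ t, F t R * ψ t ∂timeMeasure T := by
      filter_upwards [hlim.eventually (eventually_le_nhds (half_pos ha))] with n hn
      rw [← (hu n).integral_eq hL (hh n) hn (by linarith) hF R hψc hψ0 hψT,
        ← integral_sub (mulψ (by fun_prop) (iu (hu n).memLp)) (mulψ hφc (iu (hu n).memLp))]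
      congr 3
      ext t
      ring
    have l5 := tendsto_nhds_unique (((l1.sub l2).sub_const (inner ℝ k₀ (j R) * ψ 0)).add l3)
      (tendsto_const_nhds.congr' (l4.mono fun n hn => hn.symm))
    have l6 := integral_primitive_mul_deriv hT.le (hψ.of_le (by simp)) (integrable_apply hgi R)
    have l7 : ∀ t, deriv ψ t = φ t := deriv_primitive hφc T
    simp only [l7] at l6
    rw [hψT T le_rfl, mul_zero, zero_sub] at l6
    have l8 : ∫ t in (0 : ℝ)..T, φ t = -ψ 0 := by
      simp only [ψ]
      rw [intervalIntegral.integral_symm]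
    rw [intervalIntegral_eq_timeMeasure hT.le] at l6 l8 ⊢
    rw [intervalIntegral_eq_timeMeasure hT.le] at l6
    have l9 : ∫ t, (F t - L t (u₀ t)) R * ψ t ∂timeMeasure T =
        (∫ t, F t R * ψ t ∂timeMeasure T) - ∫ t, L t (u₀ t) R * ψ t ∂timeMeasure T := by
      rw [← integral_sub (mulψ hψc (integrable_apply (hF.integrable one_le_two) R))
        (mulψ hψc (integrable_apply (hLu.integrable one_le_two) R))]
      congr 1
      ext t
      rw [sub_apply, sub_mul]
    have i2 : Integrable φ (timeMeasure T) := hφc.continuousOn.integrableOn_compact isCompact_Icc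
    trans ∫ t, (inner ℝ (j (u₀ t)) (j R) * φ t - (inner ℝ k₀ (j R) * φ t +
          (∫ s in (0 : ℝ)..t, (F s - L s (u₀ s)) R) * φ t)) ∂timeMeasure T
    · refine integral_congr_ae (Eventually.of_forall fun t => ?_)
      simp only [Pi.sub_apply, Pi.add_apply]
      ring
    rw [integral_sub (mulψ hφc (iu hu₀)) (integrable_fun_add (i2.const_mul _) (mulψ hφc iG)),
      integral_add (i2.const_mul _) (mulψ hφc iG), integral_const_mul, l8, l6, l9]
    linarith
  obtain ⟨p, hp⟩ := exists_isSol hT hu₀ hg (ae_forall_eq_of_forall_ae_eq hgi main)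
  refine ⟨u₀, p, hp, fun t₀ ht₀ => ?_⟩
  -- A closed convex set is an intersection of half-spaces. If `p t₀` lay outside, a separating
  -- functional would bound all approximations, hence the weak limit almost everywhere, hence `p t₀`
  -- by continuity.
  by_contra hn
  obtain ⟨f, c, hf1, hf2⟩ := geometric_hahn_banach_closed_point h𝒞v h𝒞c hn
  have h1 := ae_le_of_weak_limit (fun n => (hu n).memLp) hu₀ hw (c := c) (riesz X (f.comp j))
    fun n => by
      filter_upwards [ae_restrict_mem measurableSet_Icc] with t ht
      rw [inner_riesz_right]
      exact (hf1 _ (hmem n t ht)).le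
  have h2 : ∀ᵐ t ∂timeMeasure T, f (p t) ≤ c := by
    filter_upwards [h1, hp.ae_eq] with t h1 h2
    rw [inner_riesz_right] at h1
    rwa [← h2]
  have h3 := Icc_subset_closure_of_ae hT h2 ht₀
  have h4 : ContinuousOn (fun t => f (p t)) (Icc 0 T) := f.continuous.comp_continuousOn hp.cont
  have h5 : f (p t₀) ≤ c := by
    have : IsClosed {t | t ∈ Icc 0 T ∧ f (p t) ≤ c} :=
      h4.preimage_isClosed_of_isClosed isClosed_Icc isClosed_Iic
    exact (this.closure_eq ▸ h3).2
  linarith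

end LinearExistence

/-! ### Completeness, adjoints and separability of the Hilbert–Schmidt space -/

namespace HS

open Filter Topology

variable {X Y Z : Type*}
  [NormedAddCommGroup X] [InnerProductSpace ℝ X] [CompleteSpace X]
  [NormedAddCommGroup Y] [InnerProductSpace ℝ Y]
  [NormedAddCommGroup Z] [InnerProductSpace ℝ Z]

theorem sum_sq_le (T : HS X Y) (s : Finset (onbIndex X)) :
    ∑ i ∈ s, ‖T.op (onb X i)‖ ^ 2 ≤ ‖T‖ ^ 2 := by
  rw [norm_sq_eq]
  exact T.isHS.sum_le_tsum s fun i _ => sq_nonneg _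

/-- Expand `x` in the basis; on partial sums this is Cauchy–Schwarz followed by Bessel's inequality.
-/
theorem norm_op_apply_le (T : HS X Y) (x : X) : ‖T.op x‖ ≤ ‖T‖ * ‖x‖ := by
  have h : HasSum (fun i => inner ℝ (onb X i) x • T.op (onb X i)) (T.op x) := by
    have := ((onb X).hasSum_repr x).mapL T.op
    simpa [(onb X).repr_apply_apply] using this
  refine le_of_tendsto h.norm (Eventually.of_forall fun s => (norm_sum_le _ _).trans ?_)
  refine (sq_le_sq₀ (Finset.sum_nonneg fun i _ => norm_nonneg _) (by positivity)).1 ?_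
  refine le_trans (b := (∑ i ∈ s, |inner ℝ (onb X i) x| ^ 2) * ∑ i ∈ s, ‖T.op (onb X i)‖ ^ 2) ?_ ?_
  · simp only [norm_smul, Real.norm_eq_abs]
    exact Finset.sum_mul_sq_le_sq_mul_sq s _ _
  · rw [mul_pow, mul_comm]
    refine mul_le_mul (T.sum_sq_le s) ?_ (Finset.sum_nonneg fun i _ => sq_nonneg _) (sq_nonneg _)
    simpa using (onb X).orthonormal.sum_inner_products_le (s := s) x

theorem norm_op_le (T : HS X Y) : ‖T.op‖ ≤ ‖T‖ :=
  ContinuousLinearMap.opNorm_le_bound _ (norm_nonneg _) T.norm_op_apply_le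

/-- The embedding of the Hilbert–Schmidt operators into the bounded operators. -/
def opL : HS X Y →L[ℝ] (X →L[ℝ] Y) :=
  LinearMap.mkContinuous op 1 fun T => by simpa using T.norm_op_le

theorem norm_le_of_forall_sum_le {T : HS X Y} {c : ℝ} (hc : 0 ≤ c)
    (h : ∀ s : Finset (onbIndex X), ∑ i ∈ s, ‖T.op (onb X i)‖ ^ 2 ≤ c ^ 2) : ‖T‖ ≤ c := by
  refine (sq_le_sq₀ (norm_nonneg _) hc).1 ?_
  rw [norm_sq_eq]
  exact T.isHS.tsum_le_of_sum_le h

/-- A Cauchy sequence converges in operator norm. The Cauchy estimate holds for finite partial sums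
of squares uniformly in the finite set, and such sums pass to the limit. -/
instance [CompleteSpace Y] : CompleteSpace (HS X Y) := by
  refine Metric.complete_of_cauchySeq_tendsto fun S hS => ?_
  obtain ⟨T, hT⟩ := cauchySeq_tendsto_of_complete 
    ((opL (X := X) (Y := Y)).uniformContinuous.comp_cauchySeq hS)
  have hT' : ∀ x, Tendsto (fun n => (S n).op x) atTop (𝓝 (T x)) := fun x =>
    ((ContinuousLinearMap.apply ℝ Y x).continuous.tendsto T).comp hT
  have key : ∀ ε > 0, ∃ N, ∀ n ≥ N, ∀ s : Finset (onbIndex X),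
      ∑ i ∈ s, ‖((S n).op - T) (onb X i)‖ ^ 2 ≤ ε ^ 2 := by
    intro ε hε
    obtain ⟨N, hN⟩ := Metric.cauchySeq_iff.1 hS ε hε
    refine ⟨N, fun n hn s => ?_⟩
    have h1 : Tendsto (fun m => ∑ i ∈ s, ‖(S n - S m).op (onb X i)‖ ^ 2) atTop
        (𝓝 (∑ i ∈ s, ‖((S n).op - T) (onb X i)‖ ^ 2)) := by
      refine tendsto_finsetSum _ fun i _ => ?_
      simp only [map_sub, sub_apply]
      exact ((hT' _).const_sub _).norm.pow 2
    refine le_of_tendsto h1 ?_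
    filter_upwards [eventually_ge_atTop N] with m hm
    refine ((S n - S m).sum_sq_le s).trans ?_
    have := hN n hn m hm
    rw [dist_eq_norm] at this
    exact pow_le_pow_left₀ (norm_nonneg _) this.le 2
  have hHS : IsHS T := by
    obtain ⟨N, hN⟩ := key 1 one_pos
    have h1 : IsHS ((S N).op - T) :=
      summable_of_sum_le (fun i => sq_nonneg _) (hN N le_rfl)
    have h2 : T = (S N).op - ((S N).op - T) := by abel
    rw [h2]
    exact (hsSubmodule X Y).sub_mem (S N).isHS h1
  refine ⟨mk T hHS, Metric.tendsto_atTop.2 fun ε hε => ?_⟩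
  obtain ⟨N, hN⟩ := key (ε / 2) (half_pos hε)
  refine ⟨N, fun n hn => ?_⟩
  rw [dist_eq_norm]
  refine (norm_le_of_forall_sum_le (half_pos hε).le fun s => ?_).trans_lt (half_lt_self hε)
  simpa using hN n hn s

theorem isHS_rankOne (x : X) (y : Y) : IsHS ((innerSL ℝ x).smulRight y) := by
  refine Summable.congr (((onb X).summable_inner_mul_inner x x).mul_left (‖y‖ ^ 2)) fun i => ?_
  simp only [ContinuousLinearMap.smulRight_apply, innerSL_apply_apply, norm_smul, mul_pow,
    Real.norm_eq_abs, sq_abs]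
  rw [real_inner_comm x (onb X i)]
  ring

/-- The rank one operator `z ↦ (x, z) y`. -/
def rankOne (x : X) (y : Y) : HS X Y := mk _ (isHS_rankOne x y)

@[simp] theorem rankOne_apply (x z : X) (y : Y) : (rankOne x y).op z = inner ℝ x z • y := rfl

/-- Rank one test elements read off matrix entries. Density arguments in `ℋ` and the pointwise form
of the operator equation both start from this. -/
theorem inner_rankOne (T : HS X Y) (x : X) (y : Y) : inner ℝ T (rankOne x y) = inner ℝ (T.op x) y := by
  rw [inner_eq]
  have h : HasSum (fun i => inner ℝ (onb X i) x • T.op (onb X i)) (T.op x) := by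
    have := ((onb X).hasSum_repr x).mapL T.op
    simpa [(onb X).repr_apply_apply] using this
  have h' := h.mapL (innerSL ℝ y)
  rw [innerSL_apply_apply, real_inner_comm] at h'
  rw [← h'.tsum_eq]
  refine tsum_congr fun i => ?_
  rw [innerSL_apply_apply, rankOne_apply, real_inner_smul_right, real_inner_smul_right,
    real_inner_comm (onb X i) x, real_inner_comm y]

@[ext] theorem ext {S T : HS X Y} (h : ∀ x, S.op x = T.op x) : S = T :=
  op_injective (ContinuousLinearMap.ext h)

@[simp] theorem compLeft_op (B : Y →L[ℝ] Z) (T : HS X Y) : (compLeft B T).op = B.comp T.op := rfl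

@[simp] theorem compRight_op [CompleteSpace Y] [CompleteSpace Z] (T : HS Y Z) (B : X →L[ℝ] Y) :
    (compRight T B).op = T.op.comp B := rfl

theorem compLeft_rankOne (B : Y →L[ℝ] Z) (x : X) (y : Y) :
    compLeft B (rankOne x y) = rankOne x (B y) := by
  ext z
  simp

section Adjoint

variable [CompleteSpace Y] [CompleteSpace Z]

theorem isHS_adjoint (T : HS X Y) : IsHS (ContinuousLinearMap.adjoint T.op) := by
  rw [isHS_iff_tsum, ← tsum_sq_adjoint (onb X) (onb Y)]
  exact (isHS_iff_tsum _).1 T.isHS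

/-- The adjoint, as an isometry of the spaces of Hilbert–Schmidt operators. -/
def adj : HS X Y →ₗᵢ[ℝ] HS Y X where
  toFun T := mk (ContinuousLinearMap.adjoint T.op) T.isHS_adjoint
  map_add' S T := op_injective (by simp)
  map_smul' c T := op_injective (by simp)
  norm_map' T := by
    refine (sq_eq_sq₀ (norm_nonneg _) (norm_nonneg _)).1 ?_
    have h := tsum_sq_adjoint (onb X) (onb Y) T.op
    rw [← ENNReal.ofReal_tsum_of_nonneg (fun i => sq_nonneg _) T.isHS,
      ← ENNReal.ofReal_tsum_of_nonneg (fun i => sq_nonneg _) T.isHS_adjoint] at h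
    rw [norm_sq_eq, norm_sq_eq]
    exact ((ENNReal.ofReal_eq_ofReal_iff (tsum_nonneg fun i => sq_nonneg _)
      (tsum_nonneg fun i => sq_nonneg _)).1 h).symm

@[simp] theorem adj_op (T : HS X Y) : (adj T).op = ContinuousLinearMap.adjoint T.op := rfl

@[simp] theorem adj_adj (T : HS X Y) : adj (adj T) = T := op_injective (by simp)

theorem adj_compLeft (B : Y →L[ℝ] Z) (T : HS X Y) :
    adj (compLeft B T) = compRight (adj T) (ContinuousLinearMap.adjoint B) :=
  op_injective (by simp [ContinuousLinearMap.adjoint_comp])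

theorem adj_compRight (T : HS Y Z) (B : X →L[ℝ] Y) :
    adj (compRight T B) = compLeft (ContinuousLinearMap.adjoint B) (adj T) :=
  op_injective (by simp [ContinuousLinearMap.adjoint_comp])

theorem eq_adj_iff {S : HS X Y} {T : HS Y X} :
    T = adj S ↔ ∀ x y, inner ℝ (T.op y) x = inner ℝ y (S.op x) := by
  constructor
  · rintro rfl x y
    rw [adj_op, ContinuousLinearMap.adjoint_inner_left]
  · intro h
    ext y
    refine ext_inner_right ℝ fun x => ?_
    rw [h, adj_op, ContinuousLinearMap.adjoint_inner_left]

end Adjoint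

/-- The rank one operators built from two countable bases have dense span: an operator orthogonal to
all of them has vanishing matrix entries. -/
instance [CompleteSpace Y] [TopologicalSpace.SeparableSpace X] [TopologicalSpace.SeparableSpace Y] :
    TopologicalSpace.SeparableSpace (HS X Y) := by
  have := (onb X).countable_index
  have := (onb Y).countable_index
  let B : Set (HS X Y) := range fun p : onbIndex X × onbIndex Y => rankOne (onb X p.1) (onb Y p.2)
  have h1 : (Submodule.span ℝ B).topologicalClosure = ⊤ := by
    rw [Submodule.topologicalClosure_eq_top_iff, Submodule.eq_bot_iff]
    intro T hT
    apply op_injective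
    refine ContinuousLinearMap.ext_on (Submodule.dense_iff_topologicalClosure_eq_top.mpr
      (onb X).dense_span) ?_
    rintro _ ⟨i, rfl⟩
    have h2 : ∀ k, (onb Y).repr (T.op (onb X i)) k = 0 := fun k => by
      rw [(onb Y).repr_apply_apply, real_inner_comm, ← inner_rankOne, real_inner_comm]
      exact hT _ (Submodule.subset_span ⟨(i, k), rfl⟩)
    have h3 := (onb Y).hasSum_repr (T.op (onb X i))
    simp only [h2, zero_smul] at h3
    simpa using h3.unique hasSum_zero
  have h2 : TopologicalSpace.IsSeparable B := (countable_range _).isSeparable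
  have h3 := (h2.span (R := ℝ)).closure
  rw [← Submodule.topologicalClosure_coe, h1] at h3
  exact TopologicalSpace.isSeparable_univ_iff.1 h3

end HS

/-! ### The spaces `𝒱 ⊆ ℋ ⊆ 𝒱*` and the Lyapunov operator -/

section OperatorSpaces

variable {V H : Type*}
  [NormedAddCommGroup V] [InnerProductSpace ℝ V] [CompleteSpace V]
  [NormedAddCommGroup H] [InnerProductSpace ℝ H] [CompleteSpace H]
  {ι : V →L[ℝ] H}

theorem riesz_toDualV_id (v : V) : riesz V (toDualV (.id ℝ V) v) = v :=
  ext_inner_right ℝ fun w => by rw [inner_riesz]; rfl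

theorem toDualV_id_riesz (f : StrongDual ℝ V) : toDualV (.id ℝ V) (riesz V f) = f := by
  ext v
  exact inner_riesz f v

theorem inner_dual (f g : StrongDual ℝ V) : inner ℝ f g = inner ℝ (riesz V f) (riesz V g) := rfl

theorem inner_dual_eq_apply (f g : StrongDual ℝ V) : inner ℝ f g = g (riesz V f) := by
  rw [inner_dual, inner_riesz_right]

instance [TopologicalSpace.SeparableSpace V] : TopologicalSpace.SeparableSpace (StrongDual ℝ V) :=
  (InnerProductSpace.toDual ℝ V).surjective.denseRange.separableSpace
    (InnerProductSpace.toDual ℝ V).continuous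

namespace OpV

variable (ι) in
/-- `P ∈ 𝒱` as an operator `V* → H`, transposed to an operator `H → V`. -/
def adjV : OpV ι →L[ℝ] HS H V :=
  (HS.compLeftL (riesz V)).comp (HS.adj.toContinuousLinearMap.comp (fromDual ι))

theorem inner_adjV (P : OpV ι) (x : H) (v : V) :
    inner ℝ ((adjV ι P).op x) v = inner ℝ x ((fromDual ι P).op (toDualV (.id ℝ V) v)) := by
  rw [← ContinuousLinearMap.adjoint_inner_left, inner_dual, riesz_toDualV_id]
  rfl

theorem norm_compLeft_riesz (S : HS H (StrongDual ℝ V)) : ‖HS.compLeft (riesz V) S‖ = ‖S‖ := by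
  refine (sq_eq_sq₀ (norm_nonneg _) (norm_nonneg _)).1 ?_
  rw [HS.norm_sq_eq, HS.norm_sq_eq]
  exact tsum_congr fun i => by rw [HS.compLeft_op, ContinuousLinearMap.comp_apply, norm_riesz]

theorem norm_adjV (P : OpV ι) : ‖adjV ι P‖ = ‖fromDual ι P‖ :=
  (norm_compLeft_riesz _).trans (HS.adj.norm_map _)

/-- After transposition both components of `P ∈ 𝒱` lie in `HS(H, V)` and play equal roles. All
estimates on `𝒱` use this symmetric description. -/
theorem norm_sq_eq (P : OpV ι) : ‖P‖ ^ 2 = ‖intoV ι P‖ ^ 2 + ‖adjV ι P‖ ^ 2 := by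
  rw [norm_adjV, add_comm]
  exact WithLp.prod_norm_sq_eq_of_L2 _

/-- Membership in `𝒱` compares the two components only on `V`, tested against `V`; density of `V` in
`H` removes both restrictions. -/
theorem fromDual_toDualV (hι : DenseRange ι) (P : OpV ι) (h : H) :
    (fromDual ι P).op (toDualV ι h) = ι ((intoV ι P).op h) := by
  have h1 : ∀ u, (fromDual ι P).op (toDualV ι (ι u)) = ι ((intoV ι P).op (ι u)) := fun u => by
    refine hι.eq_of_inner_left ℝ fun v => ?_
    exact DFunLike.congr_fun (DFunLike.congr_fun P.2 u) v
  exact congr_fun (hι.equalizer (g := fun h => (fromDual ι P).op (toDualV ι h))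
    (h := fun h => ι ((intoV ι P).op h)) (by fun_prop) (by fun_prop) (funext h1)) h

theorem inner_map_adjV (hι : DenseRange ι) (P : OpV ι) (x y : H) :
    inner ℝ (ι ((adjV ι P).op x)) y = inner ℝ x (ι ((intoV ι P).op y)) := by
  rw [← fromDual_toDualV hι, ← toDualV_id_riesz (toDualV ι y), ← inner_adjV, inner_riesz_right,
    toDualV_apply, real_inner_comm]

/-- The element of `𝒱` given by two operators `S, W : H → V` with `ι W = (ι S)*`. -/
def ofPair (S W : HS H V) (h : ∀ x y, inner ℝ (ι (W.op x)) y = inner ℝ x (ι (S.op y))) : OpV ι :=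
  ⟨WithLp.toLp 2 (HS.compRight (HS.adj W) (riesz V), S), by
    refine ContinuousLinearMap.ext fun u => ContinuousLinearMap.ext fun v => ?_
    change inner ℝ (ContinuousLinearMap.adjoint W.op (riesz V (toDualV ι (ι u)))) (ι v) =
      inner ℝ (ι (S.op (ι u))) (ι v)
    rw [ContinuousLinearMap.adjoint_inner_left, inner_riesz, toDualV_apply, real_inner_comm, h,
      real_inner_comm]⟩

@[simp] theorem intoV_ofPair (S W : HS H V)
    (h : ∀ x y, inner ℝ (ι (W.op x)) y = inner ℝ x (ι (S.op y))) :
    intoV ι (ofPair S W h) = S := rfl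

@[simp] theorem adjV_ofPair (S W : HS H V)
    (h : ∀ x y, inner ℝ (ι (W.op x)) y = inner ℝ x (ι (S.op y))) :
    adjV ι (ofPair S W h) = W := by
  ext x
  refine ext_inner_right ℝ fun v => ?_
  rw [inner_adjV]
  change inner ℝ x (ContinuousLinearMap.adjoint W.op (riesz V (toDualV (.id ℝ V) v))) = _
  rw [riesz_toDualV_id, ContinuousLinearMap.adjoint_inner_right]

theorem toHi_eq (P : OpV ι) : toHi ι P = HS.compLeft ι (intoV ι P) := rfl

theorem toHi_op (P : OpV ι) (x : H) : (toHi ι P).op x = ι ((intoV ι P).op x) := rfl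

theorem compLeft_adjV (hι : DenseRange ι) (P : OpV ι) :
    HS.compLeft ι (adjV ι P) = HS.adj (toHi ι P) :=
  HS.eq_adj_iff.2 fun x y => inner_map_adjV hι P y x

/-- The symmetric rank one operator `x ↦ (ι v, x) v` in `𝒱`. -/
def rankOneV (v w : V) : OpV ι := ofPair (HS.rankOne (ι v) w) (HS.rankOne (ι w) v) fun x y => by
  simp only [HS.rankOne_apply, map_smul, real_inner_smul_left, real_inner_smul_right]
  rw [real_inner_comm (ι w) x]
  ring

theorem toHi_rankOneV (v w : V) : toHi ι (rankOneV v w) = HS.rankOne (ι v) (ι w) := by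
  rw [toHi_eq, rankOneV, intoV_ofPair, HS.compLeft_rankOne]

/-- An operator orthogonal to all rank one operators `ι v ⊗ ι w` vanishes on the dense subspace `ι
V`, hence everywhere. -/
theorem denseRange_toHi (hι : DenseRange ι) : DenseRange (toHi ι) := by
  have h : (LinearMap.range (toHi ι).toLinearMap).topologicalClosure = ⊤ := by
    rw [Submodule.topologicalClosure_eq_top_iff, Submodule.eq_bot_iff]
    intro K hK
    have h1 : ∀ v w, inner ℝ (K.op (ι v)) (ι w) = 0 := fun v w => by
      rw [← HS.inner_rankOne, ← toHi_rankOneV, real_inner_comm]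
      exact hK _ ⟨_, rfl⟩
    have h2 : ∀ v, K.op (ι v) = 0 := fun v => hι.eq_zero_of_inner_left ℝ (h1 v)
    ext x
    exact congr_fun (hι.equalizer K.op.continuous continuous_const (funext h2)) x
  have := Submodule.dense_iff_topologicalClosure_eq_top.2 h
  exact this

instance : CompleteSpace (OpV ι) := by
  have : IsClosed (opVSubmodule ι : Set (WithLp 2 (HS (StrongDual ℝ V) H × HS H V))) := by
    refine isClosed_eq ?_ ?_
    · have h1 : Continuous fun P : WithLp 2 (HS (StrongDual ℝ V) H × HS H V) => P.fst.op :=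
        HS.opL.continuous.comp (WithLp.fstL 2 ℝ _ _).continuous
      fun_prop
    · have h1 : Continuous fun P : WithLp 2 (HS (StrongDual ℝ V) H × HS H V) => P.snd.op :=
        HS.opL.continuous.comp (WithLp.sndL 2 ℝ _ _).continuous
      fun_prop
  exact this.completeSpace_coe

instance [TopologicalSpace.SeparableSpace V] [TopologicalSpace.SeparableSpace H] :
    TopologicalSpace.SeparableSpace (OpV ι) := by
  have := UniformSpace.secondCountable_of_separable (HS (StrongDual ℝ V) H)
  have := UniformSpace.secondCountable_of_separable (HS H V)
  infer_instance

end OpV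

/-- The bounded operator `V → V` representing the form `(u, v) ↦ A v u`. -/
def formOp (A : V →L[ℝ] StrongDual ℝ V) : V →L[ℝ] V := (riesz V).comp A.flip

theorem inner_formOp (A : V →L[ℝ] StrongDual ℝ V) (u v : V) : inner ℝ (formOp A u) v = A v u :=
  inner_riesz _ _

/-- Transposing turns `P A` into the dual of `A` acting on the transposed component, so the pairing
consists of two copies of one form on `HS(H, V)`. Coercivity, boundedness and measurability are
thereby reduced to those of the form on `V`. -/
theorem lyapunov_apply (A : V →L[ℝ] StrongDual ℝ V) (P R : OpV ι) :
    lyapunov ι A P R =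
      inner ℝ (HS.compLeft (formOp A) (OpV.intoV ι P)) (OpV.intoV ι R) +
      inner ℝ (HS.compLeft (formOp A) (OpV.adjV ι P)) (OpV.adjV ι R) := by
  rw [lyapunov, add_apply]
  congr 1
  change inner ℝ (HS.compRight (HS.compRight (OpV.fromDual ι P) A) (riesz V)) (OpV.fromDual ι R) = _
  rw [← HS.adj.inner_map_map, HS.adj_compRight, HS.adj_compRight]
  change inner ℝ (HS.compLeft (riesz V) _) (HS.compLeft (riesz V) _) = _
  congr 1
  ext x
  refine ext_inner_right ℝ fun v => ?_
  simp only [HS.compLeft_op, ContinuousLinearMap.comp_apply, HS.adj_op]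
  rw [inner_riesz, inner_formOp]
  set f := ContinuousLinearMap.adjoint (OpV.fromDual ι P).op x
  have e : (OpV.adjV ι P).op x = riesz V f := rfl
  have e2 : ∀ g : StrongDual ℝ V, g v = inner ℝ g (toDualV (.id ℝ V) v) := fun g => by
    rw [inner_dual, riesz_toDualV_id, inner_riesz]
  rw [e2, ContinuousLinearMap.adjoint_inner_left, riesz_toDualV_id,
    ContinuousLinearMap.adjoint_inner_left, e, inner_dual_eq_apply]

variable (ι) in
/-- The operator `P ↦ A* P + P A` from `𝒱` to `𝒱*`. -/
def lyapunovL (A : V →L[ℝ] StrongDual ℝ V) : OpV ι →L[ℝ] StrongDual ℝ (OpV ι) :=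
  (toDualV (OpV.intoV ι)).comp ((HS.compLeftL (formOp A)).comp (OpV.intoV ι)) +
    (toDualV (OpV.adjV ι)).comp ((HS.compLeftL (formOp A)).comp (OpV.adjV ι))

theorem lyapunovL_apply (A : V →L[ℝ] StrongDual ℝ V) (P : OpV ι) :
    lyapunovL ι A P = lyapunov ι A P := by
  ext R
  rw [lyapunov_apply]
  rfl

theorem mul_norm_sq_le_inner_formOp {A : V →L[ℝ] StrongDual ℝ V} {α : ℝ}
    (hA : ∀ u, α * ‖u‖ ^ 2 ≤ A u u) (S : HS H V) :
    α * ‖S‖ ^ 2 ≤ inner ℝ (HS.compLeft (formOp A) S) S := by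
  rw [HS.norm_sq_eq, HS.inner_eq, ← tsum_mul_left]
  refine Summable.tsum_le_tsum (fun i => ?_) (S.isHS.mul_left _)
    ((HS.compLeft (formOp A) S).isHS.summable_inner S.isHS)
  rw [HS.compLeft_op, ContinuousLinearMap.comp_apply, inner_formOp]
  exact hA _

theorem lyapunov_coercive {A : V →L[ℝ] StrongDual ℝ V} {α : ℝ}
    (hA : ∀ u, α * ‖u‖ ^ 2 ≤ A u u) (P : OpV ι) : α * ‖P‖ ^ 2 ≤ lyapunov ι A P P := by
  rw [lyapunov_apply, OpV.norm_sq_eq, mul_add]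
  exact add_le_add (mul_norm_sq_le_inner_formOp hA _) (mul_norm_sq_le_inner_formOp hA _)

theorem norm_formOp_le {A : V →L[ℝ] StrongDual ℝ V} {β : ℝ} (hβ : 0 ≤ β)
    (hA : ∀ u, ‖A u‖ ≤ β * ‖u‖) : ‖formOp A‖ ≤ β := by
  refine ContinuousLinearMap.opNorm_le_bound _ hβ fun u => ?_
  have : ‖formOp A u‖ = ‖A.flip u‖ := norm_riesz _
  rw [this]
  refine ContinuousLinearMap.opNorm_le_bound _ (by positivity) fun v => ?_
  rw [ContinuousLinearMap.flip_apply]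
  refine ((A v).le_opNorm u).trans ?_
  have := mul_le_mul_of_nonneg_right (hA v) (norm_nonneg u)
  linarith

theorem norm_lyapunov_le {A : V →L[ℝ] StrongDual ℝ V} {β : ℝ} (hβ : 0 ≤ β)
    (hA : ∀ u, ‖A u‖ ≤ β * ‖u‖) (P : OpV ι) : ‖lyapunov ι A P‖ ≤ β * ‖P‖ := by
  refine ContinuousLinearMap.opNorm_le_bound _ (by positivity) fun R => ?_
  rw [lyapunov_apply]
  have h : ∀ S S' : HS H V, ‖inner ℝ (HS.compLeft (formOp A) S) S'‖ ≤ β * (‖S‖ * ‖S'‖) := by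
    intro S S'
    refine (norm_inner_le_norm _ _).trans ?_
    rw [← mul_assoc]
    refine mul_le_mul_of_nonneg_right ((HS.norm_compLeft_le _ _).trans ?_) (norm_nonneg _)
    exact mul_le_mul_of_nonneg_right (norm_formOp_le hβ hA) (norm_nonneg _)
  refine (norm_add_le _ _).trans ((add_le_add (h _ _) (h _ _)).trans ?_)
  rw [← mul_add, mul_assoc]
  refine mul_le_mul_of_nonneg_left ?_ hβ
  refine (sq_le_sq₀ (by positivity) (by positivity)).1 ?_
  rw [mul_pow ‖P‖, OpV.norm_sq_eq P, OpV.norm_sq_eq R]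
  -- Cauchy–Schwarz in the plane, for the pairs of component norms.
  nlinarith [sq_nonneg (‖OpV.intoV ι P‖ * ‖OpV.adjV ι R‖ - ‖OpV.adjV ι P‖ * ‖OpV.intoV ι R‖)]

end OperatorSpaces

/-! ### Invariance of the lower bound under implicit time steps -/

section Positivity

open Filter Topology

variable {V H : Type*}
  [NormedAddCommGroup V] [InnerProductSpace ℝ V] [CompleteSpace V]
  [NormedAddCommGroup H] [InnerProductSpace ℝ H] [CompleteSpace H]
  {ι : V →L[ℝ] H}

variable (ι) in
/-- The form `a(u, v) + (B ι u, ι v)`. -/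
def pert (A : V →L[ℝ] StrongDual ℝ V) (B : H →L[ℝ] H) : V →L[ℝ] StrongDual ℝ V :=
  A + (toDualV ι).comp (B.comp ι)

theorem pert_apply (A : V →L[ℝ] StrongDual ℝ V) (B : H →L[ℝ] H) (u v : V) :
    pert ι A B u v = A u v + inner ℝ (B (ι u)) (ι v) := rfl

theorem norm_pert_le {A : V →L[ℝ] StrongDual ℝ V} {η b C : ℝ} (hC : 0 ≤ C) (hb : 0 ≤ b)
    (hι : ∀ v, ‖ι v‖ ≤ C * ‖v‖)
    (hA : ∀ u, ‖A u‖ ≤ η * ‖u‖) {B : H →L[ℝ] H} (hB : ‖B‖ ≤ b) (u : V) :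
    ‖pert ι A B u‖ ≤ (η + C * (b * C)) * ‖u‖ := by
  have e : pert ι A B u = A u + toDualV ι (B (ι u)) := rfl
  rw [e, add_mul]
  refine (norm_add_le _ _).trans (add_le_add (hA u) ?_)
  refine ContinuousLinearMap.opNorm_le_bound _ (by positivity) fun v => ?_
  rw [toDualV_apply]
  refine (norm_inner_le_norm _ _).trans ?_
  have h1 : ‖B (ι u)‖ ≤ b * (C * ‖u‖) :=
    (B.le_opNorm _).trans (mul_le_mul hB (hι u) (norm_nonneg _) hb)
  calc ‖B (ι u)‖ * ‖ι v‖ ≤ (b * (C * ‖u‖)) * (C * ‖v‖) :=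
        mul_le_mul h1 (hι v) (norm_nonneg _) (by positivity)
    _ = _ := by ring

/-- The first component contributes `B P`. The second contributes `B P*`, whose adjoint is `P B`;
self-adjointness of `B` enters in both. -/
theorem lyapunov_pert (hι : DenseRange ι) (A : V →L[ℝ] StrongDual ℝ V) {B : H →L[ℝ] H}
    (hB : IsSelfAdjoint B) (P R : OpV ι) :
    lyapunov ι (pert ι A B) P R = lyapunov ι A P R +
      inner ℝ (HS.compLeft B (OpV.toHi ι P) + HS.compRight (OpV.toHi ι P) B) (OpV.toHi ι R) := by
  have hB' : ∀ x y, inner ℝ (B x) y = inner ℝ x (B y) := fun x y => by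
    nth_rewrite 1 [← hB.adjoint_eq]
    rw [ContinuousLinearMap.adjoint_inner_left]
  have h1 : ∀ S S' : HS H V, inner ℝ (HS.compLeft (formOp (pert ι A B)) S) S' =
      inner ℝ (HS.compLeft (formOp A) S) S' +
        inner ℝ (HS.compLeft B (HS.compLeft ι S)) (HS.compLeft ι S') := by
    intro S S'
    rw [HS.inner_eq, HS.inner_eq, HS.inner_eq, ← ((HS.compLeft (formOp A) S).isHS.summable_inner
      S'.isHS).tsum_add ((HS.compLeft B (HS.compLeft ι S)).isHS.summable_inner
      (HS.compLeft ι S').isHS)]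
    refine tsum_congr fun i => ?_
    simp only [HS.compLeft_op, ContinuousLinearMap.comp_apply]
    rw [inner_formOp, inner_formOp, pert_apply, hB', real_inner_comm (B (ι _))]
  have h2 : inner ℝ (HS.compLeft B (HS.compLeft ι (OpV.adjV ι P))) (HS.compLeft ι (OpV.adjV ι R)) =
      inner ℝ (HS.compRight (OpV.toHi ι P) B) (OpV.toHi ι R) := by
    rw [OpV.compLeft_adjV hι, OpV.compLeft_adjV hι, ← HS.adj.inner_map_map, HS.adj_compLeft,
      HS.adj_adj, HS.adj_adj, hB.adjoint_eq]
  rw [lyapunov_apply, lyapunov_apply, h1, h1, h2, inner_add_left, ← OpV.toHi_eq, ← OpV.toHi_eq]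
  ring

theorem isSelfAdjoint_iff_inner {B : H →L[ℝ] H} :
    IsSelfAdjoint B ↔ ∀ x y, inner ℝ (B x) y = inner ℝ x (B y) := by
  rw [ContinuousLinearMap.isSelfAdjoint_iff_isSymmetric]
  rfl

theorem isClosed_lowerClass (c : ℝ) : IsClosed (lowerClass H c) := by
  have h : lowerClass H c = {P : HS H H | (∀ x y, inner ℝ (P.op x) y = inner ℝ x (P.op y)) ∧
      ∀ u, c * ‖u‖ ^ 2 ≤ inner ℝ (P.op u) u} := by
    ext P
    rw [lowerClass, mem_ofPred_eq, isSelfAdjoint_iff_inner]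
    rfl
  have hc : ∀ x, Continuous fun P : HS H H => P.op x := fun x =>
    (ContinuousLinearMap.apply ℝ H x).continuous.comp HS.opL.continuous
  rw [h]
  simp only [ofPred_and, ofPred_forall]
  refine IsClosed.inter (isClosed_iInter fun x => isClosed_iInter fun y => ?_)
    (isClosed_iInter fun u => ?_)
  · exact isClosed_eq ((hc x).inner continuous_const) (continuous_const.inner (hc y))
  · exact isClosed_le continuous_const ((hc u).inner continuous_const)

theorem convex_lowerClass (c : ℝ) : Convex ℝ (lowerClass H c) := by
  rintro P ⟨hP, hP'⟩ R ⟨hR, hR'⟩ a b ha hb hab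
  refine ⟨?_, fun u => ?_⟩
  · rw [map_add, map_smul, map_smul]
    exact ((IsSelfAdjoint.all a).smul hP).add ((IsSelfAdjoint.all b).smul hR)
  · simp only [map_add, map_smul, add_apply, smul_apply, inner_add_left, real_inner_smul_left]
    calc c * ‖u‖ ^ 2 = a * (c * ‖u‖ ^ 2) + b * (c * ‖u‖ ^ 2) := by rw [← add_mul, hab, one_mul]
      _ ≤ _ := add_le_add (mul_le_mul_of_nonneg_left (hP' u) ha)
        (mul_le_mul_of_nonneg_left (hR' u) hb)

theorem HS.adj_eq_self {G : HS H H} (hG : IsSelfAdjoint G.op) : HS.adj G = G :=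
  HS.op_injective hG.adjoint_eq

/-- The implicit time step preserves self-adjointness. -/
theorem intoV_eq_adjV_of_step (hι : DenseRange ι) {A : V →L[ℝ] StrongDual ℝ V} {α h : ℝ}
    (hα : 0 < α) (hA : ∀ u, α * ‖u‖ ^ 2 ≤ A u u) (hh : 0 < h) {G K : HS H H}
    (hG : IsSelfAdjoint G.op) (hK : IsSelfAdjoint K.op) {P : OpV ι}
    (hP : ∀ R, h⁻¹ * inner ℝ (OpV.toHi ι P - G) (OpV.toHi ι R) + lyapunov ι A P R =
      inner ℝ K (OpV.toHi ι R)) : OpV.intoV ι P = OpV.adjV ι P := by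
  set S := OpV.intoV ι P
  set W := OpV.adjV ι P
  have hSW : ∀ x y, inner ℝ (ι (W.op x)) y = inner ℝ x (ι (S.op y)) := OpV.inner_map_adjV hι P
  -- `E` represents `P - P*` and is orthogonal to the self-adjoint `G` and `K`. Testing with it
  -- leaves `h⁻¹ ‖P - P*‖² / 2` plus the form at `S - W`; both are nonnegative and their sum is
  -- zero, so coercivity forces `S = W`.
  let E : OpV ι := OpV.ofPair (S - W) (W - S) fun x y => by
    simp only [map_sub, sub_apply, inner_sub_left, inner_sub_right]
    linarith [hSW x y, hSW y x, real_inner_comm x (ι (W.op y)), real_inner_comm y (ι (S.op x))]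
  have eE : OpV.toHi ι E = OpV.toHi ι P - HS.adj (OpV.toHi ι P) := by
    rw [OpV.toHi_eq, ← OpV.compLeft_adjV hι, OpV.intoV_ofPair]
    exact map_sub (HS.compLeftL ι) _ _
  have hz : ∀ G : HS H H, IsSelfAdjoint G.op → inner ℝ G (OpV.toHi ι E) = 0 := by
    intro G hG
    rw [eE, inner_sub_right, sub_eq_zero]
    conv_rhs => rw [← HS.adj_eq_self hG, HS.adj.inner_map_map]
  have h1 := hP E
  rw [inner_sub_left, hz G hG, hz K hK, sub_zero, lyapunov_apply, OpV.intoV_ofPair,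
    OpV.adjV_ofPair] at h1
  have h2 : 0 ≤ inner ℝ (OpV.toHi ι P) (OpV.toHi ι E) := by
    have h3 : inner ℝ (HS.adj (OpV.toHi ι P)) (OpV.toHi ι E) =
        -inner ℝ (OpV.toHi ι P) (OpV.toHi ι E) := by
      rw [eE, inner_sub_right, inner_sub_right, HS.adj.inner_map_map]
      nth_rewrite 1 [← HS.adj_adj (OpV.toHi ι P)]
      rw [HS.adj_adj]
      nth_rewrite 1 [← HS.adj.inner_map_map]
      rw [HS.adj_adj]
      ring
    have h4 : inner ℝ (OpV.toHi ι E) (OpV.toHi ι E) = 2 * inner ℝ (OpV.toHi ι P) (OpV.toHi ι E) := by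
      nth_rewrite 1 [eE]
      rw [inner_sub_left, h3]
      ring
    have := real_inner_self_nonneg (x := OpV.toHi ι E)
    linarith
  have h5 := mul_norm_sq_le_inner_formOp hA (S - W)
  have h6 : HS.compLeft (formOp A) (S - W) = HS.compLeft (formOp A) S - HS.compLeft (formOp A) W :=
    map_sub (HS.compLeftL (formOp A)) _ _
  rw [h6, inner_sub_left] at h5
  have h7 : inner ℝ (HS.compLeft (formOp A) W) (W - S) =
      -inner ℝ (HS.compLeft (formOp A) W) (S - W) := by rw [← neg_sub, inner_neg_right]
  have h8 : 0 ≤ h⁻¹ * inner ℝ (OpV.toHi ι P) (OpV.toHi ι E) := mul_nonneg (inv_pos.2 hh).le h2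
  have h9 : ‖S - W‖ ^ 2 ≤ 0 := by
    rw [h7] at h1
    nlinarith
  rw [← sub_eq_zero, ← norm_eq_zero]
  exact pow_eq_zero_iff two_ne_zero |>.1 (le_antisymm h9 (sq_nonneg _))

/-- A symmetric operator with a negative lower bound has almost eigenvectors at its bottom. -/
theorem exists_approx_eigenvector {P : H →L[ℝ] H} (hP : IsSelfAdjoint P) {c : ℝ}
    (hc : ∃ u, inner ℝ (P u) u < c * ‖u‖ ^ 2) :
    ∃ (l : ℝ) (u : ℕ → H), l < c ∧ (∀ n, ‖u n‖ = 1) ∧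
      Tendsto (fun n => P (u n) - l • u n) atTop (𝓝 0) := by
  have hs := isSelfAdjoint_iff_inner.1 hP
  -- The values of the quadratic form on the unit sphere. Their infimum `l` is the bottom of the
  -- spectrum, and a minimising sequence provides the almost eigenvectors, without compactness of
  -- `P`.
  let s : Set ℝ := (fun u => inner ℝ (P u) u) '' Metric.sphere 0 1
  have hb : BddBelow s := by
    refine ⟨-‖P‖, ?_⟩
    rintro _ ⟨u, hu, rfl⟩
    rw [mem_sphere_zero_iff_norm] at hu
    have h1 := (abs_real_inner_le_norm (P u) u).trans
      (mul_le_mul_of_nonneg_right (P.le_opNorm u) (norm_nonneg _))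
    rw [hu, mul_one, mul_one] at h1
    exact neg_le_of_abs_le h1
  obtain ⟨u₀, hu₀⟩ := hc
  have hu₀' : u₀ ≠ 0 := by rintro rfl; simp at hu₀
  have hn : 0 < ‖u₀‖ := norm_pos_iff.2 hu₀'
  have m₀ : inner ℝ (P (‖u₀‖⁻¹ • u₀)) (‖u₀‖⁻¹ • u₀) ∈ s := by
    refine ⟨‖u₀‖⁻¹ • u₀, ?_, rfl⟩
    rw [mem_sphere_zero_iff_norm, norm_smul, norm_inv, norm_norm, inv_mul_cancel₀ hn.ne']
  have hlt : sInf s < c := by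
    refine (csInf_le hb m₀).trans_lt ?_
    rw [map_smul, real_inner_smul_left, real_inner_smul_right, ← mul_assoc, ← mul_inv,
      inv_mul_lt_iff₀ (by positivity)]
    linarith
  obtain ⟨v, -, hv, hvs⟩ := exists_seq_tendsto_sInf ⟨_, m₀⟩ hb
  choose u hu1 hu2 using hvs
  have hu : ∀ n, ‖u n‖ = 1 := fun n => by simpa using hu1 n
  set l := sInf s
  have hl : ∀ x, l * ‖x‖ ^ 2 ≤ inner ℝ (P x) x := by
    intro x
    rcases eq_or_ne x 0 with rfl | hx
    · simp
    · have hn : 0 < ‖x‖ := norm_pos_iff.2 hx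
      have : l ≤ inner ℝ (P (‖x‖⁻¹ • x)) (‖x‖⁻¹ • x) := by
        refine csInf_le hb ⟨‖x‖⁻¹ • x, ?_, rfl⟩
        rw [mem_sphere_zero_iff_norm, norm_smul, norm_inv, norm_norm, inv_mul_cancel₀ hn.ne']
      rw [map_smul, real_inner_smul_left, real_inner_smul_right, ← mul_assoc, ← mul_inv,
        le_inv_mul_iff₀ (by positivity)] at this
      linarith
  refine ⟨l, u, hlt, hu, ?_⟩
  let D : H →L[ℝ] H := P - l • .id ℝ H
  have hD : ∀ x, D x = P x - l • x := fun x => rfl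
  have hD0 : ∀ x, 0 ≤ inner ℝ (D x) x := fun x => by
    rw [hD, inner_sub_left, real_inner_smul_left, real_inner_self_eq_norm_sq]
    linarith [hl x]
  have hDs : ∀ x y, inner ℝ (D x) y = inner ℝ x (D y) := fun x y => by
    rw [hD, hD, inner_sub_left, inner_sub_right, real_inner_smul_left, real_inner_smul_right, hs]
  -- For symmetric `D ≥ 0`, a small quadratic form forces small `D x`. It follows from `(D y, y) ≥
  -- 0` at `y = x - (1 + ‖D‖)⁻¹ D x`; the added `1` keeps the denominator positive when `D = 0`.
  have hcs : ∀ x, ‖D x‖ ^ 2 ≤ (1 + ‖D‖) * inner ℝ (D x) x := by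
    intro x
    have h1 := hD0 (x - (1 + ‖D‖)⁻¹ • D x)
    have e : inner ℝ (D (x - (1 + ‖D‖)⁻¹ • D x)) (x - (1 + ‖D‖)⁻¹ • D x) =
        inner ℝ (D x) x - 2 * (1 + ‖D‖)⁻¹ * ‖D x‖ ^ 2 +
          (1 + ‖D‖)⁻¹ ^ 2 * inner ℝ (D (D x)) (D x) := by
      rw [map_sub, map_smul]
      simp only [inner_sub_left, inner_sub_right, real_inner_smul_left, real_inner_smul_right,
        real_inner_self_eq_norm_sq]
      rw [hDs (D x) x, real_inner_self_eq_norm_sq]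
      ring
    have h2 : inner ℝ (D (D x)) (D x) ≤ (1 + ‖D‖) * ‖D x‖ ^ 2 := by
      refine (real_inner_le_norm _ _).trans ?_
      have := D.le_opNorm (D x)
      nlinarith [norm_nonneg (D x), norm_nonneg D]
    have hpos : 0 < 1 + ‖D‖ := by positivity
    rw [e] at h1
    have h3 : (1 + ‖D‖)⁻¹ ^ 2 * inner ℝ (D (D x)) (D x) ≤ (1 + ‖D‖)⁻¹ * ‖D x‖ ^ 2 := by
      calc _ ≤ (1 + ‖D‖)⁻¹ ^ 2 * ((1 + ‖D‖) * ‖D x‖ ^ 2) := by gcongr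
        _ = _ := by field_simp
    have h4 : (1 + ‖D‖)⁻¹ * ‖D x‖ ^ 2 ≤ inner ℝ (D x) x := by linarith
    rwa [inv_mul_le_iff₀ hpos] at h4
  have hlim : Tendsto (fun n => (1 + ‖D‖) * inner ℝ (D (u n)) (u n)) atTop (𝓝 0) := by
    have : ∀ n, inner ℝ (D (u n)) (u n) = v n - l := fun n => by
      rw [hD, inner_sub_left, real_inner_smul_left, real_inner_self_eq_norm_sq, hu, ← hu2 n]
      ring
    simp only [this]
    simpa using (hv.sub_const l).const_mul (1 + ‖D‖)
  have h5 : Tendsto (fun n => ‖D (u n)‖ ^ 2) atTop (𝓝 0) :=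
    squeeze_zero (fun n => sq_nonneg _) (fun n => hcs _) hlim
  rw [tendsto_zero_iff_norm_tendsto_zero]
  have h6 := h5.sqrt
  change Tendsto (fun n => ‖D (u n)‖) atTop (𝓝 0)
  simpa [Real.sqrt_sq] using h6

/-- The implicit time step preserves the lower bound. -/
theorem toHi_mem_lowerClass_of_step (hι : DenseRange ι) {A : V →L[ℝ] StrongDual ℝ V} {α h γ : ℝ}
    (hα : 0 < α) (hA : ∀ u, α * ‖u‖ ^ 2 ≤ A u u) (hA' : ∀ u, γ * ‖ι u‖ ^ 2 ≤ 2 * A u u)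
    (hh : 0 < h) (hγ : 0 ≤ γ) {G K : HS H H}
    (hG : G ∈ lowerClass H (-γ)) (hK : K ∈ lowerClass H (-γ ^ 2)) {P : OpV ι}
    (hP : ∀ R, h⁻¹ * inner ℝ (OpV.toHi ι P - G) (OpV.toHi ι R) + lyapunov ι A P R =
      inner ℝ K (OpV.toHi ι R)) : OpV.toHi ι P ∈ lowerClass H (-γ) := by
  have hSW := intoV_eq_adjV_of_step hι hα hA hh hG.1 hK.1 hP
  have hsa : ∀ x y, inner ℝ ((OpV.toHi ι P).op x) y = inner ℝ x ((OpV.toHi ι P).op y) := by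
    intro x y
    rw [OpV.toHi_op, OpV.toHi_op, ← OpV.inner_map_adjV hι, hSW]
  refine ⟨isSelfAdjoint_iff_inner.2 hsa, ?_⟩
  by_contra! hn
  obtain ⟨l, u, hl, hu, hr⟩ := exists_approx_eigenvector (isSelfAdjoint_iff_inner.2 hsa) hn
  set S := OpV.intoV ι P
  set p := (OpV.toHi ι P).op
  have hl0 : l < 0 := by linarith
  have hp : ∀ x, p x = ι (S.op x) := fun x => rfl
  -- Test with the rank one operator `ι v ⊗ v`. Because `S = W`, the two halves of the Lyapunov
  -- pairing coincide, hence the factor `2`.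
  have key : ∀ v : V, h⁻¹ * (inner ℝ (p (ι v)) (ι v) - inner ℝ (G.op (ι v)) (ι v)) +
      2 * A v (S.op (ι v)) = inner ℝ (K.op (ι v)) (ι v) := by
    intro v
    have := hP (OpV.rankOneV v v)
    rw [OpV.toHi_rankOneV, HS.inner_rankOne, HS.inner_rankOne, map_sub, sub_apply, inner_sub_left,
      lyapunov_apply, ← hSW] at this
    rw [OpV.rankOneV, OpV.intoV_ofPair, OpV.adjV_ofPair, HS.inner_rankOne, HS.compLeft_op,
      ContinuousLinearMap.comp_apply, inner_formOp] at this
    linarith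
  let r : ℕ → H := fun n => p (u n) - l • u n
  let w : ℕ → H := fun n => p (u n)
  have hw : ∀ n, w n = l • u n + r n := fun n => by simp [w, r]
  have hnw : Tendsto (fun n => ‖w n‖ ^ 2) atTop (𝓝 (l ^ 2)) := by
    have h1 : Tendsto (fun n => ‖w n‖ - ‖l • u n‖) atTop (𝓝 0) := by
      refine squeeze_zero_norm (a := fun n => ‖r n‖) (fun n => ?_) (by simpa using hr.norm)
      exact abs_norm_sub_norm_le _ _
    have h2 : Tendsto (fun n => ‖w n‖) atTop (𝓝 |l|) := by
      have := h1.add_const |l|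
      simpa [norm_smul, hu] using this
    simpa using h2.pow 2
  -- The almost eigenvector `u n` lies only in `H`, but `S (u n)` lies in `V` with image `w n ≈ l u
  -- n`, so it is the admissible choice of `v`. Since `l < 0`, multiplying `hA'` by `l` reverses it
  -- into the upper bound needed here.
  have est : ∀ n, -γ ^ 2 * ‖w n‖ ^ 2 ≤ h⁻¹ * ((l + γ) * ‖w n‖ ^ 2 + inner ℝ (p (r n)) (w n)) + l * γ * ‖w n‖ ^ 2 +
      2 * A (S.op (u n)) (S.op (r n)) := by
    intro n
    have h1 := key (S.op (u n))
    rw [← hp (u n)] at h1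
    change h⁻¹ * (inner ℝ (p (w n)) (w n) - inner ℝ (G.op (w n)) (w n)) +
      2 * A (S.op (u n)) (S.op (w n)) = inner ℝ (K.op (w n)) (w n) at h1
    have h2 := hG.2 (w n)
    have h3 := hK.2 (w n)
    have h4 : inner ℝ (p (w n)) (w n) = l * ‖w n‖ ^ 2 + inner ℝ (p (r n)) (w n) := by
      rw [hw n, map_add, map_smul, ← hw n, inner_add_left, real_inner_smul_left,
        ← real_inner_self_eq_norm_sq]
    have h5 : S.op (w n) = l • S.op (u n) + S.op (r n) := by rw [hw n, map_add, map_smul]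
    have h6 := hA' (S.op (u n))
    rw [← hp (u n)] at h6
    change γ * ‖w n‖ ^ 2 ≤ _ at h6
    rw [h4, h5, map_add, map_smul, smul_eq_mul] at h1
    have h7 : h⁻¹ * (l * ‖w n‖ ^ 2 + inner ℝ (p (r n)) (w n) - inner ℝ (G.op (w n)) (w n)) ≤
        h⁻¹ * (l * ‖w n‖ ^ 2 + inner ℝ (p (r n)) (w n) + γ * ‖w n‖ ^ 2) := by
      refine mul_le_mul_of_nonneg_left ?_ (inv_pos.2 hh).le
      linarith
    have h8 : l * (2 * A (S.op (u n)) (S.op (u n))) ≤ l * (γ * ‖w n‖ ^ 2) :=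
      mul_le_mul_of_nonpos_left h6 hl0.le
    have h9 : h⁻¹ * (l * ‖w n‖ ^ 2 + inner ℝ (p (r n)) (w n) + γ * ‖w n‖ ^ 2) =
      h⁻¹ * ((l + γ) * ‖w n‖ ^ 2 + inner ℝ (p (r n)) (w n)) := by ring
    linarith
  have hwb : ∀ n, ‖w n‖ ≤ ‖p‖ := fun n => by simpa [hu] using p.le_opNorm (u n)
  have e1 : Tendsto (fun n => inner ℝ (p (r n)) (w n)) atTop (𝓝 0) := by
    refine squeeze_zero_norm (a := fun n => ‖p‖ * ‖r n‖ * ‖p‖) (fun n => ?_) ?_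
    · exact (norm_inner_le_norm _ _).trans
        (mul_le_mul (p.le_opNorm _) (hwb n) (norm_nonneg _) (by positivity))
    · simpa using (hr.norm.const_mul ‖p‖).mul_const ‖p‖
  have e2 : Tendsto (fun n => A (S.op (u n)) (S.op (r n))) atTop (𝓝 0) := by
    refine squeeze_zero_norm (a := fun n => ‖A‖ * ‖S.op‖ * (‖S.op‖ * ‖r n‖)) (fun n => ?_) ?_
    · refine (A.le_opNorm₂ _ _).trans ?_
      refine mul_le_mul ?_ (S.op.le_opNorm _) (norm_nonneg _) (by positivity)
      exact mul_le_mul_of_nonneg_left (by simpa [hu] using S.op.le_opNorm (u n)) (norm_nonneg A)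
    · simpa using (hr.norm.const_mul ‖S.op‖).const_mul (‖A‖ * ‖S.op‖)
  -- As `r n → 0`, dividing by `l² > 0` gives `-γ² ≤ h⁻¹ (l + γ) + l γ`, that is `(l + γ)(h⁻¹ + γ) ≥
  -- 0`, against `l < -γ`.
  have lim := le_of_tendsto_of_tendsto' (hnw.const_mul (-γ ^ 2))
    (((((hnw.const_mul (l + γ)).add e1).const_mul h⁻¹).add (hnw.const_mul (l * γ))).add
      (e2.const_mul 2)) est
  have hi : 0 < h⁻¹ := inv_pos.2 hh
  have hl2 : 0 < l ^ 2 := by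
    have := hl0.ne
    positivity
  have : 0 ≤ ((l + γ) * (h⁻¹ + γ)) * l ^ 2 := by nlinarith
  have h10 : (l + γ) * (h⁻¹ + γ) < 0 := mul_neg_of_neg_of_pos (by linarith) (by linarith)
  nlinarith

end Positivity

/-! ### A priori estimates -/

section Energy

variable {X K : Type*} [NormedAddCommGroup X] [InnerProductSpace ℝ X] [CompleteSpace X]
  [TopologicalSpace.SeparableSpace X]
  [NormedAddCommGroup K] [InnerProductSpace ℝ K] [CompleteSpace K]
  {T : ℝ} {L : ℝ → X →L[ℝ] StrongDual ℝ X} {α β : ℝ} {j : X →L[ℝ] K} {F : ℝ → StrongDual ℝ X}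
  {k₀ : K} {u : ℝ → X} {p : ℝ → K}

theorem IsSol.energy_coercive (hL : EvolutionData X T L α β) (hj : DenseRange j) (hT : 0 < T)
    (hF : MemLp F 2 (timeMeasure T)) (h : IsSol j T (fun t => F t - L t (u t)) k₀ u p) :
    ∀ t ∈ Icc 0 T, ‖p t‖ ^ 2 + 2 * α * ∫ s in (0 : ℝ)..t, ‖u s‖ ^ 2 ≤
      ‖k₀‖ ^ 2 + 2 * ∫ s in (0 : ℝ)..t, F s (u s) := by
  intro t ht
  have hLu := hL.memLp_apply h.memLp
  rw [h.energy hj hT (memLp_fun_sub hF hLu) t ht]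
  have h0 : (0 : ℝ) ∈ Icc 0 T := ⟨le_rfl, hT.le⟩
  have i1 := intervalIntegrable_of_timeMeasure (integrable_pairing h.memLp hF) h0 ht
  have i2 := intervalIntegrable_of_timeMeasure (integrable_pairing h.memLp hLu) h0 ht
  have i3 := intervalIntegrable_of_timeMeasure (h.memLp.integrable_norm_pow two_ne_zero) h0 ht
  have e : ∫ s in (0 : ℝ)..t, 2 * (F s - L s (u s)) (u s) =
      2 * (∫ s in (0 : ℝ)..t, F s (u s)) - 2 * ∫ s in (0 : ℝ)..t, L s (u s) (u s) := by
    rw [← mul_sub, ← intervalIntegral.integral_sub i1 i2, ← intervalIntegral.integral_const_mul]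
    rfl
  have h1 : α * ∫ s in (0 : ℝ)..t, ‖u s‖ ^ 2 ≤ ∫ s in (0 : ℝ)..t, L s (u s) (u s) := by
    rw [← intervalIntegral.integral_const_mul]
    refine intervalIntegral.integral_mono_on ht.1 (i3.const_mul α) i2 fun s hs => ?_
    exact hL.coercive s ⟨hs.1, hs.2.trans ht.2⟩ _
  rw [e]
  linarith

/-- Young's inequality absorbs `F` into the coercive term. The constant involves `α` but not `β`, so
it serves all linearisations at once. -/
theorem IsSol.norm_sq_le (hL : EvolutionData X T L α β) (hj : DenseRange j) (hT : 0 < T)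
    (hF : MemLp F 2 (timeMeasure T)) (h : IsSol j T (fun t => F t - L t (u t)) k₀ u p) :
    ∀ t ∈ Icc 0 T, ‖p t‖ ^ 2 ≤ ‖k₀‖ ^ 2 + α⁻¹ * ∫ s in (0 : ℝ)..t, ‖F s‖ ^ 2 := by
  intro t ht
  have hα := hL.α_pos
  have h0 : (0 : ℝ) ∈ Icc 0 T := ⟨le_rfl, hT.le⟩
  have i1 := intervalIntegrable_of_timeMeasure (integrable_pairing h.memLp hF) h0 ht
  have i2 := intervalIntegrable_of_timeMeasure (hF.integrable_norm_pow two_ne_zero) h0 ht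
  have i3 := intervalIntegrable_of_timeMeasure (h.memLp.integrable_norm_pow two_ne_zero) h0 ht
  have h1 := h.energy_coercive hL hj hT hF t ht
  have h2 : ∫ s in (0 : ℝ)..t, F s (u s) ≤
      ∫ s in (0 : ℝ)..t, (α * ‖u s‖ ^ 2 + α⁻¹ / 2 * ‖F s‖ ^ 2) := by
    refine intervalIntegral.integral_mono_on ht.1 i1 ((i3.const_mul α).add (i2.const_mul _))
      fun s _ => ?_
    refine (le_abs_self _).trans (((F s).le_opNorm (u s)).trans ?_)
    have e : α * ‖u s‖ ^ 2 + α⁻¹ / 2 * ‖F s‖ ^ 2 - ‖F s‖ * ‖u s‖ =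
        α⁻¹ / 2 * ((‖F s‖ - α * ‖u s‖) ^ 2 + (α * ‖u s‖) ^ 2) := by
      field_simp
      ring
    have : 0 ≤ α⁻¹ / 2 * ((‖F s‖ - α * ‖u s‖) ^ 2 + (α * ‖u s‖) ^ 2) := by positivity
    linarith
  rw [intervalIntegral.integral_add (i3.const_mul α) (i2.const_mul _),
    intervalIntegral.integral_const_mul, intervalIntegral.integral_const_mul] at h2
  linarith

theorem integrable_norm_sq_dual (hF : MemLp F 2 (timeMeasure T)) :
    Integrable (fun t => ‖F t‖ ^ 2) (timeMeasure T) := hF.integrable_norm_pow two_ne_zero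

theorem continuousOn_toDualV (j : X →L[ℝ] K) {s : Set ℝ} {f : ℝ → K} (hf : ContinuousOn f s) :
    ContinuousOn (fun t => toDualV j (f t)) s :=
  (toDualV j).continuous.comp_continuousOn hf

theorem norm_toDualV_le {j : X →L[ℝ] K} {C : ℝ} (hC : 0 ≤ C) (hj : ∀ x, ‖j x‖ ≤ C * ‖x‖) (k : K) :
    ‖toDualV j k‖ ≤ C * ‖k‖ := by
  refine ContinuousLinearMap.opNorm_le_bound _ (by positivity) fun x => ?_
  rw [toDualV_apply]
  refine (norm_inner_le_norm _ _).trans ?_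
  have := mul_le_mul_of_nonneg_left (hj x) (norm_nonneg k)
  linarith

theorem memLp_of_continuousOn {E : Type*} [NormedAddCommGroup E]
    {f : ℝ → E} (hf : ContinuousOn f (Icc 0 T)) (p : ENNReal) : MemLp f p (timeMeasure T) := by
  obtain ⟨c, hc⟩ := isCompact_Icc.exists_bound_of_continuousOn hf
  refine MemLp.of_bound (hf.aestronglyMeasurable_of_isCompact isCompact_Icc measurableSet_Icc) c ?_
  filter_upwards [ae_restrict_mem measurableSet_Icc] with t ht using hc t ht

theorem memLp_toDualV_of_continuousOn (j : X →L[ℝ] K) {f : ℝ → K} (hf : ContinuousOn f (Icc 0 T))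
    (p : ENNReal) : MemLp (fun t => toDualV j (f t)) p (timeMeasure T) :=
  memLp_of_continuousOn (continuousOn_toDualV j hf) p

end Energy

/-! ### Products in `ℋ` as bounded bilinear maps -/

theorem continuousOn_bilin {E F G : Type*} [NormedAddCommGroup E] [NormedSpace ℝ E]
    [NormedAddCommGroup F] [NormedSpace ℝ F] [NormedAddCommGroup G] [NormedSpace ℝ G]
    (B : E →L[ℝ] F →L[ℝ] G) {f : ℝ → E} {g : ℝ → F} {s : Set ℝ} (hf : ContinuousOn f s)
    (hg : ContinuousOn g s) : ContinuousOn (fun t => B (f t) (g t)) s :=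
  (B.continuous.comp_continuousOn hf).clm_apply hg

namespace HS

variable {H : Type*} [NormedAddCommGroup H] [InnerProductSpace ℝ H] [CompleteSpace H]

/-- The product of Hilbert–Schmidt operators as a bounded bilinear map. -/
def mulL : HS H H →L[ℝ] HS H H →L[ℝ] HS H H :=
  LinearMap.mkContinuous₂ (LinearMap.mk₂ ℝ (fun P R => compLeft P.op R)
    (fun P P' R => op_injective (by ext x; simp)) (fun c P R => op_injective (by ext x; simp))
    (fun P R R' => op_injective (by ext x; simp)) (fun c P R => op_injective (by ext x; simp)))
    1 fun P R => by
      rw [one_mul]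
      exact (norm_compLeft_le _ _).trans (mul_le_mul_of_nonneg_right P.norm_op_le (norm_nonneg _))

/-- The anticommutator `P R + R P`. -/
def symL : HS H H →L[ℝ] HS H H →L[ℝ] HS H H := mulL + mulL.flip

theorem symL_comm (P R : HS H H) : symL P R = symL R P := add_comm _ _

theorem symL_self (P : HS H H) : symL P P = (2 : ℝ) • square P := by
  rw [two_smul]
  rfl

end HS

/-! ### The linearised Riccati equation for a concrete form -/

section FormData

variable {V H : Type*}
  [NormedAddCommGroup V] [InnerProductSpace ℝ V] [CompleteSpace V]
  [TopologicalSpace.SeparableSpace V]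
  [NormedAddCommGroup H] [InnerProductSpace ℝ H] [CompleteSpace H]
  [TopologicalSpace.SeparableSpace H]
  {ι : V →L[ℝ] H}

variable (ι) in
/-- The embedding `ℋ → 𝒱*` as a bounded operator. -/
def hiL : HS H H →L[ℝ] StrongDual ℝ (OpV ι) := toDualV (OpV.toHi ι)

theorem lyapunovL_pert (hι : DenseRange ι) (A : V →L[ℝ] StrongDual ℝ V) {B : HS H H}
    (hB : IsSelfAdjoint B.op) (P : OpV ι) :
    lyapunovL ι (pert ι A B.op) P = lyapunovL ι A P + hiL ι (HS.symL B (OpV.toHi ι P)) := by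
  ext R
  rw [lyapunovL_apply, lyapunov_pert hι A hB, lyapunovL_apply]
  rfl

theorem aemeasurable_lyapunovL {A : ℝ → V →L[ℝ] StrongDual ℝ V} {m : Measure ℝ}
    (hA : ∀ u v, AEMeasurable (fun t => A t u v) m) (P R : OpV ι) :
    AEMeasurable (fun t => lyapunovL ι (A t) P R) m := by
  have := (onb H).countable_index
  have h : ∀ S S' : HS H V,
      AEStronglyMeasurable (fun t => inner ℝ (HS.compLeft (formOp (A t)) S) S') m := by
    intro S S'
    refine aestronglyMeasurable_of_hasSum (κ := onbIndex H)
      (f := fun i t => A t (S'.op (onb H i)) (S.op (onb H i)))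
      (fun i => (hA _ _).aestronglyMeasurable) (Filter.Eventually.of_forall fun t => ?_)
    have h1 := ((HS.compLeft (formOp (A t)) S).isHS.summable_inner S'.isHS).hasSum
    simp only [HS.compLeft_op, ContinuousLinearMap.comp_apply, inner_formOp] at h1
    rw [HS.inner_eq]
    simpa only [HS.compLeft_op, ContinuousLinearMap.comp_apply, inner_formOp] using h1
  simp only [lyapunovL_apply, lyapunov_apply]
  exact ((h _ _).add (h _ _)).aemeasurable

variable (ι) in
/-- The standing assumptions on the embedding `ι : V → H`, the form `a` and the bound `γ`. -/
structure FormData (C T μ η γ : ℝ) (a : ℝ → V →L[ℝ] StrongDual ℝ V) : Prop where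
  dense : DenseRange ι
  C_pos : 0 < C
  norm_le : ∀ v, ‖ι v‖ ≤ C * ‖v‖
  T_pos : 0 < T
  η_pos : 0 < η
  coercive : ∀ t ∈ Icc 0 T, ∀ u, μ * ‖u‖ ^ 2 ≤ a t u u
  bounded : ∀ t ∈ Icc 0 T, ∀ u, ‖a t u‖ ≤ η * ‖u‖
  measurable : ∀ u v, AEMeasurable (fun t => a t u v) (timeMeasure T)
  γ_nonneg : 0 ≤ γ
  γ_lt : γ * C ^ 2 < μ

variable {C T μ η γ : ℝ} {a : ℝ → V →L[ℝ] StrongDual ℝ V}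

theorem lowerClass_mono {c c' : ℝ} (h : c' ≤ c) : lowerClass H c ⊆ lowerClass H c' :=
  fun _ hP => ⟨hP.1, fun u => (mul_le_mul_of_nonneg_right h (sq_nonneg _)).trans (hP.2 u)⟩

theorem smul_half_mem_lowerClass {c : ℝ} {P : HS H H} (hP : P ∈ lowerClass H c) :
    (1 / 2 : ℝ) • P ∈ lowerClass H (c / 2) := by
  refine ⟨?_, fun u => ?_⟩
  · rw [map_smul]
    exact (IsSelfAdjoint.all _).smul hP.1
  · rw [map_smul, smul_apply, real_inner_smul_left]
    linarith [hP.2 u]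

namespace FormData

theorem norm_sq_le (hD : FormData ι C T μ η γ a) (v : V) : ‖ι v‖ ^ 2 ≤ C ^ 2 * ‖v‖ ^ 2 := by
  rw [← mul_pow]
  exact pow_le_pow_left₀ (norm_nonneg _) (hD.norm_le v) 2

/-- The term with `B ≥ -γ` costs at most `γ ‖ι u‖² ≤ γ C² ‖u‖²`, so the coercivity constant is the
same for all `B`; only `β` depends on `B`. -/
theorem evolutionData (hD : FormData ι C T μ η γ a) {B : ℝ → HS H H}
    (hB : ContinuousOn B (Icc 0 T)) (hB' : ∀ t ∈ Icc 0 T, B t ∈ lowerClass H (-γ)) :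
    ∃ β, EvolutionData (OpV ι) T (fun t => lyapunovL ι (pert ι (a t) (B t).op))
      (μ - γ * C ^ 2) β := by
  obtain ⟨b, hb⟩ := isCompact_Icc.exists_bound_of_continuousOn hB
  have h0 : (0 : ℝ) ∈ Icc 0 T := ⟨le_rfl, hD.T_pos.le⟩
  have hb0 : 0 ≤ b := (norm_nonneg _).trans (hb 0 h0)
  have hη := hD.η_pos
  have hC := hD.C_pos
  refine ⟨η + C * (b * C), sub_pos.2 hD.γ_lt, by positivity, fun t ht P => ?_, fun t ht P => ?_, ?_⟩
  · rw [lyapunovL_apply]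
    refine lyapunov_coercive (fun u => ?_) P
    rw [pert_apply]
    have h1 := hD.coercive t ht u
    have h2 := (hB' t ht).2 (ι u)
    have h3 := mul_le_mul_of_nonneg_left (hD.norm_sq_le u) hD.γ_nonneg
    linarith
  · rw [lyapunovL_apply]
    exact norm_lyapunov_le (by positivity) (norm_pert_le hC.le hb0 hD.norm_le (hD.bounded t ht)
      ((B t).norm_op_le.trans (hb t ht))) P
  · refine aemeasurable_lyapunovL fun u v => ?_
    simp only [pert_apply]
    refine (hD.measurable u v).add ?_
    have h1 : ContinuousOn (fun t => inner ℝ ((B t).op (ι u)) (ι v)) (Icc 0 T) := by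
      have : Continuous fun P : HS H H => inner ℝ (P.op (ι u)) (ι v) :=
        ((ContinuousLinearMap.apply ℝ H (ι u)).continuous.comp HS.opL.continuous).inner
          continuous_const
      exact this.comp_continuousOn hB
    exact h1.aemeasurable measurableSet_Icc

/-- Existence for the linearized equation. -/
theorem exists_isSol (hD : FormData ι C T μ η γ a) {B : ℝ → HS H H}
    (hB : ContinuousOn B (Icc 0 T)) (hB' : ∀ t ∈ Icc 0 T, B t ∈ lowerClass H (-γ))
    {F : ℝ → OpVDual ι} (hF : MemLp F 2 (timeMeasure T))
    (hF' : ∀ t ∈ Icc 0 T, ∃ K ∈ lowerClass H (-γ ^ 2), F t = hiToDual ι K)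
    {P₀ : HS H H} (hP₀ : P₀ ∈ lowerClass H (-γ)) :
    ∃ u p, IsSol (OpV.toHi ι) T
      (fun t => F t - lyapunovL ι (pert ι (a t) ((1 / 2 : ℝ) • B t).op) (u t)) P₀ u p ∧
      ∀ t ∈ Icc 0 T, p t ∈ lowerClass H (-γ) := by
  have hγ := hD.γ_nonneg
  have hm : ∀ t ∈ Icc 0 T, (1 / 2 : ℝ) • B t ∈ lowerClass H (-γ) := fun t ht =>
    lowerClass_mono (by linarith) (smul_half_mem_lowerClass (hB' t ht))
  obtain ⟨β, hL⟩ := hD.evolutionData (B := fun t => (1 / 2 : ℝ) • B t) (by fun_prop) hm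
  refine exists_isSol_linear hD.T_pos hL (OpV.toHi ι) hF hP₀ (isClosed_lowerClass _)
    (convex_lowerClass _) fun h hh t ht G hG P hP => ?_
  obtain ⟨K, hK, hFK⟩ := hF' t ht
  have h1 : ∀ u, (μ - γ * C ^ 2) * ‖u‖ ^ 2 ≤ pert ι (a t) ((1 / 2 : ℝ) • B t).op u u := fun u => by
    rw [pert_apply]
    have h1 := hD.coercive t ht u
    have h2 := (hm t ht).2 (ι u)
    have h3 := mul_le_mul_of_nonneg_left (hD.norm_sq_le u) hγ
    linarith
  refine toHi_mem_lowerClass_of_step hD.dense hL.α_pos h1 (fun u => ?_) hh hγ hG hK fun R => ?_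
  -- The time step needs `γ ‖ι u‖²` below twice the perturbed form. With `B` entering at weight one
  -- half, twice the form is at least `(2 μ - γ C²) ‖u‖²`, which exceeds `γ C² ‖u‖²` because `γ C² <
  -- μ`.
  · rw [pert_apply]
    have h1 := hD.coercive t ht u
    have h2 := (smul_half_mem_lowerClass (hB' t ht)).2 (ι u)
    have h3 := mul_le_mul_of_nonneg_left (hD.norm_sq_le u) hγ
    have h4 := mul_le_mul_of_nonneg_right hD.γ_lt.le (sq_nonneg ‖u‖)
    linarith
  · have := hP R
    rw [hFK, lyapunovL_apply] at this
    exact this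

end FormData

end FormData

/-! ### Picard iteration for the abstract Riccati equation -/

section FixedPoint

open Filter Topology

variable {X K : Type*} [NormedAddCommGroup X] [InnerProductSpace ℝ X] [CompleteSpace X]
  [TopologicalSpace.SeparableSpace X]
  [NormedAddCommGroup K] [InnerProductSpace ℝ K] [CompleteSpace K]

/-- The operator `u ↦ L u + j* σ(B, j u)`. -/
def ricOp (j : X →L[ℝ] K) (σ : K →L[ℝ] K →L[ℝ] K) (L : X →L[ℝ] StrongDual ℝ X) (B : K) :
    X →L[ℝ] StrongDual ℝ X :=
  L + (toDualV j).comp ((σ B).comp j)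

theorem ricOp_apply (j : X →L[ℝ] K) (σ : K →L[ℝ] K →L[ℝ] K) (L : X →L[ℝ] StrongDual ℝ X) (B : K)
    (u : X) : ricOp j σ L B u = L u + toDualV j (σ B (j u)) := rfl

/-- The data of an abstract Riccati equation `u' + L(t) u + σ(u, u) / 2 = F` on `[0, T]`. Its
linearizations are uniformly coercive and solvable in the closed convex set `𝒞`, for right hand
sides with values in `𝒬`. -/
structure RiccatiData (j : X →L[ℝ] K) (T : ℝ) (L : ℝ → X →L[ℝ] StrongDual ℝ X)
    (σ : K →L[ℝ] K →L[ℝ] K) (𝒞 : Set K) (𝒬 : Set (StrongDual ℝ X)) (α : ℝ) : Prop where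
  dense : DenseRange j
  T_pos : 0 < T
  α_pos : 0 < α
  symm : ∀ p q, σ p q = σ q p
  isClosed : IsClosed 𝒞
  convex : Convex ℝ 𝒞
  zero_mem : 0 ∈ 𝒞
  zero_mem' : 0 ∈ 𝒬
  evolution : ∀ B : ℝ → K, ContinuousOn B (Icc 0 T) → (∀ t ∈ Icc 0 T, B t ∈ 𝒞) →
    ∃ β, EvolutionData X T (fun t => ricOp j σ (L t) (B t)) α β
  exists_isSol : ∀ (B : ℝ → K) (F : ℝ → StrongDual ℝ X) (k₀ : K), ContinuousOn B (Icc 0 T) →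
    (∀ t ∈ Icc 0 T, B t ∈ 𝒞) → MemLp F 2 (timeMeasure T) → (∀ t ∈ Icc 0 T, F t ∈ 𝒬) → k₀ ∈ 𝒞 →
    ∃ u p, IsSol j T (fun t => F t - ricOp j σ (L t) ((1 / 2 : ℝ) • B t) (u t)) k₀ u p ∧
      ∀ t ∈ Icc 0 T, p t ∈ 𝒞

namespace RiccatiData

variable {j : X →L[ℝ] K} {T : ℝ} {L : ℝ → X →L[ℝ] StrongDual ℝ X} {σ : K →L[ℝ] K →L[ℝ] K}
  {𝒞 : Set K} {𝒬 : Set (StrongDual ℝ X)} {α : ℝ}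

theorem norm_toDualV_apply_le (j : X →L[ℝ] K) (k : K) : ‖toDualV j k‖ ≤ ‖j‖ * ‖k‖ :=
  norm_toDualV_le (norm_nonneg _) j.le_opNorm k

theorem half_mem (hD : RiccatiData j T L σ 𝒞 𝒬 α) {p : K} (hp : p ∈ 𝒞) : (1 / 2 : ℝ) • p ∈ 𝒞 :=
  hD.convex.smul_mem_of_zero_mem hD.zero_mem hp (by norm_num)

theorem evolution_half (hD : RiccatiData j T L σ 𝒞 𝒬 α) {B : ℝ → K}
    (hB : ContinuousOn B (Icc 0 T)) (hB' : ∀ t ∈ Icc 0 T, B t ∈ 𝒞) :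
    ∃ β, EvolutionData X T (fun t => ricOp j σ (L t) ((1 / 2 : ℝ) • B t)) α β :=
  hD.evolution (fun t => (1 / 2 : ℝ) • B t) (by fun_prop) fun t ht => hD.half_mem (hB' t ht)

/-- The difference solves the linear equation with coefficient `B₁` and right hand side `-½ σ(B₁ -
B₂, p₂)`, which is controlled by `B₁ - B₂` because `p₂` is bounded. -/
theorem norm_sub_sq_le (hD : RiccatiData j T L σ 𝒞 𝒬 α) {B₁ B₂ : ℝ → K}
    (hB₁ : ContinuousOn B₁ (Icc 0 T)) (hB₁' : ∀ t ∈ Icc 0 T, B₁ t ∈ 𝒞)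
    (hB₂ : ContinuousOn B₂ (Icc 0 T)) (hB₂' : ∀ t ∈ Icc 0 T, B₂ t ∈ 𝒞)
    {F : ℝ → StrongDual ℝ X} (hF : MemLp F 2 (timeMeasure T)) {k₀ : K}
    {u₁ u₂ : ℝ → X} {p₁ p₂ : ℝ → K}
    (h₁ : IsSol j T (fun t => F t - ricOp j σ (L t) ((1 / 2 : ℝ) • B₁ t) (u₁ t)) k₀ u₁ p₁)
    (h₂ : IsSol j T (fun t => F t - ricOp j σ (L t) ((1 / 2 : ℝ) • B₂ t) (u₂ t)) k₀ u₂ p₂)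
    {M : ℝ} (hM : ∀ t ∈ Icc 0 T, ‖p₂ t‖ ≤ M) :
    ∀ t ∈ Icc 0 T, ‖p₁ t - p₂ t‖ ^ 2 ≤
      α⁻¹ * (‖j‖ * (‖σ‖ * M)) ^ 2 * ∫ s in (0 : ℝ)..t, ‖B₁ s - B₂ s‖ ^ 2 := by
  have hT := hD.T_pos
  obtain ⟨β₁, hL₁⟩ := hD.evolution_half hB₁ hB₁'
  obtain ⟨β₂, hL₂⟩ := hD.evolution_half hB₂ hB₂'
  let f : ℝ → StrongDual ℝ X := fun t =>
    toDualV j ((-(1 / 2) : ℝ) • σ (B₁ t - B₂ t) (p₂ t))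
  have hf : MemLp f 2 (timeMeasure T) := by
    have h3 : ContinuousOn (fun t => σ (B₁ t - B₂ t) (p₂ t)) (Icc 0 T) :=
      continuousOn_bilin σ (hB₁.sub hB₂) h₂.cont
    exact memLp_toDualV_of_continuousOn _ (h3.const_smul _) 2
  have i1 := (memLp_fun_sub hF (hL₁.memLp_apply h₁.memLp)).integrable one_le_two
  have i2 := (memLp_fun_sub hF (hL₂.memLp_apply h₂.memLp)).integrable one_le_two
  have hsub := (h₁.sub h₂ i1 i2).congr (g' := fun t => f t -
      ricOp j σ (L t) ((1 / 2 : ℝ) • B₁ t) (u₁ t - u₂ t)) (by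
    filter_upwards [h₂.ae_eq, ae_restrict_mem measurableSet_Icc] with t h2 ht
    rw [map_sub, ricOp_apply _ _ _ _ (u₂ t), ricOp_apply _ _ _ _ (u₂ t), h2]
    simp only [f, map_sub, map_smul, smul_apply, sub_apply]
    module)
  intro t ht
  have h3 := hsub.norm_sq_le hL₁ hD.dense hT hf t ht
  rw [sub_self, norm_zero, zero_pow two_ne_zero, zero_add] at h3
  refine h3.trans ?_
  have hα := hL₁.α_pos
  rw [mul_assoc]
  refine mul_le_mul_of_nonneg_left ?_ (inv_pos.2 hα).le
  rw [← intervalIntegral.integral_const_mul]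
  have h0 : (0 : ℝ) ∈ Icc 0 T := ⟨le_rfl, hT.le⟩
  refine intervalIntegral.integral_mono_on ht.1
    (intervalIntegrable_of_timeMeasure (integrable_norm_sq_dual hf) h0 ht)
    ((intervalIntegrable_of_timeMeasure ((memLp_of_continuousOn (hB₁.sub hB₂) 2).integrable_norm_pow
      two_ne_zero) h0 ht).const_mul _) fun s hs => ?_
  rw [← mul_pow]
  refine pow_le_pow_left₀ (norm_nonneg _) ?_ 2
  refine (norm_toDualV_apply_le _ _).trans ?_
  rw [mul_assoc]
  refine mul_le_mul_of_nonneg_left ?_ (norm_nonneg _)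
  rw [norm_smul]
  have h4 := σ.le_opNorm₂ (B₁ s - B₂ s) (p₂ s)
  have h5 : ‖σ‖ * ‖B₁ s - B₂ s‖ * ‖p₂ s‖ ≤ ‖σ‖ * ‖B₁ s - B₂ s‖ * M :=
    mul_le_mul_of_nonneg_left (hM s ⟨hs.1, hs.2.trans ht.2⟩) (by positivity)
  have h6 := norm_nonneg (σ (B₁ s - B₂ s) (p₂ s))
  have h7 : ‖(-(1 / 2) : ℝ)‖ = 1 / 2 := by norm_num
  have h8 : ‖σ‖ * ‖B₁ s - B₂ s‖ * M = ‖σ‖ * M * ‖B₁ s - B₂ s‖ := by ring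
  rw [h7]
  linarith

/-- Existence for the Riccati equation with a square integrable right hand side. -/
theorem exists_riccati (hD : RiccatiData j T L σ 𝒞 𝒬 α)
    {F : ℝ → StrongDual ℝ X} (hF : MemLp F 2 (timeMeasure T)) (hF' : ∀ t ∈ Icc 0 T, F t ∈ 𝒬)
    {k₀ : K} (hk₀ : k₀ ∈ 𝒞) :
    ∃ u p, IsSol j T (fun t => F t - ricOp j σ (L t) ((1 / 2 : ℝ) • p t) (u t)) k₀ u p ∧
      ∀ t ∈ Icc 0 T, p t ∈ 𝒞 := by
  have hT := hD.T_pos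
  have h0 : (0 : ℝ) ∈ Icc 0 T := ⟨le_rfl, hT.le⟩
  have hα := hD.α_pos
  have iF := intervalIntegrable_of_timeMeasure (integrable_norm_sq_dual hF)
    h0 (right_mem_Icc.2 hT.le)
  let 𝒮 := {B : ℝ → K // ContinuousOn B (Icc 0 T) ∧ ∀ t ∈ Icc 0 T, B t ∈ 𝒞}
  choose U p hU hp using fun B : 𝒮 => hD.exists_isSol B.1 F k₀ B.2.1 B.2.2 hF hF' hk₀
  let Φ : 𝒮 → 𝒮 := fun B => ⟨p B, (hU B).cont, hp B⟩
  let B₀ : 𝒮 := ⟨fun _ => k₀, continuousOn_const, fun _ _ => hk₀⟩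
  let b : ℕ → ℝ → K := fun n => (Φ^[n] B₀).1
  have b_succ : ∀ n, b (n + 1) = p (Φ^[n] B₀) := fun n => by
    simp only [b, Function.iterate_succ_apply']
    rfl
  -- One bound for the whole image of the solution map, from the energy estimate with its uniform
  -- `α`. It turns the difference estimate into a Lipschitz estimate with a fixed constant.
  obtain ⟨M, hM0, hM⟩ : ∃ M, ‖k₀‖ ≤ M ∧ ∀ B : 𝒮, ∀ t ∈ Icc 0 T, ‖p B t‖ ≤ M := by
    set J := α⁻¹ * ∫ s in (0 : ℝ)..T, ‖F s‖ ^ 2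
    have hJ : 0 ≤ J := mul_nonneg (inv_pos.2 hα).le
      (intervalIntegral.integral_nonneg hT.le fun s _ => sq_nonneg _)
    have aux : ∀ x : K, ‖x‖ ^ 2 ≤ ‖k₀‖ ^ 2 + J → ‖x‖ ≤ √(‖k₀‖ ^ 2 + J) := fun x hx =>
      Real.le_sqrt_of_sq_le hx
    refine ⟨√(‖k₀‖ ^ 2 + J), aux _ (by linarith), fun B t ht => aux _ ?_⟩
    obtain ⟨β, hL⟩ := hD.evolution_half B.2.1 B.2.2
    refine ((hU B).norm_sq_le hL hD.dense hT hF t ht).trans ?_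
    refine add_le_add le_rfl (mul_le_mul_of_nonneg_left ?_ (inv_pos.2 hα).le)
    exact intervalIntegral.integral_mono_interval le_rfl ht.1 ht.2
      (Eventually.of_forall fun s => sq_nonneg _) iF
  -- The added `1` makes `κ` positive, as needed to divide by `4 κ` below.
  set κ := α⁻¹ * (‖j‖ * (‖σ‖ * M)) ^ 2 + 1
  have hκ : 0 < κ := by positivity
  have iB : ∀ {B₁ B₂ : ℝ → K}, ContinuousOn B₁ (Icc 0 T) → ContinuousOn B₂ (Icc 0 T) →
      ∀ t ∈ Icc 0 T, IntervalIntegrable (fun s => ‖B₁ s - B₂ s‖ ^ 2) volume 0 t :=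
    fun h1 h2 t ht => intervalIntegrable_of_timeMeasure
      ((memLp_of_continuousOn (h1.sub h2) 2).integrable_norm_pow two_ne_zero) h0 ht
  have contr : ∀ B₁ B₂ : 𝒮, ∀ t ∈ Icc 0 T, ‖p B₁ t - p B₂ t‖ ^ 2 ≤
      κ * ∫ s in (0 : ℝ)..t, ‖B₁.1 s - B₂.1 s‖ ^ 2 := fun B₁ B₂ t ht => by
    refine (hD.norm_sub_sq_le B₁.2.1 B₁.2.2 B₂.2.1 B₂.2.2 hF (hU B₁) (hU B₂) (hM B₂) t ht).trans ?_
    refine mul_le_mul_of_nonneg_right (by simp [κ]) ?_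
    exact intervalIntegral.integral_nonneg ht.1 fun s _ => sq_nonneg _
  -- With the weight `exp (4 κ t)` each iteration gains a factor `1/4` in squared distance, hence
  -- `1/2` in distance, on all of `[0, T]` without subdividing it.
  have hexp : ∀ t : ℝ, κ * ∫ s in (0 : ℝ)..t, Real.exp (4 * κ * s) =
      (Real.exp (4 * κ * t) - 1) / 4 := by
    intro t
    have : ∀ s : ℝ, HasDerivAt (fun s => Real.exp (4 * κ * s) / (4 * κ)) (Real.exp (4 * κ * s)) s :=
      fun s => by
        have h1 : HasDerivAt (fun s => 4 * κ * s) (4 * κ) s := by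
          simpa using (hasDerivAt_id s).const_mul (4 * κ)
        have h2 := h1.exp.div_const (4 * κ)
        rwa [mul_div_assoc, div_self (by positivity), mul_one] at h2
    rw [intervalIntegral.integral_eq_sub_of_hasDerivAt (fun s _ => this s)
      ((by fun_prop : Continuous fun s => Real.exp (4 * κ * s)).intervalIntegrable _ _)]
    field_simp
    simp
  have hb : ∀ n, ∀ t ∈ Icc 0 T,
      ‖b (n + 1) t - b n t‖ ^ 2 ≤ (2 * M) ^ 2 * Real.exp (4 * κ * t) / 4 ^ n := by
    intro n
    induction n with
    | zero =>
      intro t ht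
      have h1 : ‖b (0 + 1) t - b 0 t‖ ≤ 2 * M := by
        refine (norm_sub_le _ _).trans ?_
        rw [b_succ]
        have := hM (Φ^[0] B₀) t ht
        have h3 : b 0 t = k₀ := rfl
        rw [h3]
        linarith
      rw [pow_zero, div_one]
      refine (pow_le_pow_left₀ (norm_nonneg _) h1 2).trans (le_mul_of_one_le_right (sq_nonneg _) ?_)
      exact Real.one_le_exp (by have := ht.1; positivity)
    | succ n ih =>
      intro t ht
      have h1 := contr (Φ^[n + 1] B₀) (Φ^[n] B₀) t ht
      rw [← b_succ, ← b_succ] at h1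
      refine h1.trans ?_
      have h2 : ∫ s in (0 : ℝ)..t, ‖b (n + 1) s - b n s‖ ^ 2 ≤
          ∫ s in (0 : ℝ)..t, (2 * M) ^ 2 / 4 ^ n * Real.exp (4 * κ * s) := by
        refine intervalIntegral.integral_mono_on ht.1
          (iB (Φ^[n + 1] B₀).2.1 (Φ^[n] B₀).2.1 t ht)
          ((by fun_prop : Continuous fun s => (2 * M) ^ 2 / 4 ^ n * Real.exp
            (4 * κ * s)).intervalIntegrable _ _) fun s hs => ?_
        refine (ih s ⟨hs.1, hs.2.trans ht.2⟩).trans_eq ?_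
        ring
      rw [intervalIntegral.integral_const_mul] at h2
      calc _ ≤ κ * ((2 * M) ^ 2 / 4 ^ n * ∫ s in (0 : ℝ)..t, Real.exp (4 * κ * s)) :=
            mul_le_mul_of_nonneg_left h2 hκ.le
        _ = (2 * M) ^ 2 / 4 ^ n * ((Real.exp (4 * κ * t) - 1) / 4) := by rw [← hexp]; ring
        _ ≤ (2 * M) ^ 2 / 4 ^ n * (Real.exp (4 * κ * t) / 4) := by gcongr; linarith
        _ = _ := by rw [pow_succ]; field_simp; ring
  set N := 2 * (|2 * M| * √(Real.exp (4 * κ * T))) with hN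
  have hdist : ∀ t ∈ Icc 0 T, ∀ n, dist (b n t) (b (n + 1) t) ≤ N / 2 / 2 ^ n := by
    intro t ht n
    rw [dist_comm, dist_eq_norm]
    refine (sq_le_sq₀ (norm_nonneg _) (by positivity)).1 ((hb n t ht).trans ?_)
    have e : (N / 2 / 2 ^ n) ^ 2 = (2 * M) ^ 2 * Real.exp (4 * κ * T) / 4 ^ n := by
      rw [hN, mul_div_cancel_left₀ _ two_ne_zero, div_pow, mul_pow, sq_abs,
        Real.sq_sqrt (Real.exp_pos _).le, ← pow_mul, mul_comm n, pow_mul]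
      norm_num
    rw [e]
    gcongr
    exact ht.2
  have hex : ∀ t, ∃ x, t ∈ Icc 0 T → Tendsto (fun n => b n t) atTop (𝓝 x) := by
    intro t
    by_cases ht : t ∈ Icc 0 T
    · obtain ⟨x, hx⟩ := cauchySeq_tendsto_of_complete (cauchySeq_of_le_geometric_two (hdist t ht))
      exact ⟨x, fun _ => hx⟩
    · exact ⟨0, fun h => absurd h ht⟩
  choose B hB using hex
  have hdB : ∀ t ∈ Icc 0 T, ∀ n, ‖b n t - B t‖ ≤ N / 2 ^ n := fun t ht n => by
    rw [← dist_eq_norm]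
    exact dist_le_of_le_geometric_two_of_tendsto (hdist t ht) (hB t ht) n
  have hNlim : Tendsto (fun n : ℕ => N / 2 ^ n) atTop (𝓝 0) := by
    have := (tendsto_pow_atTop_nhds_zero_of_lt_one (r := (1 / 2 : ℝ)) (by norm_num)
      (by norm_num)).const_mul N
    simpa [div_eq_mul_inv] using this
  have hBc : ContinuousOn B (Icc 0 T) := by
    refine TendstoUniformlyOn.continuousOn (F := b) (p := atTop) ?_
      (Frequently.of_forall fun n => (Φ^[n] B₀).2.1)
    rw [Metric.tendstoUniformlyOn_iff]
    intro ε hε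
    filter_upwards [hNlim.eventually (gt_mem_nhds hε)] with n hn t ht
    rw [dist_comm, dist_eq_norm]
    exact (hdB t ht n).trans_lt hn
  have hBm : ∀ t ∈ Icc 0 T, B t ∈ 𝒞 := fun t ht =>
    hD.isClosed.mem_of_tendsto (hB t ht)
      (Eventually.of_forall fun n => (Φ^[n] B₀).2.2 t ht)
  let B' : 𝒮 := ⟨B, hBc, hBm⟩
  have hfix : ∀ t ∈ Icc 0 T, p B' t = B t := by
    intro t ht
    have h1 : ∀ n, ‖b (n + 1) t - p B' t‖ ^ 2 ≤ κ * ((N / 2 ^ n) ^ 2 * T) := by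
      intro n
      rw [b_succ]
      refine (contr _ B' t ht).trans (mul_le_mul_of_nonneg_left ?_ hκ.le)
      calc _ ≤ ∫ s in (0 : ℝ)..t, (N / 2 ^ n) ^ 2 := by
            refine intervalIntegral.integral_mono_on ht.1 (iB (Φ^[n] B₀).2.1 hBc t ht)
              (by simp) fun s hs => ?_
            exact pow_le_pow_left₀ (norm_nonneg _) (hdB s ⟨hs.1, hs.2.trans ht.2⟩ n) 2
        _ = (N / 2 ^ n) ^ 2 * t := by
            rw [intervalIntegral.integral_const, smul_eq_mul, sub_zero, mul_comm]
        _ ≤ _ := mul_le_mul_of_nonneg_left ht.2 (sq_nonneg _)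
    have h2 : Tendsto (fun n => κ * ((N / 2 ^ n) ^ 2 * T)) atTop (𝓝 0) := by
      simpa using ((hNlim.pow 2).mul_const T).const_mul κ
    have h3 := squeeze_zero (fun n => sq_nonneg _) h1 h2
    have h4 : Tendsto (fun n => ‖b (n + 1) t - p B' t‖) atTop (𝓝 0) := by
      have := h3.sqrt
      simpa [Real.sqrt_sq] using this
    have h5 := tendsto_iff_norm_sub_tendsto_zero.2 h4
    exact tendsto_nhds_unique h5 ((hB t ht).comp (tendsto_add_atTop_nat 1))
  refine ⟨U B', p B', (hU B').congr ?_, hp B'⟩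
  filter_upwards [ae_restrict_mem measurableSet_Icc] with t ht
  rw [hfix t ht]

end RiccatiData

end FixedPoint

/-! ### Limits in `L²` and cut-offs -/

section Limits

open Filter Topology

theorem exists_limit_memLp {E α : Type*} [NormedAddCommGroup E] [InnerProductSpace ℝ E]
    [CompleteSpace E] [MeasurableSpace α] {m : Measure α} {u : ℕ → α → E}
    (hu : ∀ n, MemLp (u n) 2 m) (h : Tendsto (fun k : ℕ × ℕ => ∫ t, ‖u k.1 t - u k.2 t‖ ^ 2 ∂m)
      (atTop ×ˢ atTop) (𝓝 0)) :
    ∃ u₀, MemLp u₀ 2 m ∧ Tendsto (fun n => ∫ t, ‖u n t - u₀ t‖ ^ 2 ∂m) atTop (𝓝 0) := by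
  have e : ∀ {f g : α → E} (hf : MemLp f 2 m) (hg : MemLp g 2 m),
      dist (hf.toLp f) (hg.toLp g) ^ 2 = ∫ t, ‖f t - g t‖ ^ 2 ∂m := by
    intro f g hf hg
    rw [dist_eq_norm, ← MemLp.toLp_sub, ← real_inner_self_eq_norm_sq, L2.inner_def]
    refine integral_congr_ae ?_
    filter_upwards [(hf.sub hg).coeFn_toLp] with t h1
    rw [h1, real_inner_self_eq_norm_sq]
    rfl
  have hc : CauchySeq fun n => (hu n).toLp (u n) := by
    rw [cauchySeq_iff_tendsto_dist_atTop_0, ← prod_atTop_atTop_eq]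
    have h1 := h.sqrt
    simp only [← e (hu _) (hu _), Real.sqrt_zero] at h1
    simpa [Real.sqrt_sq] using h1
  obtain ⟨U, hU⟩ := cauchySeq_tendsto_of_complete hc
  refine ⟨U, Lp.memLp U, ?_⟩
  have h1 := (tendsto_iff_dist_tendsto_zero.1 hU).pow 2
  have e2 := fun n => e (hu n) (Lp.memLp U)
  simp only [Lp.toLp_coeFn] at e2
  simpa [e2] using h1

/-- On a finite measure `‖w‖ ≤ ε + ε⁻¹ ‖w‖²`; the choice of `ε` makes the first term small, and then
`n` the second. -/
theorem tendsto_integral_norm_of_sq {E α : Type*} [NormedAddCommGroup E] [MeasurableSpace α]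
    {m : Measure α} [IsFiniteMeasure m] {w : ℕ → α → E} (hw : ∀ n, MemLp (w n) 2 m)
    (h : Tendsto (fun n => ∫ t, ‖w n t‖ ^ 2 ∂m) atTop (𝓝 0)) :
    Tendsto (fun n => ∫ t, ‖w n t‖ ∂m) atTop (𝓝 0) := by
  set c := m.real univ
  have hc : 0 ≤ c := measureReal_nonneg
  have key : ∀ ε > 0, ∀ n, ∫ t, ‖w n t‖ ∂m ≤ ε * c + ε⁻¹ * ∫ t, ‖w n t‖ ^ 2 ∂m := by
    intro ε hε n
    have i1 := (hw n).integrable_norm_pow two_ne_zero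
    have h1 : ∫ t, ‖w n t‖ ∂m ≤ ∫ t, (ε + ε⁻¹ * ‖w n t‖ ^ 2) ∂m := by
      refine integral_mono ((hw n).integrable one_le_two).norm
        (integrable_fun_add (integrable_const ε) (i1.const_mul _)) fun t => ?_
      have e : ε + ε⁻¹ * ‖w n t‖ ^ 2 - ‖w n t‖ =
          ε⁻¹ * ((ε - ‖w n t‖ / 2) ^ 2 + 3 / 4 * ‖w n t‖ ^ 2) := by
        field_simp
        ring
      have : 0 ≤ ε⁻¹ * ((ε - ‖w n t‖ / 2) ^ 2 + 3 / 4 * ‖w n t‖ ^ 2) := by positivity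
      simp only
      linarith
    rw [integral_add (integrable_const ε) (i1.const_mul _), integral_const_mul, integral_const,
      smul_eq_mul, mul_comm] at h1
    exact h1
  rw [Metric.tendsto_atTop]
  intro ε hε
  have hε' : 0 < ε / (2 * (c + 1)) := by positivity
  obtain ⟨N, hN⟩ := Metric.tendsto_atTop.1 h (ε / (2 * (c + 1)) * (ε / 2)) (by positivity)
  refine ⟨N, fun n hn => ?_⟩
  have h1 := key _ hε' n
  have h2 := hN n hn
  rw [Real.dist_eq, sub_zero, abs_of_nonneg (integral_nonneg fun t => sq_nonneg _)] at h2
  rw [Real.dist_eq, sub_zero, abs_of_nonneg (integral_nonneg fun t => norm_nonneg _)]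
  have h3 : (ε / (2 * (c + 1)))⁻¹ * ∫ t, ‖w n t‖ ^ 2 ∂m < ε / 2 := by
    rwa [inv_mul_lt_iff₀ hε']
  have h4 : ε / (2 * (c + 1)) * c ≤ ε / 2 := by
    rw [div_mul_eq_mul_div, div_le_div_iff₀ (by positivity) two_pos]
    nlinarith
  linarith

theorem norm_intervalIntegral_le {E : Type*} [NormedAddCommGroup E] [NormedSpace ℝ E] {T : ℝ}
    {g : ℝ → E} (hg : Integrable g (timeMeasure T)) {t : ℝ} (ht : t ∈ Icc 0 T) :
    ‖∫ s in (0 : ℝ)..t, g s‖ ≤ ∫ s, ‖g s‖ ∂timeMeasure T := by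
  have hT := ht.1.trans ht.2
  rw [← intervalIntegral_eq_timeMeasure hT]
  refine (intervalIntegral.norm_integral_le_integral_norm ht.1).trans ?_
  exact intervalIntegral.integral_mono_interval le_rfl ht.1 ht.2
    (Eventually.of_forall fun s => norm_nonneg _)
    (intervalIntegrable_of_timeMeasure hg.norm ⟨le_rfl, hT⟩ ⟨hT, le_rfl⟩)

theorem memLp_zero_fun {E α : Type*} [NormedAddCommGroup E] [MeasurableSpace α] {m : Measure α}
    {p : ENNReal} : MemLp (fun _ => (0 : E)) p m := MemLp.zero'

/-- The cut-off `1` where `‖f‖ ≤ n` and `0` elsewhere. -/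
def cutoff {E : Type*} [NormedAddCommGroup E] (f : ℝ → E) (n : ℕ) (t : ℝ) : ℝ :=
  (Iic (n : ℝ)).indicator 1 ‖f t‖

section Cutoff

variable {E G : Type*} [NormedAddCommGroup E] [NormedAddCommGroup G] {f : ℝ → E} {m : Measure ℝ}

theorem cutoff_eq (f : ℝ → E) (n : ℕ) (t : ℝ) : (‖f t‖ ≤ n ∧ cutoff f n t = 1) ∨ cutoff f n t = 0 := by
  by_cases h : ‖f t‖ ≤ n
  · exact Or.inl ⟨h, indicator_of_mem (s := Iic (n : ℝ)) h _⟩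
  · exact Or.inr (indicator_of_notMem (s := Iic (n : ℝ)) h _)

theorem cutoff_mem_Icc (f : ℝ → E) (n : ℕ) (t : ℝ) : cutoff f n t ∈ Icc 0 1 := by
  rcases cutoff_eq f n t with ⟨-, h⟩ | h <;> rw [h] <;> norm_num

theorem aestronglyMeasurable_cutoff (hf : AEStronglyMeasurable f m) (n : ℕ) :
    AEStronglyMeasurable (cutoff f n) m :=
  ((measurable_one.indicator measurableSet_Iic).comp_aemeasurable
    hf.norm.aemeasurable).aestronglyMeasurable

theorem tendsto_integral_cutoff (hf : AEStronglyMeasurable f m) {g : ℝ → ℝ} (hg : Integrable g m) :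
    Tendsto (fun n => ∫ t, (1 - cutoff f n t) * g t ∂m) atTop (𝓝 0) := by
  rw [← integral_zero ℝ ℝ (μ := m)]
  refine tendsto_integral_of_dominated_convergence (fun t => ‖g t‖) (fun n => ?_) hg.norm
    (fun n => Eventually.of_forall fun t => ?_) (Eventually.of_forall fun t => ?_)
  · exact (aestronglyMeasurable_const.sub (aestronglyMeasurable_cutoff hf n)).mul hg.1
  · rw [norm_mul]
    refine mul_le_of_le_one_left (norm_nonneg _) ?_
    have := cutoff_mem_Icc f n t
    rw [Real.norm_eq_abs, abs_le]
    constructor <;> linarith [this.1, this.2]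
  · refine tendsto_const_nhds.congr' ?_
    obtain ⟨N, hN⟩ := exists_nat_ge ‖f t‖
    filter_upwards [eventually_ge_atTop N] with n hn
    have h1 : cutoff f n t = 1 :=
      indicator_of_mem (s := Iic (n : ℝ)) (hN.trans (Nat.cast_le.2 hn)) _
    rw [h1]
    ring

variable [NormedSpace ℝ E] [NormedSpace ℝ G]

theorem memLp_cutoff_smul (hf : AEStronglyMeasurable f m) {g : ℝ → G} {p : ENNReal}
    (hg : MemLp g p m) (n : ℕ) : MemLp (fun t => cutoff f n t • g t) p m := by
  refine hg.of_le ((aestronglyMeasurable_cutoff hf n).smul hg.1) (Eventually.of_forall fun t => ?_)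
  have := cutoff_mem_Icc f n t
  rw [norm_smul, Real.norm_of_nonneg this.1]
  exact mul_le_of_le_one_left (norm_nonneg _) this.2

theorem memLp_cutoff_smul_self [IsFiniteMeasure m] (hf : AEStronglyMeasurable f m) (n : ℕ)
    (p : ENNReal) : MemLp (fun t => cutoff f n t • f t) p m := by
  refine MemLp.of_bound ((aestronglyMeasurable_cutoff hf n).smul hf) n
    (Eventually.of_forall fun t => ?_)
  rcases cutoff_eq f n t with ⟨h, h'⟩ | h
  · rwa [h', one_smul]
  · rw [h, zero_smul, norm_zero]
    positivity

/-- Cut-offs take only the values `0` and `1`. They differ only where one of them vanishes, and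
there the difference and its square are both one. -/
theorem abs_cutoff_sub_le (f : ℝ → E) (n k : ℕ) (t : ℝ) :
    |cutoff f n t - cutoff f k t| ≤ (1 - cutoff f n t) + (1 - cutoff f k t) ∧
    |cutoff f n t - cutoff f k t| ^ 2 ≤ (1 - cutoff f n t) + (1 - cutoff f k t) := by
  rcases cutoff_eq f n t with ⟨-, h⟩ | h <;> rcases cutoff_eq f k t with ⟨-, h'⟩ | h' <;>
    rw [h, h'] <;> norm_num

end Cutoff

end Limits

/-! ### Uniqueness and continuous dependence -/

section Stability

open Filter Topology

variable {X K : Type*} [NormedAddCommGroup X] [InnerProductSpace ℝ X] [CompleteSpace X]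
  [TopologicalSpace.SeparableSpace X]
  [NormedAddCommGroup K] [InnerProductSpace ℝ K] [CompleteSpace K]

namespace RiccatiData

variable {j : X →L[ℝ] K} {T : ℝ} {L : ℝ → X →L[ℝ] StrongDual ℝ X} {σ : K →L[ℝ] K →L[ℝ] K}
  {𝒞 : Set K} {𝒬 : Set (StrongDual ℝ X)} {α : ℝ} {F₁ F₂ : ℝ → StrongDual ℝ X} {k₁ k₂ : K}
  {u₁ u₂ : ℝ → X} {p₁ p₂ : ℝ → K}

theorem half_add_mem (hD : RiccatiData j T L σ 𝒞 𝒬 α) {p q : K} (hp : p ∈ 𝒞) (hq : q ∈ 𝒞) :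
    (1 / 2 : ℝ) • (p + q) ∈ 𝒞 := by
  rw [smul_add]
  exact hD.convex hp hq (by norm_num) (by norm_num) (by norm_num)

/-- By symmetry of `σ`, `½ σ(p₁, p₁) - ½ σ(p₂, p₂) = σ(½ (p₁ + p₂), p₁ - p₂)`. The equation for the
difference is thus linear, with a coefficient that stays in `𝒞` by convexity. -/
theorem isSol_sub (hD : RiccatiData j T L σ 𝒞 𝒬 α)
    (h₁ : IsSol j T (fun t => F₁ t - ricOp j σ (L t) ((1 / 2 : ℝ) • p₁ t) (u₁ t)) k₁ u₁ p₁)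
    (h₂ : IsSol j T (fun t => F₂ t - ricOp j σ (L t) ((1 / 2 : ℝ) • p₂ t) (u₂ t)) k₂ u₂ p₂)
    (i₁ : Integrable (fun t => F₁ t - ricOp j σ (L t) ((1 / 2 : ℝ) • p₁ t) (u₁ t)) (timeMeasure T))
    (i₂ : Integrable (fun t => F₂ t - ricOp j σ (L t) ((1 / 2 : ℝ) • p₂ t) (u₂ t)) (timeMeasure T)) :
    IsSol j T (fun t => (F₁ t - F₂ t) -
        ricOp j σ (L t) ((1 / 2 : ℝ) • (p₁ t + p₂ t)) (u₁ t - u₂ t)) (k₁ - k₂)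
      (fun t => u₁ t - u₂ t) (fun t => p₁ t - p₂ t) := by
  refine (h₁.sub h₂ i₁ i₂).congr ?_
  filter_upwards [h₁.ae_eq, h₂.ae_eq] with t e1 e2
  simp only [ricOp_apply, map_sub, map_add, map_smul, smul_apply, add_apply, smul_add, e1, e2]
  rw [hD.symm (p₂ t) (p₁ t)]
  module

theorem evolution_add (hD : RiccatiData j T L σ 𝒞 𝒬 α) (hp₁ : ContinuousOn p₁ (Icc 0 T))
    (hp₁' : ∀ t ∈ Icc 0 T, p₁ t ∈ 𝒞) (hp₂ : ContinuousOn p₂ (Icc 0 T))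
    (hp₂' : ∀ t ∈ Icc 0 T, p₂ t ∈ 𝒞) :
    ∃ β, EvolutionData X T (fun t => ricOp j σ (L t) ((1 / 2 : ℝ) • (p₁ t + p₂ t))) α β :=
  hD.evolution (fun t => (1 / 2 : ℝ) • (p₁ t + p₂ t)) (by fun_prop) fun t ht =>
    hD.half_add_mem (hp₁' t ht) (hp₂' t ht)

/-- Uniqueness for the abstract Riccati equation. -/
theorem eqOn (hD : RiccatiData j T L σ 𝒞 𝒬 α) {F : ℝ → StrongDual ℝ X} {k₀ : K}
    (h₁ : IsSol j T (fun t => F t - ricOp j σ (L t) ((1 / 2 : ℝ) • p₁ t) (u₁ t)) k₀ u₁ p₁)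
    (h₂ : IsSol j T (fun t => F t - ricOp j σ (L t) ((1 / 2 : ℝ) • p₂ t) (u₂ t)) k₀ u₂ p₂)
    (i₁ : Integrable (fun t => F t - ricOp j σ (L t) ((1 / 2 : ℝ) • p₁ t) (u₁ t)) (timeMeasure T))
    (i₂ : Integrable (fun t => F t - ricOp j σ (L t) ((1 / 2 : ℝ) • p₂ t) (u₂ t)) (timeMeasure T))
    (hp₁ : ∀ t ∈ Icc 0 T, p₁ t ∈ 𝒞) (hp₂ : ∀ t ∈ Icc 0 T, p₂ t ∈ 𝒞) : EqOn p₁ p₂ (Icc 0 T) := by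
  obtain ⟨β, hL⟩ := hD.evolution_add h₁.cont hp₁ h₂.cont hp₂
  have h := hD.isSol_sub h₁ h₂ i₁ i₂
  simp only [sub_self] at h
  intro t ht
  have h1 := h.norm_sq_le hL hD.dense hD.T_pos memLp_zero_fun t ht
  simp only [norm_zero, zero_pow two_ne_zero, intervalIntegral.integral_zero, mul_zero,
    add_zero] at h1
  rw [← sub_eq_zero, ← norm_eq_zero]
  exact pow_eq_zero_iff two_ne_zero |>.1 (le_antisymm h1 (sq_nonneg _))

/-- Continuous dependence on the right hand side, in `L¹(0, T; K) + L²(0, T; X*)`. -/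
theorem stability (hD : RiccatiData j T L σ 𝒞 𝒬 α) (hF₁ : MemLp F₁ 2 (timeMeasure T))
    (hF₂ : MemLp F₂ 2 (timeMeasure T)) {k₀ : K}
    (h₁ : IsSol j T (fun t => F₁ t - ricOp j σ (L t) ((1 / 2 : ℝ) • p₁ t) (u₁ t)) k₀ u₁ p₁)
    (h₂ : IsSol j T (fun t => F₂ t - ricOp j σ (L t) ((1 / 2 : ℝ) • p₂ t) (u₂ t)) k₀ u₂ p₂)
    (hp₁ : ∀ t ∈ Icc 0 T, p₁ t ∈ 𝒞) (hp₂ : ∀ t ∈ Icc 0 T, p₂ t ∈ 𝒞)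
    {f : ℝ → K} {f' : ℝ → StrongDual ℝ X} (hf : Integrable f (timeMeasure T))
    (hf' : MemLp f' 2 (timeMeasure T))
    (hF : ∀ᵐ t ∂timeMeasure T, F₁ t - F₂ t = toDualV j (f t) + f' t)
    {I J : ℝ} (hI : ∫ t, ‖f t‖ ∂timeMeasure T ≤ I) (hJ : ∫ t, ‖f' t‖ ^ 2 ∂timeMeasure T ≤ J) :
    (∀ t ∈ Icc 0 T, ‖p₁ t - p₂ t‖ ^ 2 ≤ 4 * I ^ 2 + 2 * α⁻¹ * J) ∧
      α * ∫ t, ‖u₁ t - u₂ t‖ ^ 2 ∂timeMeasure T ≤ 4 * I ^ 2 + 2 * α⁻¹ * J := by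
  have hT := hD.T_pos
  have hα := hD.α_pos
  obtain ⟨β₁, hL₁⟩ := hD.evolution_half h₁.cont hp₁
  obtain ⟨β₂, hL₂⟩ := hD.evolution_half h₂.cont hp₂
  obtain ⟨β, hL⟩ := hD.evolution_add h₁.cont hp₁ h₂.cont hp₂
  have h := hD.isSol_sub h₁ h₂ ((memLp_fun_sub hF₁ (hL₁.memLp_apply h₁.memLp)).integrable one_le_two)
    ((memLp_fun_sub hF₂ (hL₂.memLp_apply h₂.memLp)).integrable one_le_two)
  have hFm : MemLp (fun t => F₁ t - F₂ t) 2 (timeMeasure T) := memLp_fun_sub hF₁ hF₂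
  -- An `L¹` force can only be paired with the supremum in time of `p₁ - p₂`. Its maximum `m` is
  -- attained, and evaluating the estimate at `t₀` lets `2 m I ≤ m² / 2 + 2 I²` be absorbed.
  obtain ⟨t₀, ht₀, hmax⟩ := isCompact_Icc.exists_isMaxOn (nonempty_Icc.2 hT.le) h.cont.norm
  set m := ‖p₁ t₀ - p₂ t₀‖
  have hm0 : 0 ≤ m := norm_nonneg _
  have i1 := integrable_pairing h.memLp hFm
  have i2 := h.memLp.integrable_norm_pow two_ne_zero
  have i3 := integrable_norm_sq_dual hf'
  have h0 : (0 : ℝ) ∈ Icc 0 T := ⟨le_rfl, hT.le⟩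
  have key : ∀ t ∈ Icc 0 T, ‖p₁ t - p₂ t‖ ^ 2 + α * ∫ s in (0 : ℝ)..t, ‖u₁ s - u₂ s‖ ^ 2 ≤
      2 * m * I + α⁻¹ * J := by
    intro t ht
    have h1 := h.energy_coercive hL hD.dense hT hFm t ht
    rw [sub_self, norm_zero, zero_pow two_ne_zero, zero_add] at h1
    have ii : ∀ {g : ℝ → ℝ}, Integrable g (timeMeasure T) → IntervalIntegrable g volume 0 t :=
      fun hg => intervalIntegrable_of_timeMeasure hg h0 ht
    have h2 : ∫ s in (0 : ℝ)..t, (F₁ s - F₂ s) (u₁ s - u₂ s) ≤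
        ∫ s in (0 : ℝ)..t, (m * ‖f s‖ + α / 2 * ‖u₁ s - u₂ s‖ ^ 2 + α⁻¹ / 2 * ‖f' s‖ ^ 2) := by
      refine intervalIntegral.integral_mono_ae_restrict ht.1 (ii i1)
        ((((ii hf.norm).const_mul m).add ((ii i2).const_mul _)).add ((ii i3).const_mul _)) ?_
      have hsub : Icc 0 t ⊆ Icc 0 T := Icc_subset_Icc_right ht.2
      filter_upwards [ae_restrict_of_ae_restrict_of_subset hsub hF,
        ae_restrict_of_ae_restrict_of_subset hsub h.ae_eq, ae_restrict_mem measurableSet_Icc]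
        with s e1 e2 hs
      rw [e1, add_apply, toDualV_apply, e2]
      have b1 : inner ℝ (f s) (p₁ s - p₂ s) ≤ m * ‖f s‖ := by
        refine (real_inner_le_norm _ _).trans ?_
        rw [mul_comm]
        exact mul_le_mul_of_nonneg_right (hmax (hsub hs)) (norm_nonneg _)
      have b2 : f' s (u₁ s - u₂ s) ≤ ‖f' s‖ * ‖u₁ s - u₂ s‖ :=
        (le_abs_self _).trans ((f' s).le_opNorm _)
      have e : α / 2 * ‖u₁ s - u₂ s‖ ^ 2 + α⁻¹ / 2 * ‖f' s‖ ^ 2 - ‖f' s‖ * ‖u₁ s - u₂ s‖ =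
          α⁻¹ / 2 * (‖f' s‖ - α * ‖u₁ s - u₂ s‖) ^ 2 := by
        field_simp
        ring
      have : 0 ≤ α⁻¹ / 2 * (‖f' s‖ - α * ‖u₁ s - u₂ s‖) ^ 2 := by positivity
      linarith
    rw [intervalIntegral.integral_add (((ii hf.norm).const_mul m).add ((ii i2).const_mul _))
      ((ii i3).const_mul _), intervalIntegral.integral_add ((ii hf.norm).const_mul m)
      ((ii i2).const_mul _), intervalIntegral.integral_const_mul,
      intervalIntegral.integral_const_mul, intervalIntegral.integral_const_mul] at h2
    have mono : ∀ {g : ℝ → ℝ}, (∀ s, 0 ≤ g s) → Integrable g (timeMeasure T) →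
        ∫ s in (0 : ℝ)..t, g s ≤ ∫ s, g s ∂timeMeasure T := fun hg hi => by
      rw [← intervalIntegral_eq_timeMeasure hT.le]
      exact intervalIntegral.integral_mono_interval le_rfl ht.1 ht.2
        (Eventually.of_forall fun s => hg s) (intervalIntegrable_of_timeMeasure hi h0 ⟨hT.le, le_rfl⟩)
    have b1 := mul_le_mul_of_nonneg_left ((mono (fun s => norm_nonneg _) hf.norm).trans hI) hm0
    have b2 := mul_le_mul_of_nonneg_left ((mono (fun s => sq_nonneg _) i3).trans hJ)
      (inv_pos.2 hα).le
    linarith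
  have sqI : 2 * m * I ≤ m ^ 2 / 2 + 2 * I ^ 2 := by nlinarith [sq_nonneg (m - 2 * I)]
  have hm : m ^ 2 ≤ 4 * I ^ 2 + 2 * α⁻¹ * J := by
    have h1 := key t₀ ht₀
    have h2 : 0 ≤ α * ∫ s in (0 : ℝ)..t₀, ‖u₁ s - u₂ s‖ ^ 2 := mul_nonneg hα.le
      (intervalIntegral.integral_nonneg ht₀.1 fun s _ => sq_nonneg _)
    linarith
  refine ⟨fun t ht => (pow_le_pow_left₀ (norm_nonneg _) (hmax ht) 2).trans hm, ?_⟩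
  have h1 := key T ⟨hT.le, le_rfl⟩
  rw [intervalIntegral_eq_timeMeasure hT.le] at h1
  have := sq_nonneg ‖p₁ T - p₂ T‖
  linarith

end RiccatiData

end Stability

/-! ### Right hand sides in `L¹ + L²` -/

section SumSpace

open Filter Topology

variable {X K : Type*} [NormedAddCommGroup X] [InnerProductSpace ℝ X] [CompleteSpace X]
  [TopologicalSpace.SeparableSpace X]
  [NormedAddCommGroup K] [InnerProductSpace ℝ K] [CompleteSpace K]

namespace RiccatiData

variable {j : X →L[ℝ] K} {T : ℝ} {L : ℝ → X →L[ℝ] StrongDual ℝ X} {σ : K →L[ℝ] K →L[ℝ] K}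
  {𝒞 : Set K} {𝒬 : Set (StrongDual ℝ X)} {α : ℝ}

theorem exists_evolutionData (hD : RiccatiData j T L σ 𝒞 𝒬 α) : ∃ β, EvolutionData X T L α β := by
  obtain ⟨β, h⟩ := hD.evolution (fun _ => 0) continuousOn_const fun _ _ => hD.zero_mem
  have e : ∀ t, ricOp j σ (L t) 0 = L t := fun t => by
    ext u v
    rw [ricOp_apply, map_zero]
    simp
  simp only [e] at h
  exact ⟨β, h⟩

theorem integrable_toDualV {f : ℝ → K} (hf : Integrable f (timeMeasure T)) :
    Integrable (fun t => toDualV j (f t)) (timeMeasure T) :=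
  (toDualV j).integrable_comp hf

/-- The nonlinear term depends on `u` only through the continuous, hence bounded, `p`, and `L` maps
`L²` to `L²`. So only integrability of `F` is needed. -/
theorem integrable_rhs (hD : RiccatiData j T L σ 𝒞 𝒬 α) {F : ℝ → StrongDual ℝ X}
    {u : ℝ → X} {p : ℝ → K} (hF : Integrable F (timeMeasure T)) (hu : MemLp u 2 (timeMeasure T))
    (hp : ContinuousOn p (Icc 0 T)) (hup : ∀ᵐ t ∂timeMeasure T, j (u t) = p t) :
    Integrable (fun t => F t - ricOp j σ (L t) ((1 / 2 : ℝ) • p t) (u t)) (timeMeasure T) := by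
  obtain ⟨β, hL⟩ := hD.exists_evolutionData
  have h1 : Integrable (fun t => toDualV j (σ ((1 / 2 : ℝ) • p t) (p t))) (timeMeasure T) :=
    (memLp_toDualV_of_continuousOn j (continuousOn_bilin σ (by fun_prop) hp) 1).integrable le_rfl
  have h2 := integrable_fun_sub hF (integrable_fun_add ((hL.memLp_apply hu).integrable one_le_two) h1)
  refine h2.congr ?_
  filter_upwards [hup] with t ht
  rw [ricOp_apply, ht]

theorem norm_smul_sub_smul {E : Type*} [NormedAddCommGroup E] [NormedSpace ℝ E] (a b : ℝ) (x : E) :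
    ‖a • x - b • x‖ = |a - b| * ‖x‖ := by
  rw [← sub_smul, norm_smul, Real.norm_eq_abs]

theorem norm_integral_apply_sub_le {g g' : ℝ → StrongDual ℝ X} (hg : Integrable g (timeMeasure T))
    (hg' : Integrable g' (timeMeasure T)) {t : ℝ} (ht : t ∈ Icc 0 T) (R : X) :
    ‖(∫ s in (0 : ℝ)..t, g s R) - ∫ s in (0 : ℝ)..t, g' s R‖ ≤
      (∫ s, ‖g s - g' s‖ ∂timeMeasure T) * ‖R‖ := by
  have h0 : (0 : ℝ) ∈ Icc 0 T := ⟨le_rfl, ht.1.trans ht.2⟩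
  have hd := integrable_fun_sub hg hg'
  rw [← intervalIntegral.integral_sub
    (intervalIntegrable_of_timeMeasure (integrable_apply hg R) h0 ht)
    (intervalIntegrable_of_timeMeasure (integrable_apply hg' R) h0 ht)]
  refine (norm_intervalIntegral_le (integrable_apply hd R) ht).trans ?_
  rw [← integral_mul_const]
  exact integral_mono (integrable_apply hd R).norm (hd.norm.mul_const _) fun s =>
    ContinuousLinearMap.le_opNorm _ _

set_option maxHeartbeats 1000000 in
/-- Existence for the abstract Riccati equation with a right hand side in
`L¹(0, T; K) + L²(0, T; X*)`. -/
theorem exists_riccati_sum (hD : RiccatiData j T L σ 𝒞 𝒬 α) {f₁ : ℝ → K}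
    {f₂ : ℝ → StrongDual ℝ X} (hf₁ : MemLp f₁ 1 (timeMeasure T)) (hf₂ : MemLp f₂ 2 (timeMeasure T))
    (hQ : ∀ᵐ t ∂timeMeasure T, toDualV j (f₁ t) + f₂ t ∈ 𝒬) {k₀ : K} (hk₀ : k₀ ∈ 𝒞) :
    ∃ u p, IsSol j T (fun t => toDualV j (f₁ t) + f₂ t -
      ricOp j σ (L t) ((1 / 2 : ℝ) • p t) (u t)) k₀ u p ∧ ∀ t ∈ Icc 0 T, p t ∈ 𝒞 := by
  classical
  have hT := hD.T_pos
  have hα := hD.α_pos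
  have hi₁ : Integrable f₁ (timeMeasure T) := hf₁.integrable le_rfl
  have hi₂ := integrable_norm_sq_dual hf₂
  let c : ℕ → ℝ → ℝ := cutoff f₁
  let Q : ℝ → StrongDual ℝ X := fun t => toDualV j (f₁ t) + f₂ t
  have hQi : Integrable Q (timeMeasure T) :=
    integrable_fun_add (integrable_toDualV hi₁) (hf₂.integrable one_le_two)
  -- The same zero-one cut-off acts on both parts of `Q`, so each value is either `Q t` or `0`, and
  -- both are in `𝒬`. Cutting where `f₁` is large makes the `L¹` part bounded; the null set where `Q
  -- t` is not in `𝒬` is filled with `0`.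
  let F : ℕ → ℝ → StrongDual ℝ X := fun n t => if Q t ∈ 𝒬 then c n t • Q t else 0
  have hFae : ∀ n, ∀ᵐ t ∂timeMeasure T, F n t = toDualV j (c n t • f₁ t) + c n t • f₂ t := by
    intro n
    filter_upwards [hQ] with t ht
    have h1 : F n t = c n t • Q t := if_pos ht
    rw [h1, map_smul, ← smul_add]
  have hF2 : ∀ n, MemLp (F n) 2 (timeMeasure T) := fun n => by
    refine (memLp_fun_add ((toDualV j).comp_memLp' (memLp_cutoff_smul_self hf₁.1 n 2))
      (memLp_cutoff_smul hf₁.1 hf₂ n)).ae_eq ?_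
    filter_upwards [hFae n] with t ht using ht.symm
  have hF𝒬 : ∀ n, ∀ t ∈ Icc 0 T, F n t ∈ 𝒬 := by
    intro n t _
    by_cases h : Q t ∈ 𝒬
    · have h1 : F n t = c n t • Q t := if_pos h
      rcases cutoff_eq f₁ n t with ⟨-, h2⟩ | h2
      · rwa [h1, show c n t = 1 from h2, one_smul]
      · rw [h1, show c n t = 0 from h2, zero_smul]
        exact hD.zero_mem'
    · have h1 : F n t = 0 := if_neg h
      rw [h1]
      exact hD.zero_mem'
  choose u p hup hp using fun n => hD.exists_riccati (hF2 n) (hF𝒬 n) hk₀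
  let δ : ℕ → ℝ := fun n => ∫ t, (1 - c n t) * ‖f₁ t‖ ∂timeMeasure T
  let δ' : ℕ → ℝ := fun n => ∫ t, (1 - c n t) * ‖f₂ t‖ ^ 2 ∂timeMeasure T
  have hδ : Tendsto δ atTop (𝓝 0) := tendsto_integral_cutoff hf₁.1 hi₁.norm
  have hδ' : Tendsto δ' atTop (𝓝 0) := tendsto_integral_cutoff hf₁.1 hi₂
  have hci : ∀ n, ∀ {g : ℝ → ℝ}, Integrable g (timeMeasure T) →
      Integrable (fun t => (1 - c n t) * g t) (timeMeasure T) := by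
    intro n g hg
    have h1 := (memLp_cutoff_smul hf₁.1 (memLp_one_iff_integrable.2 hg) n).integrable le_rfl
    refine (integrable_fun_sub hg h1).congr (Eventually.of_forall fun t => ?_)
    simp only [smul_eq_mul, c]
    ring
  let ρ : ℕ → ℕ → ℝ := fun n k => 4 * (δ n + δ k) ^ 2 + 2 * α⁻¹ * (δ' n + δ' k)
  have stab : ∀ n k, (∀ t ∈ Icc 0 T, ‖p n t - p k t‖ ^ 2 ≤ ρ n k) ∧
      α * ∫ t, ‖u n t - u k t‖ ^ 2 ∂timeMeasure T ≤ ρ n k := by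
    intro n k
    refine hD.stability (hF2 n) (hF2 k) (hup n) (hup k) (hp n) (hp k)
      (f := fun t => c n t • f₁ t - c k t • f₁ t) (f' := fun t => c n t • f₂ t - c k t • f₂ t)
      ?_ ?_ ?_ ?_ ?_
    · exact integrable_fun_sub ((memLp_cutoff_smul hf₁.1 hf₁ n).integrable le_rfl)
        ((memLp_cutoff_smul hf₁.1 hf₁ k).integrable le_rfl)
    · exact memLp_fun_sub (memLp_cutoff_smul hf₁.1 hf₂ n) (memLp_cutoff_smul hf₁.1 hf₂ k)
    · filter_upwards [hFae n, hFae k] with t h1 h2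
      rw [h1, h2, map_sub]
      abel
    · simp only [δ]
      rw [← integral_add (hci n hi₁.norm) (hci k hi₁.norm)]
      refine integral_mono_of_nonneg (Eventually.of_forall fun t => norm_nonneg _)
        (integrable_fun_add (hci n hi₁.norm) (hci k hi₁.norm)) (Eventually.of_forall fun t => ?_)
      simp only
      rw [← sub_smul, norm_smul, ← add_mul]
      exact mul_le_mul_of_nonneg_right (abs_cutoff_sub_le f₁ n k t).1 (norm_nonneg _)
    · simp only [δ']
      rw [← integral_add (hci n hi₂) (hci k hi₂)]
      refine integral_mono_of_nonneg (Eventually.of_forall fun t => sq_nonneg _)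
        (integrable_fun_add (hci n hi₂) (hci k hi₂)) (Eventually.of_forall fun t => ?_)
      simp only
      refine (congrArg (· ^ 2) (norm_smul_sub_smul (c n t) (c k t) (f₂ t))).trans_le ?_
      rw [← add_mul, mul_pow]
      exact mul_le_mul_of_nonneg_right (abs_cutoff_sub_le f₁ n k t).2 (sq_nonneg _)
  have hρ2 : Tendsto (fun k : ℕ × ℕ => ρ k.1 k.2) (atTop ×ˢ atTop) (𝓝 0) := by
    have h1 := (hδ.comp (tendsto_fst (f := atTop) (g := atTop))).add (hδ.comp tendsto_snd)
    have h2 := (hδ'.comp (tendsto_fst (f := atTop) (g := atTop))).add (hδ'.comp tendsto_snd)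
    have := ((h1.pow 2).const_mul 4).add (h2.const_mul (2 * α⁻¹))
    simpa using this
  let ρ₁ : ℕ → ℝ := fun n => 4 * (δ n) ^ 2 + 2 * α⁻¹ * δ' n
  have hρ₁ : ∀ n, Tendsto (fun k => ρ n k) atTop (𝓝 (ρ₁ n)) := fun n => by
    have := (((hδ.const_add (δ n)).pow 2).const_mul 4).add ((hδ'.const_add (δ' n)).const_mul (2 * α⁻¹))
    simpa using this
  have hρ₁' : Tendsto ρ₁ atTop (𝓝 0) := by
    have := ((hδ.pow 2).const_mul 4).add (hδ'.const_mul (2 * α⁻¹))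
    simpa using this
  have hex : ∀ t, ∃ x, t ∈ Icc 0 T → Tendsto (fun n => p n t) atTop (𝓝 x) := by
    intro t
    by_cases ht : t ∈ Icc 0 T
    · have hc : CauchySeq fun n => p n t := by
        rw [cauchySeq_iff_tendsto_dist_atTop_0, ← prod_atTop_atTop_eq]
        have h1 := squeeze_zero (fun k : ℕ × ℕ => sq_nonneg ‖p k.1 t - p k.2 t‖)
          (fun k => (stab k.1 k.2).1 t ht) hρ2
        have h2 := h1.sqrt
        simpa [Real.sqrt_sq, dist_eq_norm] using h2
      obtain ⟨x, hx⟩ := cauchySeq_tendsto_of_complete hc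
      exact ⟨x, fun _ => hx⟩
    · exact ⟨0, fun h => absurd h ht⟩
  choose q hq using hex
  have hdq : ∀ t ∈ Icc 0 T, ∀ n, ‖p n t - q t‖ ≤ √(ρ₁ n) := fun t ht n => by
    refine Real.le_sqrt_of_sq_le ?_
    exact le_of_tendsto_of_tendsto' (((hq t ht).const_sub (p n t)).norm.pow 2) (hρ₁ n)
      fun k => (stab n k).1 t ht
  have hs : Tendsto (fun n => √(ρ₁ n)) atTop (𝓝 0) := by simpa using hρ₁'.sqrt
  have hqc : ContinuousOn q (Icc 0 T) := by
    refine TendstoUniformlyOn.continuousOn (F := p) (p := atTop) ?_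
      (Frequently.of_forall fun n => (hup n).cont)
    rw [Metric.tendstoUniformlyOn_iff]
    intro ε hε
    filter_upwards [hs.eventually (gt_mem_nhds hε)] with n hn t ht
    rw [dist_comm, dist_eq_norm]
    exact (hdq t ht n).trans_lt hn
  have hqm : ∀ t ∈ Icc 0 T, q t ∈ 𝒞 := fun t ht =>
    hD.isClosed.mem_of_tendsto (hq t ht) (Eventually.of_forall fun n => hp n t ht)
  obtain ⟨v, hv, huv⟩ := exists_limit_memLp (fun n => (hup n).memLp) (by
    have h1 : ∀ k : ℕ × ℕ, ∫ t, ‖u k.1 t - u k.2 t‖ ^ 2 ∂timeMeasure T ≤ α⁻¹ * ρ k.1 k.2 := fun k => by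
      rw [le_inv_mul_iff₀ hα]
      exact (stab k.1 k.2).2
    refine squeeze_zero (fun k => integral_nonneg fun t => sq_nonneg _) h1 ?_
    simpa using hρ2.const_mul α⁻¹)
  have hw : ∀ n, MemLp (fun t => u n t - v t) 2 (timeMeasure T) := fun n => (hup n).memLp.sub hv
  have hw1 := tendsto_integral_norm_of_sq hw huv
  -- The `L²` limit `v` and the uniform limit `q` were obtained separately; the integral of `‖j v -
  -- q‖` is estimated through `u n` and `p n`, which match for every `n`.
  have hvq : ∀ᵐ t ∂timeMeasure T, j (v t) = q t := by
    have hm : MemLp (fun t => j (v t) - q t) 1 (timeMeasure T) :=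
      ((j.comp_memLp' hv).mono_exponent one_le_two).sub (memLp_of_continuousOn hqc 1)
    have hb : ∀ n, ∫ t, ‖j (v t) - q t‖ ∂timeMeasure T ≤
        ‖j‖ * (∫ t, ‖u n t - v t‖ ∂timeMeasure T) + √(ρ₁ n) * T := by
      intro n
      have i1 := ((hw n).integrable one_le_two).norm.const_mul ‖j‖
      have i2 : Integrable (fun _ : ℝ => √(ρ₁ n)) (timeMeasure T) := integrable_const _
      have h1 : ∫ t, ‖j (v t) - q t‖ ∂timeMeasure T ≤
          ∫ t, (‖j‖ * ‖u n t - v t‖ + √(ρ₁ n)) ∂timeMeasure T := by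
        refine integral_mono_ae (hm.integrable le_rfl).norm (integrable_fun_add i1 i2) ?_
        filter_upwards [(hup n).ae_eq, ae_restrict_mem measurableSet_Icc] with t h1 ht
        have e : j (v t) - q t = (p n t - q t) - j (u n t - v t) := by
          rw [map_sub, h1]
          abel
        rw [e]
        refine (norm_sub_le _ _).trans ?_
        have := j.le_opNorm (u n t - v t)
        linarith [hdq t ht n]
      rw [integral_add i1 i2, integral_const_mul, integral_const] at h1
      simpa [hT.le, mul_comm] using h1
    have h0 : Tendsto (fun n => ‖j‖ * (∫ t, ‖u n t - v t‖ ∂timeMeasure T) + √(ρ₁ n) * T) atTop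
        (𝓝 0) := by
      simpa using (hw1.const_mul ‖j‖).add (hs.mul_const T)
    have h2 : ∫ t, ‖j (v t) - q t‖ ∂timeMeasure T ≤ 0 := ge_of_tendsto' h0 hb
    have h3 := (integral_eq_zero_iff_of_nonneg (fun t => norm_nonneg _)
      (hm.integrable le_rfl).norm).1 (le_antisymm h2 (integral_nonneg fun t => norm_nonneg _))
    filter_upwards [h3] with t ht
    exact sub_eq_zero.1 (norm_eq_zero.1 ht)
  obtain ⟨β, hL⟩ := hD.exists_evolutionData
  obtain ⟨M, hM⟩ := isCompact_Icc.exists_bound_of_continuousOn hqc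
  have iG := hD.integrable_rhs hQi hv hqc hvq
  have iGn := fun n => hD.integrable_rhs ((hF2 n).integrable one_le_two) (hup n).memLp
    (hup n).cont (hup n).ae_eq
  have iQ : Integrable (fun t => ‖Q t‖) (timeMeasure T) := hQi.norm
  -- Convergence of the right hand sides in `L¹(0, T; X*)` suffices for the integrated equation. The
  -- quadratic part is handled by `σ(p, p) - σ(q, q) = σ(p + q, p - q)` and the uniform convergence
  -- of `p n`.
  have bound : ∀ n, ∫ t, ‖(F n t - ricOp j σ (L t) ((1 / 2 : ℝ) • p n t) (u n t)) -
      (Q t - ricOp j σ (L t) ((1 / 2 : ℝ) • q t) (v t))‖ ∂timeMeasure T ≤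
      (∫ t, (1 - c n t) * ‖Q t‖ ∂timeMeasure T) + β * (∫ t, ‖u n t - v t‖ ∂timeMeasure T) +
        ‖j‖ * (‖σ‖ * (√(ρ₁ n) + 2 * M) * √(ρ₁ n)) * T := by
    intro n
    have i1 := hci n iQ
    have i2 := ((hw n).integrable one_le_two).norm.const_mul β
    have i3 : Integrable (fun _ : ℝ => ‖j‖ * (‖σ‖ * (√(ρ₁ n) + 2 * M) * √(ρ₁ n))) (timeMeasure T) :=
      integrable_const _
    have h1 := integral_mono_ae (integrable_fun_sub (iGn n) iG).norm
      (integrable_fun_add (integrable_fun_add i1 i2) i3) (by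
      filter_upwards [hQ, hvq, (hup n).ae_eq, ae_restrict_mem measurableSet_Icc]
        with t h1 h2 h3 ht
      have e1 : F n t = c n t • Q t := if_pos h1
      have e2 : σ (p n t) (p n t) - σ (q t) (q t) = σ (p n t + q t) (p n t - q t) := by
        simp only [map_sub, map_add, add_apply]
        rw [hD.symm (q t) (p n t)]
        abel
      have e3 : (F n t - ricOp j σ (L t) ((1 / 2 : ℝ) • p n t) (u n t)) -
          (Q t - ricOp j σ (L t) ((1 / 2 : ℝ) • q t) (v t)) =
          -((1 - c n t) • Q t) - L t (u n t - v t) -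
            toDualV j ((1 / 2 : ℝ) • σ (p n t + q t) (p n t - q t)) := by
        rw [← e2, e1, ricOp_apply, ricOp_apply, h2, h3]
        simp only [map_sub, map_smul, smul_apply]
        module
      change ‖(F n t - ricOp j σ (L t) ((1 / 2 : ℝ) • p n t) (u n t)) -
          (Q t - ricOp j σ (L t) ((1 / 2 : ℝ) • q t) (v t))‖ ≤ (1 - c n t) * ‖Q t‖ +
          β * ‖u n t - v t‖ + ‖j‖ * (‖σ‖ * (√(ρ₁ n) + 2 * M) * √(ρ₁ n))
      rw [e3]
      have hd := hdq t ht n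
      have hs0 := Real.sqrt_nonneg (ρ₁ n)
      refine (norm_sub_le _ _).trans (add_le_add ((norm_sub_le _ _).trans (add_le_add ?_ ?_)) ?_)
      · rw [norm_neg, norm_smul, Real.norm_of_nonneg]
        have := (cutoff_mem_Icc f₁ n t).2
        linarith
      · exact hL.bounded t ht _
      · refine (norm_toDualV_apply_le _ _).trans (mul_le_mul_of_nonneg_left ?_ (norm_nonneg _))
        have h4 : ‖(1 / 2 : ℝ)‖ = 1 / 2 := by norm_num
        rw [norm_smul, h4]
        have h5 := σ.le_opNorm₂ (p n t + q t) (p n t - q t)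
        have h6 : ‖p n t + q t‖ ≤ √(ρ₁ n) + 2 * M := by
          have : p n t + q t = (p n t - q t) + (q t + q t) := by abel
          rw [this]
          refine (norm_add_le _ _).trans (add_le_add hd ((norm_add_le _ _).trans ?_))
          linarith [hM t ht]
        have h7 : ‖σ‖ * ‖p n t + q t‖ * ‖p n t - q t‖ ≤ ‖σ‖ * (√(ρ₁ n) + 2 * M) * √(ρ₁ n) :=
          mul_le_mul (mul_le_mul_of_nonneg_left h6 (norm_nonneg σ)) hd (norm_nonneg _)
            (mul_nonneg (norm_nonneg σ) ((norm_nonneg _).trans h6))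
        have h8 := norm_nonneg (σ (p n t + q t) (p n t - q t))
        linarith)
    rw [integral_add (integrable_fun_add i1 i2) i3, integral_add i1 i2, integral_const_mul,
      integral_const] at h1
    simpa [hT.le, mul_comm] using h1
  have hlim := squeeze_zero (fun n => integral_nonneg fun t => norm_nonneg _) bound (by
    have h1 := tendsto_integral_cutoff hf₁.1 iQ
    have h2 := (h1.add (hw1.const_mul β)).add (((((hs.add_const (2 * M)).const_mul ‖σ‖).mul
      hs).const_mul ‖j‖).mul_const T)
    simpa using h2)
  refine ⟨v, q, ⟨hv, hqc, hvq, fun t ht R => ?_⟩, hqm⟩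
  have h0 : (0 : ℝ) ∈ Icc 0 T := ⟨le_rfl, hT.le⟩
  have l1 : Tendsto (fun n => inner ℝ (p n t) (j R)) atTop (𝓝 (inner ℝ (q t) (j R))) :=
    (hq t ht).inner tendsto_const_nhds
  have l2 : Tendsto (fun n => ∫ s in (0 : ℝ)..t,
      (F n s - ricOp j σ (L s) ((1 / 2 : ℝ) • p n s) (u n s)) R) atTop (𝓝 (∫ s in (0 : ℝ)..t,
      (Q s - ricOp j σ (L s) ((1 / 2 : ℝ) • q s) (v s)) R)) := by
    rw [tendsto_iff_norm_sub_tendsto_zero]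
    have hlim' := hlim.mul_const (norm R)
    rw [zero_mul] at hlim'
    exact squeeze_zero (fun n => norm_nonneg _)
      (fun n => norm_integral_apply_sub_le (iGn n) iG ht R) hlim'
  have l3 : Tendsto (fun n => inner ℝ (p n t) (j R)) atTop (𝓝 (inner ℝ k₀ (j R) +
      ∫ s in (0 : ℝ)..t, (Q s - ricOp j σ (L s) ((1 / 2 : ℝ) • q s) (v s)) R)) := by
    simp only [(hup _).eq t ht R]
    exact l2.const_add _
  exact tendsto_nhds_unique l1 l3

end RiccatiData

end SumSpace

/-! ### Weak derivatives and the integrated equation -/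

section WeakForm

variable {X K : Type*} [NormedAddCommGroup X] [InnerProductSpace ℝ X] [CompleteSpace X]
  [NormedAddCommGroup K] [InnerProductSpace ℝ K] [CompleteSpace K]
  {j : X →L[ℝ] K} {T : ℝ} {k₀ : K} {u : ℝ → X} {p : ℝ → K}

theorem IsTestFunction.apply_left {φ : ℝ → ℝ} (hφ : IsTestFunction T φ) : φ 0 = 0 :=
  image_eq_zero_of_notMem_tsupport fun h => (hφ.2.2 h).1.false

theorem IsTestFunction.apply_right {φ : ℝ → ℝ} (hφ : IsTestFunction T φ) : φ T = 0 :=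
  image_eq_zero_of_notMem_tsupport fun h => (hφ.2.2 h).2.false

/-- Solutions of the integrated equation have the corresponding weak derivative. -/
theorem IsSol.weakDeriv {g : ℝ → StrongDual ℝ X} (hT : 0 < T) (h : IsSol j T g k₀ u p)
    (hg : Integrable g (timeMeasure T)) (R : X) {φ : ℝ → ℝ} (hφ : IsTestFunction T φ) :
    -(∫ t in (0 : ℝ)..T, inner ℝ (j (u t)) (j R) * deriv φ t) = ∫ t in (0 : ℝ)..T, g t R * φ t := by
  have hd : Continuous (deriv φ) := hφ.1.continuous_deriv (by simp)
  have h1 := integral_primitive_mul_deriv hT.le (hφ.1.of_le (by simp)) (integrable_apply hg R)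
  rw [hφ.apply_right, mul_zero, zero_sub] at h1
  have h2 : ∫ t in (0 : ℝ)..T, deriv φ t = 0 := by
    rw [intervalIntegral.integral_deriv_eq_sub (fun t _ => (hφ.1.differentiable (by simp)) t)
      (hd.intervalIntegrable _ _), hφ.apply_left, hφ.apply_right, sub_zero]
  have h3 : ∫ t in (0 : ℝ)..T, inner ℝ (j (u t)) (j R) * deriv φ t =
      ∫ t in (0 : ℝ)..T, (inner ℝ k₀ (j R) * deriv φ t +
        (∫ s in (0 : ℝ)..t, g s R) * deriv φ t) := by
    rw [intervalIntegral_eq_timeMeasure hT.le, intervalIntegral_eq_timeMeasure hT.le]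
    refine integral_congr_ae ?_
    filter_upwards [h.ae_eq, ae_restrict_mem measurableSet_Icc] with t h1 ht
    rw [h1, h.eq t ht R, add_mul]
  have i1 : IntervalIntegrable (fun t => (∫ s in (0 : ℝ)..t, g s R) * deriv φ t) volume 0 T := by
    refine ContinuousOn.intervalIntegrable ?_
    rw [uIcc_of_le hT.le]
    exact (continuousOn_primitive_timeMeasure (integrable_apply hg R)).mul hd.continuousOn
  rw [h3, intervalIntegral.integral_add ((hd.intervalIntegrable _ _).const_mul _) i1,
    intervalIntegral.integral_const_mul, h2, h1]
  ring

/-- A function with a weak derivative satisfies the integrated equation. -/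
theorem isSol_of_weakDeriv {g : ℝ → StrongDual ℝ X} (hT : 0 < T) (hu : MemLp u 2 (timeMeasure T))
    (hp : ContinuousOn p (Icc 0 T)) (hup : ∀ᵐ t ∂timeMeasure T, j (u t) = p t)
    (hg : Integrable g (timeMeasure T)) (h : ∀ R φ, IsTestFunction T φ →
      -(∫ t in (0 : ℝ)..T, inner ℝ (j (u t)) (j R) * deriv φ t) = ∫ t in (0 : ℝ)..T, g t R * φ t) :
    IsSol j T g (p 0) u p := by
  refine ⟨hu, hp, hup, fun t ht R => ?_⟩
  obtain ⟨c, hc⟩ := ae_eq_primitive_of_weakDeriv hT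
    (((j.comp_memLp' hu).integrable one_le_two).inner_const (j R)) (integrable_apply hg R) (h R)
  have h1 : EqOn (fun t => inner ℝ (p t) (j R)) (fun t => c + ∫ s in (0 : ℝ)..t, g s R)
      (Icc 0 T) := by
    refine Measure.eqOn_Icc_of_ae_eq volume hT.ne ?_ (hp.inner continuousOn_const)
      (continuousOn_const.add (continuousOn_primitive_timeMeasure (integrable_apply hg R)))
    filter_upwards [hc, hup] with t h1 h2
    rw [← h2]; exact h1
  have h2 := h1 ⟨le_rfl, hT.le⟩
  have h3 := h1 ht
  simp only [intervalIntegral.integral_same, add_zero] at h2 h3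
  rw [h3, h2]

theorem integral_sub_apply_mul {Q N : ℝ → StrongDual ℝ X} (hT : 0 < T)
    (hQ : Integrable Q (timeMeasure T)) (hN : Integrable N (timeMeasure T)) (R : X) {φ : ℝ → ℝ}
    (hφ : IsTestFunction T φ) : ∫ t in (0 : ℝ)..T, (Q t - N t) R * φ t =
      (∫ t in (0 : ℝ)..T, Q t R * φ t) - ∫ t in (0 : ℝ)..T, N t R * φ t := by
  have hi : ∀ {f : ℝ → ℝ}, Integrable f (timeMeasure T) →
      IntervalIntegrable (fun t => f t * φ t) volume 0 T := fun hf =>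
    (intervalIntegrable_of_timeMeasure hf ⟨le_rfl, hT.le⟩ ⟨hT.le, le_rfl⟩).mul_continuousOn
      hφ.1.continuous.continuousOn
  rw [← intervalIntegral.integral_sub (hi (integrable_apply hQ R)) (hi (integrable_apply hN R))]
  refine intervalIntegral.integral_congr fun t _ => ?_
  simp only [sub_apply]
  ring

end WeakForm

/-! ### The operator Riccati equation as an instance -/

section Instance

variable {V H : Type*}
  [NormedAddCommGroup V] [InnerProductSpace ℝ V] [CompleteSpace V]
  [TopologicalSpace.SeparableSpace V]
  [NormedAddCommGroup H] [InnerProductSpace ℝ H] [CompleteSpace H]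
  [TopologicalSpace.SeparableSpace H]
  {ι : V →L[ℝ] H} {C T μ η γ : ℝ} {a : ℝ → V →L[ℝ] StrongDual ℝ V}

theorem EvolutionData.congr {X : Type*} [NormedAddCommGroup X] [InnerProductSpace ℝ X] {T α β : ℝ}
    {L L' : ℝ → X →L[ℝ] StrongDual ℝ X} (h : EvolutionData X T L α β)
    (hL : ∀ t ∈ Icc 0 T, L t = L' t) : EvolutionData X T L' α β where
  α_pos := h.α_pos
  β_pos := h.β_pos
  coercive t ht := hL t ht ▸ h.coercive t ht
  bounded t ht := hL t ht ▸ h.bounded t ht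
  measurable u v := (h.measurable u v).congr (by
    filter_upwards [ae_restrict_mem measurableSet_Icc] with t ht
    rw [hL t ht])

theorem zero_mem_lowerClass {c : ℝ} (hc : c ≤ 0) : (0 : HS H H) ∈ lowerClass H c := by
  refine ⟨by rw [map_zero]; exact IsSelfAdjoint.zero _, fun u => ?_⟩
  rw [map_zero, zero_apply, inner_zero_left]
  exact mul_nonpos_of_nonpos_of_nonneg hc (sq_nonneg _)

theorem lyapunovL_pert_eq_ricOp (hι : DenseRange ι) (A : V →L[ℝ] StrongDual ℝ V) {B : HS H H}
    (hB : IsSelfAdjoint B.op) :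
    lyapunovL ι (pert ι A B.op) = ricOp (OpV.toHi ι) HS.symL (lyapunovL ι A) B :=
  ContinuousLinearMap.ext fun P => lyapunovL_pert hι A hB P

/-- The bridge to the abstract theory: `σ` is the anticommutator, so `½ σ(P, P) = P²`. Members of
the lower class are self-adjoint, which is what lets the perturbed form produce the anticommutator.
-/
theorem FormData.riccatiData (hD : FormData ι C T μ η γ a) :
    RiccatiData (OpV.toHi ι) T (fun t => lyapunovL ι (a t)) HS.symL (lowerClass H (-γ))
      {F | ∃ K ∈ lowerClass H (-γ ^ 2), F = hiToDual ι K} (μ - γ * C ^ 2) where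
  dense := OpV.denseRange_toHi hD.dense
  T_pos := hD.T_pos
  α_pos := sub_pos.2 hD.γ_lt
  symm := HS.symL_comm
  isClosed := isClosed_lowerClass _
  convex := convex_lowerClass _
  zero_mem := zero_mem_lowerClass (neg_nonpos.2 hD.γ_nonneg)
  zero_mem' := ⟨0, zero_mem_lowerClass (neg_nonpos.2 (sq_nonneg _)), (map_zero (hiL ι)).symm⟩
  evolution B hB hB' := by
    obtain ⟨β, h⟩ := hD.evolutionData hB hB'
    exact ⟨β, h.congr fun t ht => lyapunovL_pert_eq_ricOp hD.dense _ (hB' t ht).1⟩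
  exists_isSol B F k₀ hB hB' hF hF' hk₀ := by
    obtain ⟨u, p, h, hp⟩ := hD.exists_isSol hB hB' hF hF' hk₀
    refine ⟨u, p, h.congr ?_, hp⟩
    filter_upwards [ae_restrict_mem measurableSet_Icc] with t ht
    rw [lyapunovL_pert_eq_ricOp hD.dense _ (smul_half_mem_lowerClass (hB' t ht)).1]

/-- The norm of `𝒱` sees two components. The image in `ℋ` determines the first through `ι`, and its
adjoint determines the second. -/
theorem OpV.toHi_injective (hι : DenseRange ι) (hι' : Function.Injective ι) :
    Function.Injective (OpV.toHi ι) := by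
  have inj : ∀ S : HS H V, HS.compLeft ι S = 0 → S = 0 := fun S hS => by
    ext x
    have h1 : ι (S.op x) = 0 := by
      have := congrArg (fun K : HS H H => K.op x) hS
      simpa using this
    have h2 := hι' (h1.trans (map_zero ι).symm)
    simpa using h2
  rw [injective_iff_map_eq_zero]
  intro P hP
  have h1 : OpV.intoV ι P = 0 := inj _ hP
  have h2 : OpV.adjV ι P = 0 := inj _ (by rw [OpV.compLeft_adjV hι, hP, map_zero])
  have h3 := OpV.norm_sq_eq P
  rw [h1, h2, norm_zero] at h3
  simpa using h3

/-- The nonlinear terms of the Riccati equation. -/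
theorem ricOp_symL_eq {A : V →L[ℝ] StrongDual ℝ V} {P : OpV ι} {p : HS H H}
    (h : OpV.toHi ι P = p) : ricOp (OpV.toHi ι) HS.symL (lyapunovL ι A) ((1 / 2 : ℝ) • p) P =
      lyapunov ι A P + hiToDual ι (HS.square (OpV.toHi ι P)) := by
  rw [ricOp_apply, lyapunovL_apply, h, map_smul, smul_apply, HS.symL_self, smul_smul]
  norm_num
  rfl

end Instance

/-! ### Weak solutions of the abstract Riccati equation -/

section WeakRiccati

variable {X K : Type*} [NormedAddCommGroup X] [InnerProductSpace ℝ X] [CompleteSpace X]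
  [TopologicalSpace.SeparableSpace X]
  [NormedAddCommGroup K] [InnerProductSpace ℝ K] [CompleteSpace K]

namespace RiccatiData

variable {j : X →L[ℝ] K} {T : ℝ} {L : ℝ → X →L[ℝ] StrongDual ℝ X} {σ : K →L[ℝ] K →L[ℝ] K}
  {𝒞 : Set K} {𝒬 : Set (StrongDual ℝ X)} {α : ℝ} {Q N : ℝ → StrongDual ℝ X} {u : ℝ → X}
  {p : ℝ → K} {k₀ : K}

theorem integrable_of_decomposition {f₁ : ℝ → K} {f₂ : ℝ → StrongDual ℝ X}
    (hf₁ : MemLp f₁ 1 (timeMeasure T)) (hf₂ : MemLp f₂ 2 (timeMeasure T))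
    (hQ : ∀ᵐ t ∂timeMeasure T, Q t = toDualV j (f₁ t) + f₂ t) : Integrable Q (timeMeasure T) := by
  refine (integrable_fun_add (integrable_toDualV (j := j) (hf₁.integrable le_rfl))
    (hf₂.integrable one_le_two)).congr ?_
  filter_upwards [hQ] with t ht
  exact ht.symm

theorem integrable_nonlinear (hD : RiccatiData j T L σ 𝒞 𝒬 α) (hQ : Integrable Q (timeMeasure T))
    (hu : MemLp u 2 (timeMeasure T)) (hp : ContinuousOn p (Icc 0 T))
    (hup : ∀ᵐ t ∂timeMeasure T, j (u t) = p t)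
    (hN : ∀ᵐ t ∂timeMeasure T, N t = ricOp j σ (L t) ((1 / 2 : ℝ) • p t) (u t)) :
    Integrable N (timeMeasure T) := by
  refine (integrable_fun_sub hQ (hD.integrable_rhs hQ hu hp hup)).congr ?_
  filter_upwards [hN] with t ht
  rw [ht, sub_sub_cancel]

/-- The weak derivative of a solution of the integrated Riccati equation. -/
theorem weakDeriv (hD : RiccatiData j T L σ 𝒞 𝒬 α) (hQ : Integrable Q (timeMeasure T))
    (h : IsSol j T (fun t => Q t - ricOp j σ (L t) ((1 / 2 : ℝ) • p t) (u t)) k₀ u p)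
    (hN : ∀ᵐ t ∂timeMeasure T, N t = ricOp j σ (L t) ((1 / 2 : ℝ) • p t) (u t)) (R : X) {φ : ℝ → ℝ}
    (hφ : IsTestFunction T φ) : -(∫ t in (0 : ℝ)..T, inner ℝ (j (u t)) (j R) * deriv φ t) =
      ∫ t in (0 : ℝ)..T, (Q t - N t) R * φ t := by
  have iN := hD.integrable_nonlinear hQ h.memLp h.cont h.ae_eq hN
  have h1 : IsSol j T (fun t => Q t - N t) k₀ u p := h.congr (by
    filter_upwards [hN] with t ht
    rw [ht])
  exact h1.weakDeriv hD.T_pos (integrable_fun_sub hQ iN) R hφ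

/-- Solutions of the integrated Riccati equation satisfy its weak form. -/
theorem equation (hD : RiccatiData j T L σ 𝒞 𝒬 α) (hQ : Integrable Q (timeMeasure T))
    (h : IsSol j T (fun t => Q t - ricOp j σ (L t) ((1 / 2 : ℝ) • p t) (u t)) k₀ u p)
    (hN : ∀ᵐ t ∂timeMeasure T, N t = ricOp j σ (L t) ((1 / 2 : ℝ) • p t) (u t)) (R : X) {φ : ℝ → ℝ}
    (hφ : IsTestFunction T φ) :
    -(∫ t in (0 : ℝ)..T, inner ℝ (j (u t)) (j R) * deriv φ t) + ∫ t in (0 : ℝ)..T, N t R * φ t =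
      ∫ t in (0 : ℝ)..T, Q t R * φ t := by
  rw [hD.weakDeriv hQ h hN R hφ, integral_sub_apply_mul hD.T_pos hQ
    (hD.integrable_nonlinear hQ h.memLp h.cont h.ae_eq hN) R hφ, sub_add_cancel]

/-- Weak solutions of the Riccati equation satisfy the integrated equation. -/
theorem isSol_of_equation (hD : RiccatiData j T L σ 𝒞 𝒬 α) (hQ : Integrable Q (timeMeasure T))
    (hu : MemLp u 2 (timeMeasure T)) (hp : ContinuousOn p (Icc 0 T))
    (hup : ∀ᵐ t ∂timeMeasure T, j (u t) = p t)
    (hN : ∀ᵐ t ∂timeMeasure T, N t = ricOp j σ (L t) ((1 / 2 : ℝ) • p t) (u t))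
    (h : ∀ R φ, IsTestFunction T φ → -(∫ t in (0 : ℝ)..T, inner ℝ (j (u t)) (j R) * deriv φ t) +
      ∫ t in (0 : ℝ)..T, N t R * φ t = ∫ t in (0 : ℝ)..T, Q t R * φ t) :
    IsSol j T (fun t => Q t - ricOp j σ (L t) ((1 / 2 : ℝ) • p t) (u t)) (p 0) u p := by
  have iN := hD.integrable_nonlinear hQ hu hp hup hN
  refine (isSol_of_weakDeriv hD.T_pos hu hp hup (integrable_fun_sub hQ iN) fun R φ hφ => ?_).congr ?_
  · rw [integral_sub_apply_mul hD.T_pos hQ iN R hφ, ← h R φ hφ, add_sub_cancel_right]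
  · filter_upwards [hN] with t ht
    rw [ht]

/-- Uniqueness of weak solutions of the Riccati equation in `𝒞`. -/
theorem eq_of_equation (hD : RiccatiData j T L σ 𝒞 𝒬 α) (hj : Function.Injective j)
    (hQ : Integrable Q (timeMeasure T))
    (h : IsSol j T (fun t => Q t - ricOp j σ (L t) ((1 / 2 : ℝ) • p t) (u t)) k₀ u p)
    (hp : ∀ t ∈ Icc 0 T, p t ∈ 𝒞) {u' : ℝ → X} {p' : ℝ → K}
    (hu' : MemLp u' 2 (timeMeasure T)) (hc' : ContinuousOn p' (Icc 0 T))
    (hup' : ∀ᵐ t ∂timeMeasure T, j (u' t) = p' t) (hp' : ∀ t ∈ Icc 0 T, p' t ∈ 𝒞) (h0 : p' 0 = k₀)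
    (hN : ∀ᵐ t ∂timeMeasure T, N t = ricOp j σ (L t) ((1 / 2 : ℝ) • p' t) (u' t))
    (h' : ∀ R φ, IsTestFunction T φ → -(∫ t in (0 : ℝ)..T, inner ℝ (j (u' t)) (j R) * deriv φ t) +
      ∫ t in (0 : ℝ)..T, N t R * φ t = ∫ t in (0 : ℝ)..T, Q t R * φ t) :
    (∀ᵐ t ∂timeMeasure T, u' t = u t) ∧ EqOn p' p (Icc 0 T) := by
  have h1 := hD.isSol_of_equation hQ hu' hc' hup' hN h'
  rw [h0] at h1
  -- Uniqueness is first obtained for the continuous representatives; injectivity of `j` then lifts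
  -- it to the functions with values in `X`.
  have h2 : EqOn p' p (Icc 0 T) := hD.eqOn h1 h (hD.integrable_rhs hQ hu' hc' hup')
    (hD.integrable_rhs hQ h.memLp h.cont h.ae_eq) hp' hp
  refine ⟨?_, h2⟩
  filter_upwards [hup', h.ae_eq, ae_restrict_mem measurableSet_Icc] with t e1 e2 ht
  exact hj (by rw [e1, e2, h2 ht])

/-- The right hand side of the Riccati equation, decomposed. -/
theorem exists_decomposition (hD : RiccatiData j T L σ 𝒞 𝒬 α) {f₁ : ℝ → K}
    {f₂ : ℝ → StrongDual ℝ X} (hf₁ : MemLp f₁ 1 (timeMeasure T)) (hf₂ : MemLp f₂ 2 (timeMeasure T))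
    (hQ : ∀ᵐ t ∂timeMeasure T, Q t = toDualV j (f₁ t) + f₂ t) (hu : MemLp u 2 (timeMeasure T))
    (hp : ContinuousOn p (Icc 0 T)) (hup : ∀ᵐ t ∂timeMeasure T, j (u t) = p t)
    (hN : ∀ᵐ t ∂timeMeasure T, N t = ricOp j σ (L t) ((1 / 2 : ℝ) • p t) (u t)) :
    ∃ g₁ g₂, MemLp g₁ 1 (timeMeasure T) ∧ MemLp g₂ 2 (timeMeasure T) ∧
      ∀ᵐ t ∂timeMeasure T, Q t - N t = toDualV j (g₁ t) + g₂ t := by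
  obtain ⟨β, hL⟩ := hD.exists_evolutionData
  refine ⟨_, _, memLp_fun_sub hf₁ (memLp_of_continuousOn
    (continuousOn_bilin σ (f := fun t => (1 / 2 : ℝ) • p t) (by fun_prop) hp) 1),
    memLp_fun_sub hf₂ (hL.memLp_apply hu), ?_⟩
  filter_upwards [hQ, hup, hN] with t h1 h2 h3
  rw [h1, h3, ricOp_apply, h2, map_sub]
  abel

end RiccatiData

end WeakRiccati

end RiccatiHS

end

/-! ### The theorem for the operator Riccati equation -/

open RiccatiHS in
theorem mainTheorem2 {V H : Type*}
    [NormedAddCommGroup V] [InnerProductSpace ℝ V] [CompleteSpace V]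
    [TopologicalSpace.SeparableSpace V]
    [NormedAddCommGroup H] [InnerProductSpace ℝ H] [CompleteSpace H]
    [TopologicalSpace.SeparableSpace H]
    (ι : V →L[ℝ] H) (hι_inj : Function.Injective ι) (hι_dense : DenseRange ι)
    (hι_compact : IsCompactOperator ι)
    (C : ℝ) (hC : 0 < C) (hι_bound : ∀ v : V, ‖ι v‖ ≤ C * ‖v‖)
    (T : ℝ) (hT : 0 < T)
    (a : ℝ → V →L[ℝ] StrongDual ℝ V) (μ η : ℝ) (hμ : 0 < μ) (hη : 0 < η)
    (ha_pos : ∀ t ∈ Set.Icc 0 T, ∀ u : V, μ * ‖u‖ ^ 2 ≤ a t u u)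
    (ha_bdd : ∀ t ∈ Set.Icc 0 T, ∀ u v : V, |a t u v| ≤ η * ‖u‖ * ‖v‖)
    (ha_meas : ∀ u v : V, AEMeasurable (fun t => a t u v)
      (MeasureTheory.volume.restrict (Set.Icc 0 T)))
    (γ : ℝ) (hγ : 0 ≤ γ) (hγμ : γ < μ / C ^ 2)
    (Q : ℝ → OpVDual ι) (hQ : MemSum ι T Q)
    (hQ_lower : ∀ᵐ t ∂MeasureTheory.volume.restrict (Set.Icc 0 T),
      ∃ K ∈ lowerClass H (-γ ^ 2), Q t = hiToDual ι K)
    (P₀ : HS H H) (hP₀ : P₀ ∈ lowerClass H (-γ)) :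
    ∃ (P : ℝ → OpV ι) (p : ℝ → HS H H),
      IsWeakSolution ι T a Q P₀ P p ∧
      (∀ t ∈ Set.Icc 0 T, p t ∈ lowerClass H (-γ)) ∧
      ∀ (P' : ℝ → OpV ι) (p' : ℝ → HS H H),
        IsWeakSolution ι T a Q P₀ P' p' →
        (∀ t ∈ Set.Icc 0 T, p' t ∈ lowerClass H (-γ)) →
        (∀ᵐ t ∂MeasureTheory.volume.restrict (Set.Icc 0 T), P' t = P t) ∧
          Set.EqOn p' p (Set.Icc 0 T) := by
  have hD : FormData ι C T μ η γ a :=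
    { dense := hι_dense
      C_pos := hC
      norm_le := hι_bound
      T_pos := hT
      η_pos := hη
      coercive := ha_pos
      bounded := fun t ht u => ContinuousLinearMap.opNorm_le_bound _ (by positivity)
        fun v => ha_bdd t ht u v
      measurable := ha_meas
      γ_nonneg := hγ
      γ_lt := (lt_div_iff₀ (by positivity)).1 hγμ }
  have hR := hD.riccatiData
  obtain ⟨f₁, f₂, hf₁, hf₂, hQf⟩ := hQ
  have hQf' : ∀ᵐ t ∂timeMeasure T, Q t = toDualV (OpV.toHi ι) (f₁ t) + f₂ t := hQf
  have iQ := RiccatiData.integrable_of_decomposition hf₁ hf₂ hQf'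
  obtain ⟨P, p, hs, hp⟩ := hR.exists_riccati_sum hf₁ hf₂ (k₀ := P₀) (by
    filter_upwards [hQf', hQ_lower] with t h1 h2
    rw [← h1]
    exact h2) hP₀
  have hs' : IsSol (OpV.toHi ι) T (fun t => Q t - ricOp (OpV.toHi ι) HS.symL (lyapunovL ι (a t))
      ((1 / 2 : ℝ) • p t) (P t)) P₀ P p := hs.congr (by
    filter_upwards [hQf'] with t ht
    rw [ht])
  -- At the fixed point the linearised operator, with coefficient `½ p`, is the Lyapunov term plus
  -- the square. This holds for almost every time, where `P` agrees with its representative.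
  have hN : ∀ {P : ℝ → OpV ι} {p : ℝ → HS H H}, (∀ᵐ t ∂timeMeasure T, OpV.toHi ι (P t) = p t) →
      ∀ᵐ t ∂timeMeasure T, lyapunov ι (a t) (P t) + hiToDual ι (HS.square (OpV.toHi ι (P t))) =
        ricOp (OpV.toHi ι) HS.symL (lyapunovL ι (a t)) ((1 / 2 : ℝ) • p t) (P t) := fun h => by
    filter_upwards [h] with t ht
    exact (ricOp_symL_eq ht).symm
  have hNP := hN hs'.ae_eq
  obtain ⟨g₁, g₂, hg₁, hg₂, hg⟩ := hR.exists_decomposition hf₁ hf₂ hQf' hs'.memLp hs'.cont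
    hs'.ae_eq hNP
  -- The weak derivative of `P` is `Q` minus the Lyapunov and square terms, decomposed as `g₁ + g₂`:
  -- the square goes with the `L¹` part and the Lyapunov term with the `L²` part.
  refine ⟨P, p, ⟨⟨hs'.memLp, _, ⟨g₁, g₂, hg₁, hg₂, hg⟩, fun R φ hφ =>
    hR.weakDeriv iQ hs' hNP R hφ⟩, ⟨hs'.cont, hs'.ae_eq⟩,
    hs'.initial hR.dense hT.le, fun R φ hφ => hR.equation iQ hs' hNP R hφ⟩, hp,
    fun P' p' h' hp' => ?_⟩
  exact hR.eq_of_equation (OpV.toHi_injective hι_dense hι_inj) iQ hs' hp h'.memW.1 h'.contRep.1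
    h'.contRep.2 hp' h'.initial (hN h'.contRep.2) h'.equation
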